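/- For $f\in\mathbb C[x]$ let $\|f\|_\infty$ be the largest modulus of a coefficient, and let $\lg=\log_2$. Bit complexity is measured by the number of gates of Boolean circuits over the full binary basis (one circuit for each choice of the parameters), and $\mu(m)$ denotes the least number of gates of a circuit that multiplies two $m$-bit integers; a real argument of $\mu$ is rounded up. Polynomials are given to a circuit, and returned by it, as lists of complex coefficients whose real and imaginary parts are fixed-point binary numbers. Let $s,t\in\mathbb C[x]$, where $\deg s\le 2n$, $t$ is monic of degree $n$, $\|s\|_\infty\le 2^{\tau_1}$, $\|t\|_\infty\le 2^{\tau_2}$, and all the roots of $t$ have modulus at most $2^\rho$. Let $q$ and $r$ be the quotient and the remainder of the division of $s$ by $t$, that is, $s=tq+r$ with $\deg r<\deg t$. (a) If $n\ge 1$ and $\rho\ge 0$, then $\|q\|_\infty\le 2^{2n+\lg n+1+n\rho+\tau_1}$ and $\|r\|_\infty\le 2^{3n+\lg n+1+2n\rho+\tau_1}$. (b) Let $n\ge 2$, $\ell,\tau_1,\tau_2\ge 0$ and $\rho\ge 1$ be real parameters ($n$ an integer), and put $$\lambda=\ell+\tau_1+12\,\tau_2\lg n+80\lg^2 n+10(\rho+1)\,n\lg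 n+30 .$$ Then $\lambda=O(\ell+\tau_1+\tau_2\lg n+n\rho\lg n)$. Moreover, from any polynomials $\tilde s,\tilde t$ (of degree at most $2n$ and $n$, given as above) with $\|s-\tilde s\|_\infty\le 2^{-\lambda}$ and $\|t-\tilde t\|_\infty\le 2^{-\lambda}$ one can compute polynomials $\tilde q,\tilde r$ with $\|q-\tilde q\|_\infty\le 2^{-\ell}$ and $\|r-\tilde r\|_\infty\le 2^{-\ell}$ by a circuit, depending only on $n,\ell,\tau_1,\tau_2,\rho$ and on the input format, with $$O\bigl(n\,\lg^2 n\;\mu(\ell+\tau_1+(\tau_2+n\rho)\lg n)\bigr)$$ gates, and this number is also $\tilde O(n\ell+n\tau_1+n\tau_2+n^2\rho)$, where $\tilde O(X)$ means $O(X\lg^k X)$ for some fixed $k$. All the implied constants, and $k$, are absolute. -/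

import Mathlib

open Polynomial

/-- A Boolean circuit with inputs indexed by `ι` and exactly `g` gates. Each gate applies an
arbitrary binary Boolean operation (one bit operation) to two wires, each of which is an input
(`Sum.inl`) or an earlier gate (`Sum.inr`). -/
inductive Circuit (ι : Type) : ℕ → Type
  | nil : Circuit ι 0
  | gate {g : ℕ} (c : Circuit ι g) (op : Bool → Bool → Bool) (a b : ι ⊕ Fin g) : Circuit ι (g + 1)

namespace Circuit

/-- The values of all the gates on the input `x`, in the order of their creation. -/
def gateVal {ι : Type} : {g : ℕ} → Circuit ι g → (ι → Bool) → Fin g → Bool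
  | _, nil, _ => Fin.elim0
  | _, gate c op a b, x =>
      Fin.snoc (α := fun _ => Bool) (c.gateVal x)
        (op (Sum.elim x (c.gateVal x) a) (Sum.elim x (c.gateVal x) b))

/-- The value of a wire (an input or a gate) on the input `x`. -/
def wireVal {ι : Type} {g : ℕ} (c : Circuit ι g) (x : ι → Bool) : ι ⊕ Fin g → Bool :=
  Sum.elim x (c.gateVal x)

end Circuit

/-- The Boolean function `F` can be evaluated by a circuit with `g` gates: each output bit of `F`
is read off from a wire of the circuit. -/
def ComputableWithGates {ι κ : Type} (F : (ι → Bool) → κ → Bool) (g : ℕ) : Prop :=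
  ∃ (c : Circuit ι g) (out : κ → ι ⊕ Fin g), ∀ x k, c.wireVal x (out k) = F x k

/-- The multiplication of two `m`-bit integers, as a Boolean function from `2 m` input bits
to `2 m` output bits (least significant bit first). -/
def mulBits (m : ℕ) (x : Fin m ⊕ Fin m → Bool) (k : Fin (2 * m)) : Bool :=
  (Nat.ofBits (fun i => x (Sum.inl i)) * Nat.ofBits (fun i => x (Sum.inr i))).testBit k

/-- `mulCost m` is `μ(m)`, the bit complexity of multiplying two integers of size `m`: the least
number of gates of a Boolean circuit that multiplies two `m`-bit integers. -/
noncomputable def mulCost (m : ℕ) : ℕ :=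
  sInf {g : ℕ | ComputableWithGates (mulBits m) g}

/-- The integer written in two's complement with `w` value bits (least significant bit first) and
one sign bit. -/
def intOfBits {w : ℕ} (b : Fin (w + 1) → Bool) : ℤ :=
  (Nat.ofBits (fun i : Fin w => b i.castSucc) : ℤ) - if b (Fin.last w) then 2 ^ w else 0

/-- The index type of the bits that describe a polynomial with `d` complex coefficients: the
coefficient, its real (`0`) or imaginary (`1`) part, and the position of the bit. -/
abbrev PolyBit (d w : ℕ) : Type := Fin d × Fin 2 × Fin (w + 1)

/-- The polynomial of degree less than `d` whose coefficients have the real and imaginary parts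
described by the bits `b` as fixed-point numbers, that is two's complement integers divided
by `2 ^ p`. -/
noncomputable def polyOfBits (p : ℕ) {d w : ℕ} (b : PolyBit d w → Bool) : ℂ[X] :=
  ∑ j : Fin d, monomial (j : ℕ)
    (((intOfBits (fun i => b (j, 0, i)) : ℂ) + (intOfBits (fun i => b (j, 1, i)) : ℂ) * Complex.I)
      / 2 ^ p)

/-- The binary logarithm. -/
noncomputable def lg (x : ℝ) : ℝ := Real.logb 2 x

/-- The division problem: `s` has degree at most `2 n` and coefficients of modulus at most
`2 ^ τ₁`; `t` is monic of degree `n`, its coefficients have modulus at most `2 ^ τ₂` and its roots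
have modulus at most `2 ^ ρ`; `q` and `r` are the quotient and the remainder of `s` by `t`. -/
structure IsDivision (n : ℕ) (τ₁ τ₂ ρ : ℝ) (s t q r : ℂ[X]) : Prop where
  natDegree_s : s.natDegree ≤ 2 * n
  monic_t : t.Monic
  natDegree_t : t.natDegree = n
  norm_s : s.supNorm ≤ 2 ^ τ₁
  norm_t : t.supNorm ≤ 2 ^ τ₂
  norm_root : ∀ z : ℂ, t.IsRoot z → ‖z‖ ≤ 2 ^ ρ
  eq : s = t * q + r
  degree_r : r.degree < t.degree

/-- The input precision `λ`. -/
noncomputable def divPrecision (n : ℕ) (ℓ τ₁ τ₂ ρ : ℝ) : ℝ :=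
  ℓ + τ₁ + 12 * τ₂ * lg n + 80 * lg n ^ 2 + 10 * (ρ + 1) * n * lg n + 30

/-- The Boolean function `F` solves the approximate division problem for the precision `ℓ`. It
reads the `2 n + 1` coefficients of `s'` and the `n + 1` coefficients of `t'` (with `p` bits after
the binary point) and writes the `n + 1` coefficients of `q'` and the `n` coefficients of `r'`
(with `p'` bits after the binary point). Whenever `s'` and `t'` approximate `s` and `t` to the
precision `λ`, `q'` and `r'` approximate the quotient and the remainder of `s` by `t` to the
precision `ℓ`. -/
def SolvesDivision (n : ℕ) (ℓ τ₁ τ₂ ρ : ℝ) (p w p' w' : ℕ)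
    (F : (PolyBit (2 * n + 1) w ⊕ PolyBit (n + 1) w → Bool) →
      PolyBit (n + 1) w' ⊕ PolyBit n w' → Bool) : Prop :=
  ∀ s t q r : ℂ[X], IsDivision n τ₁ τ₂ ρ s t q r →
    ∀ x : PolyBit (2 * n + 1) w ⊕ PolyBit (n + 1) w → Bool,
      (s - polyOfBits p (fun i => x (Sum.inl i))).supNorm ≤ 2 ^ (-divPrecision n ℓ τ₁ τ₂ ρ) →
      (t - polyOfBits p (fun i => x (Sum.inr i))).supNorm ≤ 2 ^ (-divPrecision n ℓ τ₁ τ₂ ρ) →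
      (q - polyOfBits p' (fun i => F x (Sum.inl i))).supNorm ≤ 2 ^ (-ℓ) ∧
      (r - polyOfBits p' (fun i => F x (Sum.inr i))).supNorm ≤ 2 ^ (-ℓ)

/-!
Let `t` be monic of degree `n` with roots `z`. The reversal of `t` is the product of the `1 - z X`,
so its inverse `H` as a power series is the product of the geometric series `1 / (1 - z X)`. A
weighted `ℓ¹` norm with weight `2 ^ (-ρ - 1)`, for which each of these series has norm at most `2`,
bounds the coefficients of `H`. The reversal of the quotient is the product of `H` and the reversal
of `s`, truncated, which bounds the quotient and then the remainder.

To compute `H`, Newton's iteration is run on fixed-point numbers, that is on Gaussian integers with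
rounding after each step. A step doubles the number of correct coefficients and amplifies the
rounding error by a factor `2 ^ O(n ρ)`; there are `O(lg n)` steps, hence the summand `n ρ lg n` of
the precision. The polynomial products are evaluated modulo `2 ^ N + 1`, where the powers of `2` are
roots of unity for the fast Fourier transform and `± 2 ^ (N / 2)` serve as the images of `i`. Only
the pointwise products cost multiplications of integers; each is cut into a bounded number of
blocks, which brings in `μ`. The same transform, applied recursively, gives `μ(m) = O(m lg¹⁰ m)`.
-/

/-! ### Composition of circuits -/

namespace Circuit

variable {ι κ : Type} {g h : ℕ}

theorem wireVal_gate_castSucc (c : Circuit ι g) (op : Bool → Bool → Bool) (a b i : ι ⊕ Fin g)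
    (x : ι → Bool) :
    (c.gate op a b).wireVal x (Sum.map id Fin.castSucc i) = c.wireVal x i := by
  rcases i with i | i
  · rfl
  · exact Fin.snoc_castSucc (α := fun _ => Bool) _ _ i

theorem wireVal_gate_last (c : Circuit ι g) (op : Bool → Bool → Bool) (a b : ι ⊕ Fin g)
    (x : ι → Bool) :
    (c.gate op a b).wireVal x (Sum.inr (Fin.last g)) = op (c.wireVal x a) (c.wireVal x b) :=
  Fin.snoc_last (α := fun _ => Bool) _ _

theorem exists_comp (c : Circuit ι g) (out : κ → ι ⊕ Fin g) (d : Circuit κ h) :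
    ∃ (e : Circuit ι (g + h)) (fromC : ι ⊕ Fin g → ι ⊕ Fin (g + h))
      (fromD : κ ⊕ Fin h → ι ⊕ Fin (g + h)),
      (∀ x i, e.wireVal x (fromC i) = c.wireVal x i) ∧
      ∀ x j, e.wireVal x (fromD j) = d.wireVal (fun k => c.wireVal x (out k)) j := by
  induction d with
  | nil => exact ⟨c, id, Sum.elim out Fin.elim0, fun _ _ => rfl, fun x j => by
      rcases j with k | j
      · rfl
      · exact j.elim0⟩
  | @gate h d op a b ih =>
    obtain ⟨e, fromC, fromD, he_c, he_d⟩ := ih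
    let lift : ι ⊕ Fin (g + h) → ι ⊕ Fin (g + h + 1) := Sum.map id Fin.castSucc
    refine ⟨e.gate op (fromD a) (fromD b), lift ∘ fromC,
      Sum.elim (lift ∘ fromD ∘ Sum.inl)
        (Fin.snoc (α := fun _ => ι ⊕ Fin (g + h + 1)) (lift ∘ fromD ∘ Sum.inr)
          (Sum.inr (Fin.last _))),
      fun x i => (wireVal_gate_castSucc e op _ _ _ x).trans (he_c x i), fun x j => ?_⟩
    rcases j with k | j
    · exact (wireVal_gate_castSucc e op _ _ _ x).trans (he_d x _)
    · cases j using Fin.lastCases with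
      | last =>
        rw [Sum.elim_inr, Fin.snoc_last, wireVal_gate_last, wireVal_gate_last, he_d, he_d]
      | cast j =>
        rw [Sum.elim_inr, Fin.snoc_castSucc]
        exact ((wireVal_gate_castSucc e op _ _ _ x).trans (he_d x _)).trans
          (wireVal_gate_castSucc d op a b (Sum.inr j) _).symm

end Circuit

/-- The Boolean function `F` can be evaluated by a circuit with at most `g` gates. -/
def ComputableWithin {ι κ : Type} (F : (ι → Bool) → κ → Bool) (g : ℕ) : Prop :=
  ∃ g' ≤ g, ComputableWithGates F g'

namespace ComputableWithin

variable {ι κ ν : Type} {F : (ι → Bool) → κ → Bool} {g h : ℕ}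

theorem mono (hF : ComputableWithin F g) (hgh : g ≤ h) : ComputableWithin F h := by
  obtain ⟨g', hg', hF⟩ := hF
  exact ⟨g', hg'.trans hgh, hF⟩

theorem comp {G : (κ → Bool) → ν → Bool} (hG : ComputableWithin G h) (hF : ComputableWithin F g) :
    ComputableWithin (fun x => G (F x)) (g + h) := by
  obtain ⟨g', hg', c, out, hc⟩ := hF
  obtain ⟨h', hh', d, out', hd⟩ := hG
  obtain ⟨e, -, fromD, -, he⟩ := c.exists_comp out d
  refine ⟨g' + h', by omega, e, fromD ∘ out', fun x k => ?_⟩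
  rw [Function.comp_apply, he, hd, funext (hc x)]

theorem sumElim {G : (ι → Bool) → ν → Bool} (hF : ComputableWithin F g)
    (hG : ComputableWithin G h) : ComputableWithin (fun x => Sum.elim (F x) (G x)) (g + h) := by
  obtain ⟨g', hg', c, out, hc⟩ := hF
  obtain ⟨h', hh', d, out', hd⟩ := hG
  obtain ⟨e, fromC, fromD, he_c, he_d⟩ := c.exists_comp Sum.inl d
  refine ⟨g' + h', by omega, e, Sum.elim (fromC ∘ out) (fromD ∘ out'), ?_⟩
  rintro x (k | k)
  · exact (he_c x _).trans (hc x k)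
  · exact (he_d x _).trans (hd x k)

theorem wiring (f : κ → ι) : ComputableWithin (fun (x : ι → Bool) k => x (f k)) 0 :=
  ⟨0, le_rfl, .nil, fun k => .inl (f k), fun _ _ => rfl⟩

theorem rewire (hF : ComputableWithin F g) (f : ν → κ) :
    ComputableWithin (fun x k => F x (f k)) g :=
  (wiring f).comp hF

theorem uncurry_fin {n : ℕ} {F : Fin n → (ι → Bool) → κ → Bool} {g : Fin n → ℕ}
    (hF : ∀ i, ComputableWithin (F i) (g i)) :
    ComputableWithin (fun x (p : Fin n × κ) => F p.1 x p.2) (∑ i, g i) := by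
  induction n with
  | zero => exact ⟨0, by simp, .nil, fun p => p.1.elim0, fun _ p => p.1.elim0⟩
  | succ n ih =>
    rw [Fin.sum_univ_castSucc]
    convert ((ih fun i => hF i.castSucc).sumElim (hF (Fin.last n))).rewire
      fun p : Fin (n + 1) × κ => Fin.lastCases (motive := fun _ => Fin n × κ ⊕ κ)
        (.inr p.2) (fun i => .inl (i, p.2)) p.1 using 1
    funext x ⟨i, k⟩
    cases i using Fin.lastCases <;> simp

theorem uncurry {τ : Type} [Fintype τ] {F : τ → (ι → Bool) → κ → Bool} {g : τ → ℕ}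
    (hF : ∀ i, ComputableWithin (F i) (g i)) :
    ComputableWithin (fun x (p : τ × κ) => F p.1 x p.2) (∑ i, g i) := by
  let e := Fintype.equivFin τ
  rw [← Equiv.sum_comp e.symm g]
  simpa using (uncurry_fin fun j => hF (e.symm j)).rewire fun p : τ × κ => (e p.1, p.2)

theorem gate (op : Bool → Bool → Bool) (a b : ι) :
    ComputableWithin (fun (x : ι → Bool) (_ : Unit) => op (x a) (x b)) 1 :=
  ⟨1, le_rfl, Circuit.nil.gate op (.inl a) (.inl b), fun _ => .inr (Fin.last 0), fun x _ =>
    Circuit.wireVal_gate_last .nil op (.inl a) (.inl b) x⟩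

theorem op {κ' : Type} {G : (ι → Bool) → κ' → Bool} (o : Bool → Bool → Bool) (k : κ) (k' : κ')
    (hF : ComputableWithin F g) (hG : ComputableWithin G h) :
    ComputableWithin (fun x (_ : Unit) => o (F x k) (G x k')) (g + h + 1) :=
  (gate o (Sum.inl k) (Sum.inr k')).comp (hF.sumElim hG)

theorem wiring_or_const [Nonempty ι] (f : κ → ι ⊕ Bool) :
    ComputableWithin (fun (x : ι → Bool) k => Sum.elim x id (f k)) 2 := by
  obtain ⟨i⟩ := ‹Nonempty ι›
  have consts := (gate (fun _ _ => false) i i).sumElim (gate (fun _ _ => true) i i)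
  convert ((wiring (id : ι → ι)).sumElim consts).rewire fun k =>
    (f k).map id fun b => bif b then Sum.inr () else Sum.inl () using 1
  funext x k
  rcases f k with j | (_ | _) <;> rfl

end ComputableWithin

/-- A way of writing values as bit strings, given by the decoding of the bit strings. A value may
have several codes, or none. -/
structure BitEncoding where
  Index : Type
  Value : Type
  decode : (Index → Bool) → Value

namespace BitEncoding

/-- Pairs, encoded by the concatenation of the codes. -/
abbrev prod (A B : BitEncoding) : BitEncoding :=
  ⟨A.Index ⊕ B.Index, A.Value × B.Value, fun x => (A.decode (x ∘ .inl), B.decode (x ∘ .inr))⟩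

/-- Families indexed by `τ`, encoded by the family of the codes. -/
abbrev pow (A : BitEncoding) (τ : Type) : BitEncoding :=
  ⟨τ × A.Index, τ → A.Value, fun x i => A.decode fun k => x (i, k)⟩

/-- The encoding of `f v` by the codes of `v`. -/
abbrev map (A : BitEncoding) {V : Type} (f : A.Value → V) : BitEncoding :=
  ⟨A.Index, V, f ∘ A.decode⟩

end BitEncoding

/-- A circuit with at most `g` gates turns every code of `y ω` into a code of `z ω`, where the
parameter `ω` ranges over all the inputs of a computation. -/
def Computes {Ω : Type*} (A B : BitEncoding) (y : Ω → A.Value) (z : Ω → B.Value) (g : ℕ) : Prop :=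
  ∃ F : (A.Index → Bool) → B.Index → Bool, ComputableWithin F g ∧
    ∀ ω x, A.decode x = y ω → B.decode (F x) = z ω

namespace Computes

variable {Ω : Type*} {A B C : BitEncoding} {y : Ω → A.Value} {z : Ω → B.Value} {u : Ω → C.Value}
  {a b : ℕ}

theorem mono (h : Computes A B y z a) (hab : a ≤ b) : Computes A B y z b := by
  obtain ⟨F, hF, hFz⟩ := h
  exact ⟨F, hF.mono hab, hFz⟩

theorem of_wiring {f : A.Value → B.Value} (σ : B.Index → A.Index)
    (h : ∀ x, B.decode (x ∘ σ) = f (A.decode x)) : Computes A B id f 0 :=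
  ⟨_, .wiring σ, fun _ x hx => (h x).trans (congrArg f hx)⟩

theorem trans (h : Computes A B y z a) (h' : Computes B C z u b) :
    Computes A C y u (a + b) := by
  obtain ⟨F, hF, hFz⟩ := h
  obtain ⟨G, hG, hGu⟩ := h'
  exact ⟨_, hG.comp hF, fun ω x hx => hGu ω _ (hFz ω x hx)⟩

theorem apply {f : A.Value → B.Value} (h : Computes A B id f a) :
    Computes A B y (fun ω => f (y ω)) a := by
  obtain ⟨F, hF, hFf⟩ := h
  exact ⟨F, hF, fun ω x hx => (hFf _ x rfl).trans (congrArg f hx)⟩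

theorem andThen {f : B.Value → C.Value} (h : Computes A B y z a) (h' : Computes B C id f b) :
    Computes A C y (fun ω => f (z ω)) (a + b) :=
  h.trans h'.apply

theorem congr_of_mem_range {z' : Ω → B.Value} (h : Computes A B y z a)
    (hz : ∀ ω, y ω ∈ Set.range A.decode → z ω = z' ω) : Computes A B y z' a := by
  obtain ⟨F, hF, hFz⟩ := h
  exact ⟨F, hF, fun ω x hx => (hFz ω x hx).trans (hz ω ⟨x, hx⟩)⟩

theorem congr {z' : Ω → B.Value} (h : Computes A B y z a) (hz : ∀ ω, z ω = z' ω) :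
    Computes A B y z' a :=
  h.congr_of_mem_range fun ω _ => hz ω

theorem refl : Computes A A y y 0 := (of_wiring (f := id) id fun _ => rfl).apply

theorem pair (h : Computes A B y z a) (h' : Computes A C y u b) :
    Computes A (B.prod C) y (fun ω => (z ω, u ω)) (a + b) := by
  obtain ⟨F, hF, hFz⟩ := h
  obtain ⟨G, hG, hGu⟩ := h'
  exact ⟨_, hF.sumElim hG, fun ω x hx => Prod.ext (hFz ω x hx) (hGu ω x hx)⟩

theorem fst {y : Ω → (A.prod B).Value} : Computes (A.prod B) A y (fun ω => (y ω).1) 0 :=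
  (of_wiring (A := A.prod B) (f := Prod.fst) Sum.inl fun _ => rfl).apply

theorem snd {y : Ω → (A.prod B).Value} : Computes (A.prod B) B y (fun ω => (y ω).2) 0 :=
  (of_wiring (A := A.prod B) (f := Prod.snd) Sum.inr fun _ => rfl).apply

theorem pi {τ : Type} [Fintype τ] {z : Ω → τ → B.Value} {g : τ → ℕ}
    (h : ∀ i, Computes A B y (fun ω => z ω i) (g i)) :
    Computes A (B.pow τ) y z (∑ i, g i) := by
  choose F hF hFz using h
  exact ⟨_, .uncurry hF, fun ω x hx => funext fun i => hFz i ω x hx⟩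

theorem pi_const {τ : Type} [Fintype τ] {z : Ω → τ → B.Value} {g : ℕ}
    (h : ∀ i, Computes A B y (fun ω => z ω i) g) :
    Computes A (B.pow τ) y z (Fintype.card τ * g) :=
  (pi h).mono (by simp)

theorem proj {τ : Type} {y : Ω → (A.pow τ).Value} (i : τ) :
    Computes (A.pow τ) A y (fun ω => y ω i) 0 :=
  (of_wiring (A := A.pow τ) (f := fun v => v i) (fun k => (i, k)) fun _ => rfl).apply

theorem const [Nonempty A.Index] (b : B.Index → Bool) :
    Computes A B y (fun _ => B.decode b) 2 :=
  ⟨_, .wiring_or_const fun k => .inr (b k), fun _ _ _ => rfl⟩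

theorem map_intro {V : Type} (f : A.Value → V) : Computes A (A.map f) id f 0 :=
  of_wiring id fun _ => rfl

theorem map_elim {V : Type} {f : A.Value → V} {φ : V → B.Value}
    (h : Computes A B id (fun v => φ (f v)) a) : Computes (A.map f) B id φ a := by
  obtain ⟨F, hF, hFφ⟩ := h
  exact ⟨F, hF, fun ω x hx => (hFφ _ x rfl).trans (congrArg φ hx)⟩

end Computes

/-! ### Addition of natural numbers -/

theorem ofBits_eq_sum {n : ℕ} (x : Fin n → Bool) :
    Nat.ofBits x = ∑ i, (x i).toNat * 2 ^ (i : ℕ) := by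
  induction n with
  | zero => simp
  | succ n ih =>
    rw [Nat.ofBits_succ, ih, Fin.sum_univ_succ, Finset.mul_sum, add_comm]
    simp only [Fin.val_zero, pow_zero, mul_one, Fin.val_succ, pow_succ, Function.comp]
    exact congrArg _ (Finset.sum_congr rfl fun i _ => by ring)

theorem ofBits_window {K : ℕ} (x : Fin K → Bool) (s m : ℕ) :
    Nat.ofBits (fun i : Fin m => if h : s + i < K then x ⟨s + i, h⟩ else false) =
      Nat.ofBits x / 2 ^ s % 2 ^ m := by
  refine Nat.eq_of_testBit_eq fun j => ?_
  rw [Nat.testBit_mod_two_pow, Nat.testBit_div_two_pow, Nat.testBit_ofBits, Nat.testBit_ofBits]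
  by_cases hj : j < m <;> simp [hj, add_comm]

theorem ofBits_append {a b : ℕ} (x : Fin a → Bool) (y : Fin b → Bool) :
    Nat.ofBits (Fin.append x y) = Nat.ofBits x + 2 ^ a * Nat.ofBits y := by
  simp only [ofBits_eq_sum, Fin.sum_univ_add, Fin.append_left, Fin.append_right, Fin.val_castAdd,
    Fin.val_natAdd, Finset.mul_sum, pow_add]
  exact congrArg _ (Finset.sum_congr rfl fun i _ => by ring)

theorem ofBits_not {n : ℕ} (x : Fin n → Bool) :
    Nat.ofBits (fun i => !x i) = 2 ^ n - 1 - Nat.ofBits x := by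
  refine Nat.eq_of_testBit_eq fun j => ?_
  rw [Nat.sub_sub, add_comm 1, Nat.testBit_two_pow_sub_succ (Nat.ofBits_lt_two_pow x),
    Nat.testBit_ofBits, Nat.testBit_ofBits]
  by_cases hj : j < n <;> simp [hj]

namespace BitEncoding

/-- Natural numbers less than `2 ^ m`, in binary with the least significant bit first. -/
abbrev nat (m : ℕ) : BitEncoding := ⟨Fin m, ℕ, Nat.ofBits⟩

theorem mem_range_decode_prod {A B : BitEncoding} {v : (A.prod B).Value}
    (hv : v ∈ Set.range (A.prod B).decode) :
    v.1 ∈ Set.range A.decode ∧ v.2 ∈ Set.range B.decode := by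
  obtain ⟨x, rfl⟩ := hv
  exact ⟨⟨_, rfl⟩, ⟨_, rfl⟩⟩

theorem lt_two_pow_of_mem_range_decode {m : ℕ} {v : (nat m).Value}
    (hv : v ∈ Set.range (nat m).decode) : v < 2 ^ m := by
  obtain ⟨x, rfl⟩ := hv
  exact Nat.ofBits_lt_two_pow x

theorem lt_two_pow_of_mem_range_decode_prod {m k : ℕ} {v : ((nat m).prod (nat k)).Value}
    (hv : v ∈ Set.range ((nat m).prod (nat k)).decode) : v.1 < 2 ^ m ∧ v.2 < 2 ^ k :=
  (mem_range_decode_prod hv).imp lt_two_pow_of_mem_range_decode lt_two_pow_of_mem_range_decode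

end BitEncoding

open BitEncoding

namespace Computes

variable {Ω : Type*} {A : BitEncoding} {y : Ω → A.Value}

theorem nat_window {K : ℕ} [NeZero K] (s m : ℕ) :
    Computes (nat K) (nat m) id (fun x : ℕ => (x / 2 ^ s % 2 ^ m : ℕ)) 2 := by
  refine ⟨_, .wiring_or_const (κ := Fin m) (ι := Fin K)
    fun i => if h : s + i < K then .inl ⟨s + i, h⟩ else .inr false, ?_⟩
  rintro _ x rfl
  refine Eq.trans (congrArg Nat.ofBits (funext fun i => ?_)) (ofBits_window x s m)
  split_ifs <;> rfl

theorem nat_append {m k n : ℕ} (hn : m + k = n) :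
    Computes ((nat m).prod (nat k)) (nat n) id (fun p : ℕ × ℕ => (p.1 + 2 ^ m * p.2 : ℕ)) 0 := by
  subst hn
  refine of_wiring (A := (nat m).prod (nat k)) (B := nat (m + k))
    (Fin.append Sum.inl Sum.inr) fun x => ?_
  rw [← ofBits_append]
  exact congrArg Nat.ofBits (funext fun i => by cases i using Fin.addCases <;> simp)

theorem nat_not {m : ℕ} : Computes (nat m) (nat m) id (fun x : ℕ => (2 ^ m - 1 - x : ℕ)) m := by
  have nots := ComputableWithin.uncurry fun i : Fin m => .gate (fun b _ => !b) i i
  refine ⟨_, (nots.rewire fun i : Fin m => (i, ())).mono (by simp), ?_⟩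
  rintro _ x rfl
  exact ofBits_not x

theorem nat_zero [Nonempty A.Index] (m : ℕ) : Computes A (nat m) y (fun _ => (0 : ℕ)) 2 :=
  (const (B := nat m) fun _ : Fin m => false).congr fun _ => by simp [ofBits_eq_sum]

theorem nat_one [Nonempty A.Index] : Computes A (nat 1) y (fun _ => (1 : ℕ)) 2 :=
  (const (B := nat 1) fun _ : Fin 1 => true).congr fun _ => rfl

theorem nat_fullAdd :
    Computes ((nat 1).prod ((nat 1).prod (nat 1))) (nat 2) id
      (fun p : ℕ × ℕ × ℕ => (p.1 + p.2.1 + p.2.2 : ℕ)) 7 := by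
  have bits := ComputableWithin.wiring (κ := Fin 3) (ι := Fin 1 ⊕ Fin 1 ⊕ Fin 1)
    ![.inl 0, .inr (.inl 0), .inr (.inr 0)]
  have half := bits.op xor 0 1 bits
  have sum := half.op xor () 2 bits
  have carry := (half.op and () 2 bits).op or () () (bits.op and 0 1 bits)
  refine ⟨_, ((sum.sumElim carry).rewire ![.inl (), .inr ()]).mono (by norm_num), ?_⟩
  rintro _ x rfl
  simp only [ofBits_eq_sum, Fin.sum_univ_two, Fin.sum_univ_one, Function.comp,
    Matrix.cons_val_zero, Matrix.cons_val_one, Matrix.cons_val, Sum.elim_inl, Sum.elim_inr]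
  cases x (.inl 0) <;> cases x (.inr (.inl 0)) <;> cases x (.inr (.inr 0)) <;> rfl

theorem nat_add (w : ℕ) :
    Computes ((nat w).prod ((nat w).prod (nat 1))) (nat (w + 1)) id
      (fun p : ℕ × ℕ × ℕ => (p.1 + p.2.1 + p.2.2 : ℕ)) (20 * w) := by
  induction w with
  | zero =>
    refine (snd.trans snd).congr_of_mem_range fun p hp => ?_
    obtain ⟨hx, hyc⟩ := mem_range_decode_prod hp
    have hx := lt_two_pow_of_mem_range_decode hx
    have hy := (lt_two_pow_of_mem_range_decode_prod hyc).1
    dsimp only [id] at *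
    omega
  | succ w ih =>
    let A := (nat (w + 1)).prod ((nat (w + 1)).prod (nat 1))
    have x : Computes A (nat (w + 1)) id (fun p : ℕ × ℕ × ℕ => p.1) 0 := fst
    have y : Computes A (nat (w + 1)) id (fun p : ℕ × ℕ × ℕ => p.2.1) 0 := snd.trans fst
    have c : Computes A (nat 1) id (fun p : ℕ × ℕ × ℕ => p.2.2) 0 := snd.trans snd
    have low := ((x.andThen (nat_window 0 1)).pair
      ((y.andThen (nat_window 0 1)).pair c)).andThen nat_fullAdd
    have split := low.pair ((x.andThen (nat_window 1 w)).pair (y.andThen (nat_window 1 w)))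
    let B := (nat 2).prod ((nat w).prod (nat w))
    have l : Computes B (nat 2) id (fun p : ℕ × ℕ × ℕ => p.1) 0 := fst
    have xHigh : Computes B (nat w) id (fun p : ℕ × ℕ × ℕ => p.2.1) 0 := snd.trans fst
    have yHigh : Computes B (nat w) id (fun p : ℕ × ℕ × ℕ => p.2.2) 0 := snd.trans snd
    have high := (xHigh.pair (yHigh.pair (l.andThen (nat_window 1 1)))).andThen ih
    refine ((split.andThen (((l.andThen (nat_window 0 1)).pair high).andThen
      (nat_append (add_comm 1 (w + 1))))).mono (by omega)).congr_of_mem_range fun p hp => ?_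
    obtain ⟨hx, hyc⟩ := mem_range_decode_prod hp
    have hx := lt_two_pow_of_mem_range_decode hx
    obtain ⟨hy, hc⟩ := lt_two_pow_of_mem_range_decode_prod hyc
    obtain ⟨x, y, c⟩ := p
    dsimp only [id] at hx hy hc ⊢
    rw [pow_succ] at hx hy
    rw [pow_zero, pow_one, Nat.div_one, Nat.div_one, Nat.div_one,
      Nat.mod_eq_of_lt (Nat.div_lt_of_lt_mul (by rwa [mul_comm] at hx)),
      Nat.mod_eq_of_lt (Nat.div_lt_of_lt_mul (by rwa [mul_comm] at hy))]
    omega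

end Computes

/-! ### Arithmetic modulo `2 ^ N + 1` -/

/-- The ring of integers modulo `2 ^ N + 1`. Here `2` is a root of unity of order `2 N`, so that the
multiplication by a power of `2` is a rotation of bits and the products by the twiddle factors of
a fast Fourier transform are free. -/
abbrev Fermat (N : ℕ) : Type := ZMod (2 ^ N + 1)

theorem Fermat.two_pow_self (N : ℕ) : (2 : Fermat N) ^ N = -1 := by
  have h : ((2 ^ N + 1 : ℕ) : Fermat N) = 0 := ZMod.natCast_self _
  push_cast at h
  exact eq_neg_of_add_eq_zero_left h

theorem Fermat.two_pow_two_mul (N : ℕ) : (2 : Fermat N) ^ (2 * N) = 1 := by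
  rw [mul_comm, pow_mul, two_pow_self, neg_one_sq]

theorem Fermat.two_pow_mod (N e : ℕ) : (2 : Fermat N) ^ (e % (2 * N)) = 2 ^ e := by
  conv_rhs => rw [← Nat.div_add_mod e (2 * N), pow_add, pow_mul, two_pow_two_mul, one_pow, one_mul]

theorem Fermat.exists_two_mul_two_pow_mul_eq_one (N e : ℕ) [NeZero N] :
    ∃ j, 2 * (2 ^ j * 2 ^ e) = (1 : Fermat N) := by
  refine ⟨(2 * N - 1) * (e + 1), ?_⟩
  have h : (2 * N - 1) * (e + 1) + (e + 1) = 2 * N * (e + 1) := by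
    have := NeZero.one_le (n := N)
    rw [← Nat.succ_mul]
    exact congrArg (· * (e + 1)) (by omega)
  rw [mul_left_comm, ← pow_succ', ← pow_add, h, pow_mul, two_pow_two_mul, one_pow]

/-- Residues modulo `2 ^ N + 1`, given by any representative with `2 N` bits. -/
abbrev BitEncoding.fermat (N : ℕ) : BitEncoding :=
  (nat (2 * N)).map fun x : ℕ => (x : Fermat N)

theorem add_mod_add_div_lt {M x y : ℕ} (hx : x < M) (hy : y < M) :
    (x + y) % M + (x + y) / M < M := by
  have hdiv : (x + y) / M < 2 := Nat.div_lt_of_lt_mul (by omega)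
  have hmod := Nat.mod_lt (x + y) (by omega : 0 < M)
  have hsum := Nat.div_add_mod (x + y) M
  interval_cases (x + y) / M <;> omega

theorem mul_add_mod_succ {M hi lo : ℕ} (hhi : hi < M) (hlo : lo < M) :
    (M * hi + lo) % (M + 1) = if hi ≤ lo then lo - hi else M + 1 - (hi - lo) := by
  split_ifs with h
  · have : M * hi + lo = (lo - hi) + (M + 1) * hi := by rw [add_mul, one_mul]; omega
    rw [this, Nat.add_mul_mod_self_left, Nat.mod_eq_of_lt (by omega)]
  · obtain ⟨d, rfl⟩ : ∃ d, hi = d + 1 := ⟨hi - 1, by omega⟩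
    have : M * (d + 1) + lo = (M + 1 - (d + 1 - lo)) + (M + 1) * d := by
      rw [add_mul, one_mul, mul_add]; omega
    rw [this, Nat.add_mul_mod_self_left, Nat.mod_eq_of_lt (by omega)]

-- `lo - hi` is computed as `lo + (M - 1 - hi) + 1`; the borrow is added back since `M ≡ -1`.
theorem mul_add_mod_succ_mod {M hi lo : ℕ} (hhi : hi < M) (hlo : lo < M) :
    (M * hi + lo) % (M + 1) % M =
      ((lo + (M - 1 - hi) + 1) % M + (1 - (lo + (M - 1 - hi) + 1) / M)) % M := by
  rw [mul_add_mod_succ hhi hlo]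
  split_ifs with h
  · have : lo + (M - 1 - hi) + 1 = (lo - hi) + M := by omega
    rw [this, Nat.add_mod_right, Nat.add_div_right _ (by omega), Nat.div_eq_of_lt (by omega)]
    simp
  · have : lo + (M - 1 - hi) + 1 = M - (hi - lo) := by omega
    rw [this, Nat.div_eq_of_lt (by omega), Nat.mod_eq_of_lt (a := M - _) (by omega)]
    exact congrArg (· % M) (by omega)

theorem sum_blocks (M c x : ℕ) :
    ∑ i ∈ Finset.range c, 2 ^ (M * i) * (x / 2 ^ (M * i) % 2 ^ M) = x % 2 ^ (M * c) := by
  induction c with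
  | zero => simp [Nat.mod_one]
  | succ c ih => rw [Finset.sum_range_succ, ih, mul_add, mul_one, pow_add, Nat.mod_mul]

namespace Computes

variable {Ω : Type*} {A : BitEncoding} {y : Ω → A.Value} {a b N : ℕ}

theorem fermat_of_nat {m : ℕ} [NeZero m] (hm : m ≤ 2 * N) :
    Computes (nat m) (fermat N) id (fun x : ℕ => (x : Fermat N)) 2 := by
  refine ((nat_window 0 (2 * N)).andThen (map_intro _)).congr_of_mem_range fun x hx => ?_
  have hx' : x < 2 ^ (2 * N) :=
    (lt_two_pow_of_mem_range_decode hx).trans_le (Nat.pow_le_pow_right two_pos hm)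
  dsimp only [id] at hx' ⊢
  rw [pow_zero, Nat.div_one, Nat.mod_eq_of_lt hx']

theorem fermat_const [Nonempty A.Index] [NeZero N] (c : Fermat N) :
    Computes A (fermat N) y (fun _ => c) 2 := by
  refine (const (B := fermat N) fun i : Fin (2 * N) => c.val.testBit i).congr fun _ => ?_
  have hc : c.val < 2 ^ (2 * N) := by
    have h2 : 2 ^ 1 ≤ 2 ^ N := Nat.pow_le_pow_right two_pos NeZero.one_le
    rw [two_mul, pow_add]
    nlinarith [ZMod.val_lt c]
  simp [Nat.ofBits_testBit, Nat.mod_eq_of_lt hc]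

-- Addition with end-around carry, since `2 ^ (2 N) = 1`.
theorem fermat_add_id [NeZero N] : Computes ((fermat N).prod (fermat N)) (fermat N) id
    (fun p : Fermat N × Fermat N => p.1 + p.2) (100 * N) := by
  have hN : 1 ≤ N := NeZero.one_le
  refine map_elim (A := (nat (2 * N)).prod (nat (2 * N)))
    (f := fun p : ℕ × ℕ => ((p.1 : Fermat N), (p.2 : Fermat N))) ?_
  let A := (nat (2 * N)).prod (nat (2 * N))
  have x : Computes A (nat (2 * N)) id (fun p : ℕ × ℕ => p.1) 0 := fst
  have y : Computes A (nat (2 * N)) id (fun p : ℕ × ℕ => p.2) 0 := snd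
  have sum := (x.pair (y.pair (nat_zero 1))).andThen (nat_add (2 * N))
  have carried := (((nat_window (K := 2 * N + 1) 0 (2 * N)).pair
    ((nat_zero (2 * N)).pair (nat_window (2 * N) 1))).andThen (nat_add (2 * N))).andThen
    (nat_window 0 (2 * N))
  refine (((sum.andThen carried).andThen (map_intro _)).mono (by omega)).congr_of_mem_range
    fun p hp => ?_
  obtain ⟨hx, hy⟩ := lt_two_pow_of_mem_range_decode_prod hp
  dsimp only [id] at hx hy ⊢
  generalize p.1 = x, p.2 = y at hx hy ⊢
  have hcarry : (x + y) / 2 ^ (2 * N) < 2 := Nat.div_lt_of_lt_mul (by omega)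
  have hwrap : ((x + y : ℕ) : Fermat N) =
      ((x + y) % 2 ^ (2 * N) + (x + y) / 2 ^ (2 * N) : ℕ) := by
    conv_lhs => rw [← Nat.mod_add_div (x + y) (2 ^ (2 * N))]
    push_cast
    rw [Fermat.two_pow_two_mul, one_mul]
  rw [pow_zero, pow_one, add_zero, add_zero, Nat.div_one, Nat.div_one, Nat.mod_eq_of_lt hcarry,
    Nat.mod_eq_of_lt (add_mod_add_div_lt hx hy), ← hwrap, Nat.cast_add]

theorem fermat_two_pow_mul [NeZero N] (e : ℕ) :
    Computes (fermat N) (fermat N) id (fun x : Fermat N => 2 ^ e * x) 0 := by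
  have : NeZero (2 * N) := ⟨by have := NeZero.ne N; omega⟩
  let shift : Fin (2 * N) := Fin.ofNat (2 * N) e
  refine of_wiring (A := fermat N) (B := fermat N) (fun i : Fin (2 * N) => i - shift) fun x => ?_
  simp only [Function.comp, ofBits_eq_sum]
  push_cast
  rw [Finset.mul_sum, ← Equiv.sum_comp (Equiv.addRight shift)]
  refine Finset.sum_congr rfl fun i _ => ?_
  have htwo : (2 : Fermat N) ^ ((i + shift : Fin (2 * N)) : ℕ) = 2 ^ (i + e : ℕ) := by
    rw [Fin.val_add, Fin.val_ofNat, Nat.add_mod_mod, Fermat.two_pow_mod]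
  rw [Equiv.coe_addRight, add_sub_cancel_right, htwo, pow_add]
  ring

theorem fermat_neg [NeZero N] {z : Ω → Fermat N} (h : Computes A (fermat N) y z a) :
    Computes A (fermat N) y (fun ω => -z ω) a :=
  (h.andThen (fermat_two_pow_mul N)).congr fun ω => by rw [Fermat.two_pow_self, neg_one_mul]

theorem fermat_add [NeZero N] {z z' : Ω → Fermat N} (h : Computes A (fermat N) y z a)
    (h' : Computes A (fermat N) y z' b) :
    Computes A (fermat N) y (fun ω => z ω + z' ω) (a + b + 100 * N) :=
  (h.pair h').andThen fermat_add_id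

theorem fermat_sub [NeZero N] {z z' : Ω → Fermat N} (h : Computes A (fermat N) y z a)
    (h' : Computes A (fermat N) y z' b) :
    Computes A (fermat N) y (fun ω => z ω - z' ω) (a + b + 100 * N) :=
  (h.fermat_add h'.fermat_neg).congr fun _ => (sub_eq_add_neg _ _).symm

theorem fermat_sum [NeZero N] [Nonempty A.Index] {τ : Type*} (s : Finset τ)
    {z : τ → Ω → Fermat N} {g : ℕ} (h : ∀ i ∈ s, Computes A (fermat N) y (z i) g) :
    Computes A (fermat N) y (fun ω => ∑ i ∈ s, z i ω) (s.card * (g + 100 * N) + 2) := by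
  classical
  induction s using Finset.induction_on with
  | empty => simpa using fermat_const 0
  | insert i s hi ih =>
    have step := (h i (Finset.mem_insert_self i s)).fermat_add
      (ih fun j hj => h j (Finset.mem_insert_of_mem hj))
    refine (step.mono ?_).congr fun ω => (Finset.sum_insert (f := fun j => z j ω) hi).symm
    rw [Finset.card_insert_of_notMem hi]
    ring_nf
    omega

theorem nat_val_fermat [NeZero N] :
    Computes (fermat N) (nat N) id (fun x : Fermat N => (x.val % 2 ^ N : ℕ)) (100 * N) := by
  have hN : 1 ≤ N := NeZero.one_le
  have : NeZero (2 * N) := ⟨by omega⟩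
  refine map_elim ?_
  have diff := ((nat_window (K := 2 * N) 0 N).pair
    (((nat_window N N).andThen nat_not).pair nat_one)).andThen (nat_add N)
  have addBorrow := (((nat_window (K := N + 1) 0 N).pair ((nat_zero N).pair
    ((nat_window N 1).andThen nat_not))).andThen (nat_add N)).andThen (nat_window 0 N)
  refine ((diff.andThen addBorrow).mono (by omega)).congr_of_mem_range fun (x : ℕ) hx => ?_
  have hx := lt_two_pow_of_mem_range_decode hx
  dsimp only [id] at hx ⊢
  rw [two_mul, pow_add] at hx
  have hhi : x / 2 ^ N < 2 ^ N := Nat.div_lt_of_lt_mul hx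
  have hlo : x % 2 ^ N < 2 ^ N := Nat.mod_lt x (by positivity)
  have hborrow : (x % 2 ^ N + (2 ^ N - 1 - x / 2 ^ N) + 1) / 2 ^ N < 2 :=
    Nat.div_lt_of_lt_mul (by generalize x / 2 ^ N = hi, x % 2 ^ N = lo at hhi hlo ⊢; omega)
  rw [pow_zero, pow_one, Nat.div_one, Nat.div_one, Nat.div_one, add_zero, Nat.mod_eq_of_lt hhi,
    Nat.mod_eq_of_lt hborrow, ZMod.val_natCast]
  conv_rhs => rw [← Nat.div_add_mod x (2 ^ N)]
  exact (mul_add_mod_succ_mod hhi hlo).symm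

theorem fermat_mul_of_blocks [NeZero N] {M c g : ℕ} [NeZero M] (hMN : M ≤ N)
    (hc : 2 * N ≤ M * c)
    (hmul : Computes ((nat M).prod (nat M)) (nat (2 * M)) id
      (fun p : ℕ × ℕ => (p.1 * p.2 : ℕ)) g) :
    Computes ((fermat N).prod (fermat N)) (fermat N) id
      (fun p : Fermat N × Fermat N => p.1 * p.2) (c * c * (g + 6 + 100 * N) + 2) := by
  have : NeZero (2 * N) := ⟨by have := NeZero.ne N; omega⟩
  have : NeZero (2 * M) := ⟨by have := NeZero.ne M; omega⟩
  refine map_elim (A := (nat (2 * N)).prod (nat (2 * N)))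
    (f := fun p : ℕ × ℕ => ((p.1 : Fermat N), (p.2 : Fermat N))) ?_
  have xBlock (i : ℕ) := (fst (A := nat (2 * N)) (B := nat (2 * N)) (y := id)).andThen
    (nat_window (M * i) M)
  have yBlock (i : ℕ) := (snd (A := nat (2 * N)) (B := nat (2 * N)) (y := id)).andThen
    (nat_window (M * i) M)
  have term (ij : ℕ × ℕ) := ((((xBlock ij.1).pair (yBlock ij.2)).andThen hmul).andThen
    (fermat_of_nat (N := N) (by omega))).andThen (fermat_two_pow_mul (M * ij.1 + M * ij.2))
  refine ((fermat_sum (Finset.range c ×ˢ Finset.range c) fun i _ => term i).mono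
    (le_of_eq ?_)).congr_of_mem_range fun p hp => ?_
  · rw [Finset.card_product, Finset.card_range]
    ring
  have sum_blocks_eq (x : ℕ) (hx : x < 2 ^ (2 * N)) : x = ∑ i ∈ Finset.range c,
      2 ^ (M * i) * (x / 2 ^ (M * i) % 2 ^ M) := by
    rw [sum_blocks, Nat.mod_eq_of_lt (hx.trans_le (Nat.pow_le_pow_right two_pos hc))]
  obtain ⟨hx, hy⟩ := lt_two_pow_of_mem_range_decode_prod hp
  dsimp only [id] at hx hy ⊢
  conv_rhs => rw [sum_blocks_eq _ hx, sum_blocks_eq _ hy]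
  push_cast
  rw [Finset.sum_product, Finset.sum_mul_sum]
  refine Finset.sum_congr rfl fun i _ => Finset.sum_congr rfl fun j _ => ?_
  rw [pow_add]
  ring

end Computes

/-! ### The fast Fourier transform -/

section PolynomialOfFn

variable {R : Type*} [Semiring R] [DecidableEq R]

theorem ofFn_fin_append {m k : ℕ} (u : Fin m → R) (v : Fin k → R) :
    ofFn (m + k) (Fin.append u v) = ofFn m u + X ^ m * ofFn k v := by
  simp only [ofFn_eq_sum_monomial, Fin.sum_univ_add, Fin.append_left, Fin.append_right,
    Fin.val_castAdd, Fin.val_natAdd, Finset.mul_sum, X_pow_mul_monomial, add_comm m]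

theorem ofFn_toFn_of_degree_lt {m : ℕ} {f : R[X]} (hf : f.degree < m) :
    ofFn m (toFn m f) = f := by
  ext j
  by_cases hj : j < m
  · rw [ofFn_coeff_eq_val_of_lt _ hj]
    rfl
  · rw [ofFn_coeff_eq_zero_of_ge _ (not_lt.mp hj),
      (degree_lt_iff_coeff_zero _ _).mp hf j (not_lt.mp hj)]

end PolynomialOfFn

theorem sq_sub_sq_dvd_of_sub_dvd_of_add_dvd {R : Type*} [CommRing R]
    {x a c u₀ u₁ v₀ v₁ f g : R} (hc : 2 * (c * a) = 1)
    (hf : x - a ∣ (u₀ + a * u₁) * (v₀ + a * v₁) - f)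
    (hg : x + a ∣ (u₀ - a * u₁) * (v₀ - a * v₁) - g) :
    x ^ 2 - a ^ 2 ∣ (u₀ + x * u₁) * (v₀ + x * v₁) - (c * a * (f + g) + x * (c * (f - g))) := by
  obtain ⟨k, hk⟩ := hf
  obtain ⟨k', hk'⟩ := hg
  have coprime : IsCoprime (x - a) (x + a) := ⟨-c, c, by linear_combination hc⟩
  rw [sq_sub_sq, mul_comm]
  refine coprime.mul_dvd
    ⟨k + u₁ * v₀ + u₀ * v₁ + (x + a) * u₁ * v₁ - c * (f - g), ?_⟩
    ⟨k' + u₁ * v₀ + u₀ * v₁ + (x - a) * u₁ * v₁ - c * (f - g), ?_⟩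
  · linear_combination hk - f * hc
  · linear_combination hk' - g * hc

/-- The reduction modulo `X ^ m - a` of a polynomial of degree less than `2 m`, as an operation on
the lists of coefficients. -/
def foldCoeffs {R : Type*} [CommRing R] {m : ℕ} (a : R) (u : Fin (m + m) → R) (i : Fin m) : R :=
  u (Fin.castAdd m i) + a * u (Fin.natAdd m i)

section Fold

variable {R : Type*} [CommRing R] [DecidableEq R] {m : ℕ} {a : R}

theorem ofFn_foldCoeffs (u : Fin (m + m) → R) :
    ofFn m (foldCoeffs a u) =
      ofFn m (fun i => u (Fin.castAdd m i)) + C a * ofFn m (fun i => u (Fin.natAdd m i)) := by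
  rw [← smul_eq_C_mul, ← map_smul, ← map_add]
  rfl

theorem X_pow_sub_C_sq_dvd_of_foldCoeffs {c : R} {u v : Fin (m + m) → R} {f g : Fin m → R}
    (hc : 2 * (c * a) = 1)
    (hf : X ^ m - C a ∣ ofFn m (foldCoeffs a u) * ofFn m (foldCoeffs a v) - ofFn m f)
    (hg : X ^ m - C (-a) ∣ ofFn m (foldCoeffs (-a) u) * ofFn m (foldCoeffs (-a) v) - ofFn m g) :
    X ^ (m + m) - C (a ^ 2) ∣ ofFn (m + m) u * ofFn (m + m) v -
      ofFn (m + m) (Fin.append ((c * a) • (f + g)) (c • (f - g))) := by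
  have hc' : 2 * (C c * C a) = (1 : R[X]) := by
    rw [← C_ofNat, ← C_mul, ← C_mul, hc, C_1]
  simp only [ofFn_foldCoeffs, C_neg, neg_mul, sub_neg_eq_add, ← sub_eq_add_neg] at hf hg
  have := sq_sub_sq_dvd_of_sub_dvd_of_add_dvd hc' hf hg
  rw [← Fin.append_castAdd_natAdd (f := u), ← Fin.append_castAdd_natAdd (f := v)]
  simpa only [ofFn_fin_append, map_smul, map_add, map_sub, smul_eq_C_mul, C_mul, C_pow, pow_add,
    ← sq] using this

end Fold

/-- The products modulo `X ^ m - 2 ^ e` of polynomials over the integers modulo `2 ^ N + 1` can be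
computed with at most `g` gates. The result `f (u, v)` is the list of coefficients of some
polynomial of degree less than `m` in the right residue class. -/
def ComputesMulMod (N m e g : ℕ) : Prop :=
  ∃ f : (Fin m → Fermat N) × (Fin m → Fermat N) → Fin m → Fermat N,
    Computes (((fermat N).pow (Fin m)).prod ((fermat N).pow (Fin m))) ((fermat N).pow (Fin m))
      id f g ∧
    ∀ u v, X ^ m - C (2 ^ e : Fermat N) ∣ ofFn m u * ofFn m v - ofFn m (f (u, v))

theorem Computes.fermat_fold {N m : ℕ} [NeZero N] (e : ℕ) :
    Computes ((fermat N).pow (Fin (m + m))) ((fermat N).pow (Fin m)) id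
      (foldCoeffs (2 ^ e)) (m * (100 * N)) :=
  (pi_const fun _ => (proj _).fermat_add ((proj _).andThen (fermat_two_pow_mul e))).mono (by simp)

theorem Computes.fermat_unfold {N m : ℕ} [NeZero N] (i j : ℕ) :
    Computes (((fermat N).pow (Fin m)).prod ((fermat N).pow (Fin m)))
      ((fermat N).pow (Fin (m + m))) id
      (fun p : (Fin m → Fermat N) × (Fin m → Fermat N) =>
        Fin.append ((2 ^ i : Fermat N) • (p.1 + p.2)) ((2 ^ j : Fermat N) • (p.1 - p.2)))
      (2 * m * (100 * N)) := by
  let A := ((fermat N).pow (Fin m)).prod ((fermat N).pow (Fin m))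
  have left (k : Fin m) : Computes A (fermat N) id
      (fun p : (Fin m → Fermat N) × (Fin m → Fermat N) => p.1 k) 0 := fst.trans (proj k)
  have right (k : Fin m) : Computes A (fermat N) id
      (fun p : (Fin m → Fermat N) × (Fin m → Fermat N) => p.2 k) 0 := snd.trans (proj k)
  refine (pi_const (g := 100 * N) fun k => ?_).mono (by simp [two_mul])
  cases k using Fin.addCases with
  | left k =>
    refine ((((left k).fermat_add (right k)).andThen (fermat_two_pow_mul i)).mono
      (by omega)).congr fun p => ?_
    rw [Fin.append_left, Pi.smul_apply, Pi.add_apply, smul_eq_mul]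
  | right k =>
    refine ((((left k).fermat_sub (right k)).andThen (fermat_two_pow_mul j)).mono
      (by omega)).congr fun p => ?_
    rw [Fin.append_right, Pi.smul_apply, Pi.sub_apply, smul_eq_mul]

namespace ComputesMulMod

variable {N m e g g' : ℕ}

theorem one (h : Computes ((fermat N).prod (fermat N)) (fermat N) id
    (fun p : Fermat N × Fermat N => p.1 * p.2) g) : ComputesMulMod N 1 e g := by
  refine ⟨fun p _ => p.1 0 * p.2 0, ?_, fun u v => ?_⟩
  · exact (Computes.pi_const fun _ => (((Computes.fst.trans (Computes.proj 0)).pair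
      (Computes.snd.trans (Computes.proj 0))).andThen h)).mono (by simp)
  · simp [ofFn_eq_sum_monomial]

theorem double [NeZero N] (h : ComputesMulMod N m e g) (h' : ComputesMulMod N m (e + N) g') :
    ComputesMulMod N (m + m) (2 * e) (g + g' + 600 * m * N) := by
  obtain ⟨f, hf, hfdvd⟩ := h
  obtain ⟨f', hf', hfdvd'⟩ := h'
  let V := (fermat N).pow (Fin (m + m))
  let F (k : ℕ) (u : Fin (m + m) → Fermat N) : Fin m → Fermat N := foldCoeffs (2 ^ k) u
  obtain ⟨j, hj⟩ := Fermat.exists_two_mul_two_pow_mul_eq_one N e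
  refine ⟨fun p => Fin.append
    ((2 ^ (j + e) : Fermat N) • (f (F e p.1, F e p.2) + f' (F (e + N) p.1, F (e + N) p.2)))
    ((2 ^ j : Fermat N) • (f (F e p.1, F e p.2) - f' (F (e + N) p.1, F (e + N) p.2))),
    ?_, fun u v => ?_⟩
  · have left : Computes (V.prod V) V id (fun p => p.1) 0 := Computes.fst
    have right : Computes (V.prod V) V id (fun p => p.2) 0 := Computes.snd
    have folded (k : ℕ) := (left.andThen (Computes.fermat_fold k)).pair
      (right.andThen (Computes.fermat_fold k))
    refine ((((folded e).andThen hf).pair ((folded (e + N)).andThen hf')).andThen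
      (Computes.fermat_unfold (j + e) j)).mono (le_of_eq ?_)
    ring
  · have hneg : (2 : Fermat N) ^ (e + N) = -2 ^ e := by
      rw [pow_add, Fermat.two_pow_self, mul_neg_one]
    have hfdvd'_neg := hfdvd' (F (e + N) u) (F (e + N) v)
    simp only [F, hneg] at hfdvd'_neg ⊢
    rw [mul_comm 2 e, pow_mul, pow_add (2 : Fermat N)]
    exact X_pow_sub_C_sq_dvd_of_foldCoeffs hj (hfdvd _ _) hfdvd'_neg

theorem two_pow [NeZero N] (h : Computes ((fermat N).prod (fermat N)) (fermat N) id
    (fun p : Fermat N × Fermat N => p.1 * p.2) g) (k : ℕ) (hk : 2 ^ k ∣ N) :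
    ∀ e, 2 ^ k ∣ e → ComputesMulMod N (2 ^ k) e (2 ^ k * (g + 300 * k * N)) := by
  induction k with
  | zero => exact fun e _ => by simpa using one h
  | succ k ih =>
    rintro e ⟨d, rfl⟩
    have hkN : 2 ^ k ∣ N := (pow_dvd_pow 2 k.le_succ).trans hk
    have hexp : 2 ^ (k + 1) * d = 2 * (2 ^ k * d) := by ring
    have hcost : 2 ^ (k + 1) * (g + 300 * (k + 1) * N) = 2 ^ k * (g + 300 * k * N) +
        2 ^ k * (g + 300 * k * N) + 600 * 2 ^ k * N := by ring
    rw [hexp, hcost, pow_succ, mul_two]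
    exact (ih hkN (2 ^ k * d) (dvd_mul_right _ _)).double
      (ih hkN (2 ^ k * d + N) (dvd_add (dvd_mul_right _ _) hkN))

end ComputesMulMod

theorem Computes.fermat_polynomial_mul {N g k : ℕ} [NeZero N]
    (h : Computes ((fermat N).prod (fermat N)) (fermat N) id
      (fun p : Fermat N × Fermat N => p.1 * p.2) g) (hk : 2 ^ k ∣ N) {Ω : Type*}
    {u v : Ω → (Fermat N)[X]} (hu : ∀ ω, (u ω).degree < (2 ^ k : ℕ))
    (hv : ∀ ω, (v ω).degree < (2 ^ k : ℕ)) (huv : ∀ ω, (u ω * v ω).degree < (2 ^ k : ℕ)) :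
    Computes (((fermat N).pow (Fin (2 ^ k))).prod ((fermat N).pow (Fin (2 ^ k))))
      ((fermat N).pow (Fin (2 ^ k))) (fun ω => (toFn _ (u ω), toFn _ (v ω)))
      (fun ω => toFn _ (u ω * v ω)) (2 ^ k * (g + 300 * k * N)) := by
  obtain ⟨f, hf, hfdvd⟩ := ComputesMulMod.two_pow h k hk 0 (dvd_zero _)
  refine hf.apply.congr fun ω => ?_
  have hdvd := hfdvd (toFn _ (u ω)) (toFn _ (v ω))
  rw [ofFn_toFn_of_degree_lt (hu ω), ofFn_toFn_of_degree_lt (hv ω)] at hdvd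
  have : Nontrivial (Fermat N) := ZMod.nontrivial_iff.mpr (by simp)
  have heq : u ω * v ω - ofFn _ (f (toFn _ (u ω), toFn _ (v ω))) = 0 := by
    by_contra hne
    refine (monic_X_pow_sub_C (2 ^ 0 : Fermat N) (by positivity)).not_dvd_of_degree_lt hne ?_ hdvd
    rw [degree_X_pow_sub_C (by positivity)]
    exact (degree_sub_le _ _).trans_lt (max_lt (huv ω) (ofFn_degree_lt _))
  rw [sub_eq_zero.mp heq, toFn_comp_ofFn_eq_id]

/-! ### Multiplication of integers -/

/-- Integers with `m` bits can be multiplied with at most `g` gates. -/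
def ComputesMul (m g : ℕ) : Prop :=
  Computes ((nat m).prod (nat m)) (nat (2 * m)) id (fun p : ℕ × ℕ => (p.1 * p.2 : ℕ)) g

theorem mul_lt_two_pow_two_mul {m x y : ℕ} (hx : x < 2 ^ m) (hy : y < 2 ^ m) :
    x * y < 2 ^ (2 * m) := by
  rw [two_mul, pow_add]
  exact Nat.mul_lt_mul'' hx hy

theorem Fermat.val_natCast_mod {N x : ℕ} (hx : x < 2 ^ N) : (x : Fermat N).val % 2 ^ N = x := by
  rw [ZMod.val_natCast, Nat.mod_eq_of_lt (hx.trans (Nat.lt_succ_self _)), Nat.mod_eq_of_lt hx]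

namespace ComputesMul

variable {m m' g : ℕ}

theorem of_mulBits (h : ComputableWithGates (mulBits m) g) : ComputesMul m g := by
  refine ⟨mulBits m, ⟨g, le_rfl, h⟩, ?_⟩
  rintro _ x rfl
  change Nat.ofBits (fun k : Fin (2 * m) => Nat.testBit _ k) = _
  rw [Nat.ofBits_testBit]
  exact Nat.mod_eq_of_lt
    (mul_lt_two_pow_two_mul (Nat.ofBits_lt_two_pow _) (Nat.ofBits_lt_two_pow _))

theorem exists_mulBits (h : ComputesMul m g) :
    ∃ g' ≤ g, ComputableWithGates (mulBits m) g' := by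
  obtain ⟨F, hF, hFmul⟩ := h
  have hFbits : F = mulBits m := by
    funext x k
    have hx : Nat.ofBits (F x) = _ := hFmul _ x rfl
    have hbit := Nat.testBit_ofBits_lt (F x) k k.2
    rw [hx] at hbit
    exact hbit.symm
  rwa [hFbits] at hF

theorem mulCost_le (h : ComputesMul m g) : mulCost m ≤ g := by
  obtain ⟨g', hg', hmul⟩ := h.exists_mulBits
  exact (Nat.sInf_le hmul).trans hg'

theorem of_le [NeZero m] (hm : m ≤ m') (h : ComputesMul m' g) : ComputesMul m (g + 6) := by
  have hm0 := NeZero.ne m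
  have : NeZero m' := ⟨by omega⟩
  have : NeZero (2 * m') := ⟨by omega⟩
  let A := (nat m).prod (nat m)
  have x : Computes A (nat m) id (fun p : ℕ × ℕ => p.1) 0 := Computes.fst
  have y : Computes A (nat m) id (fun p : ℕ × ℕ => p.2) 0 := Computes.snd
  have padded := (x.andThen (Computes.nat_window 0 m')).pair (y.andThen (Computes.nat_window 0 m'))
  refine (((padded.andThen h).andThen (Computes.nat_window 0 (2 * m))).mono
    (by omega)).congr_of_mem_range fun p hp => ?_
  obtain ⟨hx, hy⟩ := lt_two_pow_of_mem_range_decode_prod hp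
  have hpow : 2 ^ m ≤ 2 ^ m' := Nat.pow_le_pow_right two_pos hm
  dsimp only [id] at hx hy ⊢
  rw [pow_zero, Nat.div_one, Nat.div_one, Nat.div_one, Nat.mod_eq_of_lt (hx.trans_le hpow),
    Nat.mod_eq_of_lt (hy.trans_le hpow), Nat.mod_eq_of_lt (mul_lt_two_pow_two_mul hx hy)]

theorem one : ComputesMul 1 20 := by
  have hadd := (Computes.fst (A := nat 1) (B := nat 1) (y := id)).pair
    (Computes.snd.pair (Computes.nat_zero 1))
  refine (((hadd.andThen Computes.nat_fullAdd).andThen (Computes.nat_window 1 2)).mono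
    (by norm_num)).congr_of_mem_range fun p hp => ?_
  obtain ⟨hx, hy⟩ := lt_two_pow_of_mem_range_decode_prod hp
  obtain ⟨x, y⟩ : ℕ × ℕ := p
  dsimp only [id] at hx hy ⊢
  interval_cases x <;> interval_cases y <;> rfl

theorem of_fermat [NeZero m] (h : Computes ((fermat (2 * m)).prod (fermat (2 * m)))
    (fermat (2 * m)) id (fun p : Fermat (2 * m) × Fermat (2 * m) => p.1 * p.2) g) :
    ComputesMul m (g + 200 * m + 4) := by
  have : NeZero (2 * m) := ⟨by have := NeZero.ne m; omega⟩
  let A := (nat m).prod (nat m)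
  have x : Computes A (nat m) id (fun p : ℕ × ℕ => p.1) 0 := Computes.fst
  have y : Computes A (nat m) id (fun p : ℕ × ℕ => p.2) 0 := Computes.snd
  have residues := (x.andThen (Computes.fermat_of_nat (N := 2 * m) (by omega))).pair
    (y.andThen (Computes.fermat_of_nat (N := 2 * m) (by omega)))
  refine (((residues.andThen h).andThen Computes.nat_val_fermat).mono
    (by omega)).congr_of_mem_range fun p hp => ?_
  obtain ⟨hx, hy⟩ := lt_two_pow_of_mem_range_decode_prod hp
  dsimp only [id] at hx hy ⊢
  rw [← Nat.cast_mul, Fermat.val_natCast_mod (mul_lt_two_pow_two_mul hx hy)]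

theorem exists_gates (m : ℕ) : ∃ g, ComputesMul m g := by
  rcases Nat.eq_zero_or_pos m with rfl | hm
  · refine ⟨0, (Computes.fst (A := nat 0) (B := nat 0)).congr_of_mem_range fun p hp => ?_⟩
    obtain ⟨hx, -⟩ := lt_two_pow_of_mem_range_decode_prod hp
    dsimp only [id] at hx ⊢
    rw [Nat.lt_one_iff.mp hx, zero_mul]
  · have : NeZero m := ⟨hm.ne'⟩
    have : NeZero (2 * m) := ⟨by omega⟩
    exact ⟨_, of_fermat (Computes.fermat_mul_of_blocks (M := 1) (c := 2 * (2 * m))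
      (by omega) (by omega) one)⟩

end ComputesMul

theorem computableWithGates_mulBits_mulCost (m : ℕ) :
    ComputableWithGates (mulBits m) (mulCost m) := by
  obtain ⟨g, hg⟩ := ComputesMul.exists_gates m
  obtain ⟨g', -, hg'⟩ := hg.exists_mulBits
  exact Nat.sInf_mem (s := {g : ℕ | ComputableWithGates (mulBits m) g}) ⟨g', hg'⟩

theorem computesMul_mulCost (m : ℕ) : ComputesMul m (mulCost m) :=
  .of_mulBits (computableWithGates_mulBits_mulCost m)

theorem ComputableWithGates.card_le {ι κ : Type} [Fintype κ] {F : (ι → Bool) → κ → Bool} {g : ℕ}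
    (h : ComputableWithGates F g) (hinput : ∀ k i, ∃ x, F x k ≠ x i)
    (hinj : Function.Injective fun k x => F x k) : Fintype.card κ ≤ g := by
  obtain ⟨c, out, hc⟩ := h
  have hgate (k : κ) : ∃ j, out k = Sum.inr j := by
    rcases hk : out k with i | j
    · obtain ⟨x, hx⟩ := hinput k i
      rw [← hc, hk] at hx
      exact absurd rfl hx
    · exact ⟨j, rfl⟩
  choose j hj using hgate
  have hj_inj : Function.Injective j := fun k k' hkk => hinj <| funext fun x => by
    change F x k = F x k'
    rw [← hc, ← hc, hj, hj, hkk]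
  simpa using Fintype.card_le_of_injective j hj_inj

theorem mulBits_two_pow_one {m : ℕ} [NeZero m] (i : Fin m) (k : Fin (2 * m)) :
    mulBits m (Sum.elim (fun l => decide (l = i)) (fun l => decide (l = 0))) k =
      decide ((i : ℕ) = k) := by
  have ofBits_eq_two_pow (i : Fin m) : Nat.ofBits (fun l => decide (l = i)) = 2 ^ (i : ℕ) := by
    rw [ofBits_eq_sum, Finset.sum_eq_single i] <;> simp +contextual
  simp [mulBits, ofBits_eq_two_pow, Nat.testBit_two_pow]

theorem mulBits_zero_left {m : ℕ} (x : Fin m → Bool) (k : Fin (2 * m)) :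
    mulBits m (Sum.elim (fun _ => false) x) k = false := by
  simp [mulBits, ofBits_eq_sum]

theorem mulBits_zero_right {m : ℕ} (x : Fin m → Bool) (k : Fin (2 * m)) :
    mulBits m (Sum.elim x fun _ => false) k = false := by
  simp [mulBits, ofBits_eq_sum]

theorem le_mulCost (m : ℕ) : m ≤ mulCost m := by
  rcases Nat.eq_zero_or_pos m with rfl | hm
  · exact Nat.zero_le _
  have : NeZero m := ⟨hm.ne'⟩
  obtain ⟨c, out, hc⟩ := computableWithGates_mulBits_mulCost m
  let low (k : Fin m) : Fin (2 * m) := ⟨k, by omega⟩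
  have hlow : ComputableWithGates (fun x k => mulBits m x (low k)) (mulCost m) :=
    ⟨c, out ∘ low, fun x k => hc x (low k)⟩
  refine (Fintype.card_fin m).symm.trans_le (hlow.card_le ?_ fun k k' hkk => ?_)
  · rintro k (i | i)
    · refine ⟨Sum.elim (fun _ => true) (fun _ => false), ?_⟩
      rw [mulBits_zero_right]
      exact Bool.false_ne_true
    · refine ⟨Sum.elim (fun _ => false) (fun _ => true), ?_⟩
      rw [mulBits_zero_left]
      exact Bool.false_ne_true
  · have hbit := congrFun hkk (Sum.elim (fun l => decide (l = k)) (fun l => decide (l = 0)))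
    dsimp only at hbit
    rw [mulBits_two_pow_one, mulBits_two_pow_one, decide_eq_decide] at hbit
    exact Fin.ext (hbit.mp rfl)

theorem degree_mul_lt_of_lt {R : Type*} [Semiring R] {f g : R[X]} {h : ℕ} (hf : f.degree < h)
    (hg : g.degree < h) : (f * g).degree < (2 * h : ℕ) := by
  rw [degree_lt_iff_coeff_zero] at hf hg ⊢
  intro i hi
  rw [coeff_mul]
  refine Finset.sum_eq_zero fun p hp => ?_
  rw [Finset.HasAntidiagonal.mem_antidiagonal] at hp
  by_cases hfst : h ≤ p.1
  · rw [hf _ hfst, zero_mul]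
  · rw [hg _ (by omega), mul_zero]

/-- The polynomial whose coefficients are the `h` lowest blocks of `L` bits of `x`, so that its
value at `2 ^ L` is `x` if `x` has at most `L * h` bits. -/
noncomputable def blockPoly (L h x : ℕ) : ℕ[X] := ofFn h fun i => x / 2 ^ (L * i) % 2 ^ L

section BlockPoly

variable {L h x y : ℕ}

theorem coeff_blockPoly (hx : x < 2 ^ (L * h)) (i : ℕ) :
    (blockPoly L h x).coeff i = x / 2 ^ (L * i) % 2 ^ L := by
  rcases lt_or_ge i h with hi | hi
  · exact ofFn_coeff_eq_val_of_lt _ hi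
  · rw [blockPoly, ofFn_coeff_eq_zero_of_ge _ hi, Nat.div_eq_of_lt, Nat.zero_mod]
    exact hx.trans_le (Nat.pow_le_pow_right two_pos (Nat.mul_le_mul_left _ hi))

theorem coeff_blockPoly_lt (L h x i : ℕ) : (blockPoly L h x).coeff i < 2 ^ L := by
  rcases lt_or_ge i h with hi | hi
  · exact (ofFn_coeff_eq_val_of_lt _ hi).trans_lt (Nat.mod_lt _ (by positivity))
  · exact (ofFn_coeff_eq_zero_of_ge _ hi).trans_lt (by positivity)

theorem degree_blockPoly_lt (L h x : ℕ) : (blockPoly L h x).degree < h := ofFn_degree_lt _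

theorem eval_blockPoly (hx : x < 2 ^ (L * h)) : (blockPoly L h x).eval (2 ^ L) = x := by
  rw [blockPoly, ofFn_eq_sum_monomial, eval_finsetSum]
  simp only [eval_monomial, ← pow_mul]
  rw [Fin.sum_univ_eq_sum_range fun i => x / 2 ^ (L * i) % 2 ^ L * 2 ^ (L * i)]
  simp only [mul_comm (_ % _)]
  rw [sum_blocks, Nat.mod_eq_of_lt hx]

theorem coeff_blockPoly_mul_lt {i k N : ℕ} (hi : i < 2 ^ k) (hN : k + 2 * L ≤ N) :
    (blockPoly L h x * blockPoly L h y).coeff i < 2 ^ N := by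
  have term_le (p : ℕ × ℕ) (_ : p ∈ Finset.HasAntidiagonal.antidiagonal i) :
      (blockPoly L h x).coeff p.1 * (blockPoly L h y).coeff p.2 ≤ (2 ^ L - 1) * 2 ^ L :=
    Nat.mul_le_mul (Nat.le_sub_one_of_lt (coeff_blockPoly_lt ..)) (coeff_blockPoly_lt ..).le
  rw [coeff_mul]
  calc _ ≤ (i + 1) * ((2 ^ L - 1) * 2 ^ L) := by
        simpa using Finset.sum_le_card_nsmul _ _ _ term_le
    _ ≤ 2 ^ k * ((2 ^ L - 1) * 2 ^ L) := Nat.mul_le_mul_right _ hi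
    _ < 2 ^ k * (2 ^ L * 2 ^ L) := by
        gcongr
        exact Nat.sub_lt (by positivity) one_pos
    _ = 2 ^ (k + 2 * L) := by ring
    _ ≤ 2 ^ N := Nat.pow_le_pow_right two_pos hN

theorem sum_coeff_blockPoly_mul {K : ℕ} (hK : 2 * h ≤ K) (hx : x < 2 ^ (L * h))
    (hy : y < 2 ^ (L * h)) :
    ∑ i : Fin K, 2 ^ (L * (i : ℕ)) * (blockPoly L h x * blockPoly L h y).coeff i = x * y := by
  have hdeg : (blockPoly L h x * blockPoly L h y).degree < K :=
    (degree_mul_lt_of_lt (degree_blockPoly_lt _ _ _) (degree_blockPoly_lt _ _ _)).trans_le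
      (Nat.cast_le.mpr hK)
  conv_rhs => rw [← eval_blockPoly hx, ← eval_blockPoly hy, ← eval_mul,
    ← ofFn_toFn_of_degree_lt hdeg, ofFn_eq_sum_monomial, eval_finsetSum]
  refine Finset.sum_congr rfl fun i _ => ?_
  rw [eval_monomial, ← pow_mul, mul_comm]
  rfl

end BlockPoly

namespace Computes

theorem nat_concat {J N : ℕ} : Computes ((nat N).pow (Fin J)) (nat (J * N)) id
    (fun z : Fin J → ℕ => (∑ j : Fin J, 2 ^ (N * (j : ℕ)) * z j : ℕ)) 0 := by
  refine of_wiring (A := (nat N).pow (Fin J)) (f := fun z : Fin J → ℕ => _) finProdFinEquiv.symm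
    fun x => ?_
  change Nat.ofBits (fun k : Fin (J * N) => x (finProdFinEquiv.symm k)) =
    ∑ j : Fin J, 2 ^ (N * j) * Nat.ofBits (fun i : Fin N => x (j, i))
  simp only [ofBits_eq_sum, Finset.mul_sum]
  rw [← Equiv.sum_comp finProdFinEquiv, Fintype.sum_prod_type]
  refine Finset.sum_congr rfl fun j _ => Finset.sum_congr rfl fun i _ => ?_
  rw [Equiv.symm_apply_apply, finProdFinEquiv_apply_val, pow_add]
  ring

-- The terms with the same residue of the index modulo `c` do not overlap, so that there are only
-- `c` additions.
theorem fermat_sum_two_pow_mul {J K L M N c : ℕ} [NeZero (J * N)] [NeZero M] (hK : J * c = K)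
    (hN : c * L = N) (hM : J * N ≤ 2 * M) :
    Computes ((nat N).pow (Fin K)) (fermat M) id
      (fun z : Fin K → ℕ => ((∑ i : Fin K, 2 ^ (L * (i : ℕ)) * z i : ℕ) : Fermat M))
      (c * (2 + 100 * M) + 2) := by
  subst hK hN
  let A := (nat (c * L)).pow (Fin (J * c))
  have residueClass (r : Fin c) : Computes A ((nat (c * L)).pow (Fin J)) id
      (fun (z : Fin (J * c) → ℕ) j => z (finProdFinEquiv (j, r))) 0 :=
    (pi_const (τ := Fin J) fun j => proj (finProdFinEquiv (j, r))).mono (by simp)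
  have term (r : Fin c) := (((residueClass r).andThen nat_concat).andThen
    (fermat_of_nat hM)).andThen (fermat_two_pow_mul (L * (r : ℕ)))
  have : NeZero (J * c) := ⟨left_ne_zero_of_mul (mul_assoc J c L ▸ NeZero.ne (J * (c * L)))⟩
  have : NeZero (c * L) := ⟨right_ne_zero_of_mul (NeZero.ne (J * (c * L)))⟩
  refine ((fermat_sum Finset.univ fun r _ => term r).mono (by simp)).congr
    fun (z : Fin (J * c) → ℕ) => ?_
  dsimp only [id]
  rw [← Equiv.sum_comp finProdFinEquiv, Fintype.sum_prod_type_right, Nat.cast_sum]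
  refine Finset.sum_congr rfl fun r _ => ?_
  push_cast [Finset.mul_sum]
  refine Finset.sum_congr rfl fun j _ => ?_
  rw [finProdFinEquiv_apply_val, mul_add, pow_add]
  ring

theorem blockPoly_mul {N g k L h : ℕ} [NeZero N] [NeZero L] [NeZero h]
    (hmul : Computes ((fermat N).prod (fermat N)) (fermat N) id
      (fun p : Fermat N × Fermat N => p.1 * p.2) g)
    (hk : 2 ^ k ∣ N) (hh : 2 * h ≤ 2 ^ k) (hN : k + 2 * L ≤ N) :
    Computes ((nat (L * h)).prod (nat (L * h))) ((nat N).pow (Fin (2 ^ k))) id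
      (fun p : ℕ × ℕ => toFn (2 ^ k) (blockPoly L h p.1 * blockPoly L h p.2))
      (2 ^ k * (8 + g + 300 * k * N + 100 * N)) := by
  let A := (nat (L * h)).prod (nat (L * h))
  let residues (x : ℕ) : (Fermat N)[X] := (blockPoly L h x).map (Nat.castRingHom _)
  let V := (fermat N).pow (Fin (2 ^ k))
  have residues_coeff (z : ℕ × ℕ → ℕ) (hz : Computes A (nat (L * h)) id z 0)
      (hlt : ∀ p : ℕ × ℕ, p ∈ Set.range A.decode → z p < 2 ^ (L * h)) :
      Computes A V id (fun p => toFn (2 ^ k) (residues (z p))) (2 ^ k * 4) := by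
    refine (pi_const (τ := Fin (2 ^ k)) (g := 4) fun i => ((hz.andThen
      (nat_window (L * i) L)).andThen (fermat_of_nat (by omega))).congr_of_mem_range
      fun p hp => ?_).mono (by simp)
    change _ = (residues (z p)).coeff i
    simp only [residues, coeff_map, coeff_blockPoly (hlt p hp), eq_natCast]
  have hdeg (x : ℕ) : (residues x).degree < h := degree_map_le.trans_lt (degree_blockPoly_lt L h x)
  have hdeg' (x : ℕ) : (residues x).degree < (2 ^ k : ℕ) :=
    (hdeg x).trans_le (Nat.cast_le.mpr (by omega))
  have product := fermat_polynomial_mul hmul hk (Ω := ℕ × ℕ) (fun p => hdeg' p.1)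
    (fun p => hdeg' p.2) fun p =>
      (degree_mul_lt_of_lt (hdeg p.1) (hdeg p.2)).trans_le (Nat.cast_le.mpr hh)
  have operands := (residues_coeff Prod.fst fst fun p hp =>
    (lt_two_pow_of_mem_range_decode_prod hp).1).pair (residues_coeff Prod.snd snd fun p hp =>
    (lt_two_pow_of_mem_range_decode_prod hp).2)
  have coeffs := (operands.trans product).trans <| pi_const (τ := Fin (2 ^ k)) fun i =>
    (proj (A := fermat N) i).andThen nat_val_fermat
  refine (coeffs.mono (by rw [Fintype.card_fin]; ring_nf; rfl)).congr fun p => funext fun i => ?_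
  change ((residues p.1 * residues p.2).coeff i).val % 2 ^ N = _
  simp only [residues, ← Polynomial.map_mul, coeff_map, eq_natCast]
  exact Fermat.val_natCast_mod (coeff_blockPoly_mul_lt i.2 hN)

end Computes

namespace ComputesMul

theorem two_pow_two_mul_add_three {k g : ℕ} (h : ComputesMul (2 ^ (k + 4)) g) :
    ComputesMul (2 ^ (2 * k + 3)) (2 ^ (k + 4) * g + 6000 * (k + 3) * 2 ^ (2 * k + 4)) := by
  have hm : 2 ^ (k + 2) * 2 ^ (k + 1) = 2 ^ (2 * k + 3) := by ring
  have hL : 2 ^ (k + 2) = 4 * 2 ^ k := by ring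
  have hN : 2 ^ (k + 4) = 16 * 2 ^ k := by ring
  have h2m : 2 ^ k * 2 ^ (k + 4) = 2 * 2 ^ (2 * k + 3) := by ring
  have hk : k + 2 < 2 ^ (k + 2) := Nat.lt_two_pow_self
  have coeffs := Computes.blockPoly_mul (N := 2 ^ (k + 4)) (k := k + 2) (L := 2 ^ (k + 2))
    (h := 2 ^ (k + 1)) (Computes.fermat_mul_of_blocks (c := 2) le_rfl (by omega) h)
    (pow_dvd_pow 2 (by omega)) (by omega) (by omega)
  have value := (coeffs.andThen (Computes.fermat_sum_two_pow_mul (J := 2 ^ k) (L := 2 ^ (k + 2))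
    (M := 2 * 2 ^ (2 * k + 3)) (c := 4) (by ring) (by ring) (by omega))).andThen
    Computes.nat_val_fermat
  rw [hm] at value
  refine (value.mono ?_).congr_of_mem_range fun p hp => ?_
  · have hpow : 1 ≤ 2 ^ k := Nat.one_le_two_pow
    have hsq : 2 ^ (2 * k) = 2 ^ k * 2 ^ k := by ring
    rw [pow_add 2 (2 * k) 3, pow_add 2 (2 * k) 4, hsq, hL, hN]
    nlinarith
  · obtain ⟨hx, hy⟩ := lt_two_pow_of_mem_range_decode_prod hp
    have hsum := sum_coeff_blockPoly_mul (L := 2 ^ (k + 2)) (K := 2 ^ (k + 2))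
      (h := 2 ^ (k + 1)) (by omega) (hm ▸ hx) (hm ▸ hy)
    refine (congrArg (fun z : ℕ => (z : Fermat _).val % _) hsum).trans ?_
    exact Fermat.val_natCast_mod (mul_lt_two_pow_two_mul hx hy)

end ComputesMul

theorem quasilinear_recursion_le {C j k : ℕ} (hC : 60000 ≤ C) (hj : 40 ≤ j) (hk : k = (j - 2) / 2) :
    2 ^ (k + 4) * (C * 2 ^ (k + 4) * (k + 5) ^ 10) + 6000 * (k + 3) * 2 ^ (2 * k + 4) + 6 ≤
      C * 2 ^ j * (j + 1) ^ 10 := by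
  -- `(5 / 3) ^ 10 > 128`, which is twice the factor `64` by which the work grows per bit.
  have log_decrease : 128 * (k + 5) ^ 10 ≤ (j + 1) ^ 10 := by
    have h := Nat.pow_le_pow_left (show 5 * (k + 5) ≤ 3 * (j + 1) by omega) 10
    rw [mul_pow, mul_pow] at h
    omega
  have linear_le : k + 3 ≤ (k + 5) ^ 10 :=
    (show k + 3 ≤ k + 5 by omega).trans (Nat.le_self_pow (by norm_num) _)
  have size_le : 4 * 2 ^ (2 * k) ≤ 2 ^ j :=
    calc 4 * 2 ^ (2 * k) = 2 ^ (2 * k + 2) := by ring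
      _ ≤ 2 ^ j := Nat.pow_le_pow_right two_pos (by omega)
  calc _ = 64 * C * (4 * 2 ^ (2 * k)) * (k + 5) ^ 10
          + 24000 * (k + 3) * (4 * 2 ^ (2 * k)) + 6 := by ring
    _ ≤ 64 * C * 2 ^ j * (k + 5) ^ 10 + 24000 * (k + 5) ^ 10 * 2 ^ j + 6 := by gcongr
    _ ≤ C * 2 ^ j * (128 * (k + 5) ^ 10) := by
        have hpos : 1 ≤ 2 ^ j * (k + 5) ^ 10 := Nat.one_le_iff_ne_zero.mpr (by positivity)
        have hmul := Nat.mul_le_mul_right (2 ^ j * (k + 5) ^ 10) hC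
        generalize 2 ^ j = x, (k + 5) ^ 10 = y at hpos hmul ⊢
        linarith
    _ ≤ C * 2 ^ j * (j + 1) ^ 10 := by gcongr

theorem exists_computesMul_two_pow :
    ∃ C : ℕ, ∀ j, ComputesMul (2 ^ j) (C * 2 ^ j * (j + 1) ^ 10) := by
  choose G hG using fun j => ComputesMul.exists_gates (2 ^ j)
  refine ⟨∑ j ∈ Finset.range 40, G j + 60000, fun j => ?_⟩
  induction j using Nat.strong_induction_on with
  | _ j ih =>
    rcases Nat.lt_or_ge j 40 with hj | hj
    · refine (hG j).mono ?_
      rw [mul_assoc]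
      calc G j ≤ ∑ j ∈ Finset.range 40, G j + 60000 :=
            (Finset.single_le_sum (fun _ _ => Nat.zero_le _) (Finset.mem_range.mpr hj)).trans
              (Nat.le_add_right _ _)
        _ ≤ _ := Nat.le_mul_of_pos_right _ (by positivity)
    · have step := (ih ((j - 2) / 2 + 4) (by omega)).two_pow_two_mul_add_three
      have pad : 2 ^ j ≤ 2 ^ (2 * ((j - 2) / 2) + 3) := Nat.pow_le_pow_right two_pos (by omega)
      exact (step.of_le pad).mono (quasilinear_recursion_le (Nat.le_add_left _ _) hj rfl)

open scoped PowerSeries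

/-! ### Truncated norms of power series -/

/-- The weighted `ℓ¹` norm of the first `m` coefficients of a power series. With weight `1` it
controls the rounding errors; weights less than `1` serve to bound the inverse of a power series
in terms of the roots of the reversed polynomial. -/
noncomputable def truncNorm {R : Type*} [SeminormedRing R] (θ : ℝ) (m : ℕ) (f : R⟦X⟧) : ℝ :=
  ∑ i ∈ Finset.range m, ‖PowerSeries.coeff i f‖ * θ ^ i

section truncNorm

variable {R : Type*} [SeminormedRing R] {θ : ℝ} {m : ℕ} {f g : R⟦X⟧}

theorem truncNorm_nonneg (hθ : 0 ≤ θ) : 0 ≤ truncNorm θ m f :=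
  Finset.sum_nonneg fun _ _ => by positivity

theorem truncNorm_mono (hθ : 0 ≤ θ) {m' : ℕ} (h : m ≤ m') : truncNorm θ m f ≤ truncNorm θ m' f :=
  Finset.sum_le_sum_of_subset_of_nonneg (Finset.range_mono h) fun _ _ _ => by positivity

theorem truncNorm_add_le (hθ : 0 ≤ θ) :
    truncNorm θ m (f + g) ≤ truncNorm θ m f + truncNorm θ m g := by
  rw [truncNorm, truncNorm, truncNorm, ← Finset.sum_add_distrib]
  refine Finset.sum_le_sum fun i _ => ?_
  rw [map_add, ← add_mul]
  gcongr
  exact norm_add_le _ _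

theorem truncNorm_neg : truncNorm θ m (-f) = truncNorm θ m f := by
  simp only [truncNorm, map_neg, norm_neg]

theorem truncNorm_sub_le (hθ : 0 ≤ θ) :
    truncNorm θ m (f - g) ≤ truncNorm θ m f + truncNorm θ m g := by
  rw [sub_eq_add_neg, ← truncNorm_neg (f := g)]
  exact truncNorm_add_le hθ

theorem truncNorm_mul_le_sum (hθ : 0 ≤ θ) :
    truncNorm θ m (f * g) ≤
      ∑ i ∈ Finset.range m, ‖PowerSeries.coeff i f‖ * θ ^ i * truncNorm θ (m - i) g := by
  simp only [truncNorm, Finset.mul_sum]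
  rw [← Finset.sum_range_diag_flip m fun i j =>
    ‖PowerSeries.coeff i f‖ * θ ^ i * (‖PowerSeries.coeff j g‖ * θ ^ j)]
  refine Finset.sum_le_sum fun k _ => ?_
  rw [PowerSeries.coeff_mul, Finset.Nat.sum_antidiagonal_eq_sum_range_succ_mk]
  refine (mul_le_mul_of_nonneg_right (norm_sum_le _ _) (by positivity)).trans ?_
  rw [Finset.sum_mul]
  refine Finset.sum_le_sum fun i hi => ?_
  rw [mul_mul_mul_comm, ← pow_add, Nat.add_sub_cancel' (Finset.mem_range_succ_iff.mp hi)]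
  gcongr
  exact norm_mul_le _ _

theorem truncNorm_mul_le (hθ : 0 ≤ θ) :
    truncNorm θ m (f * g) ≤ truncNorm θ m f * truncNorm θ m g := by
  refine (truncNorm_mul_le_sum hθ).trans ?_
  rw [truncNorm, Finset.sum_mul]
  gcongr
  exact truncNorm_mono hθ (Nat.sub_le m _)

theorem truncNorm_mul_self_le (hθ : 0 ≤ θ) {m' : ℕ} (h : m' ≤ 2 * m) :
    truncNorm θ m' (f * f) ≤ 2 * truncNorm θ m f * truncNorm θ m' f := by
  refine (truncNorm_mul_le_sum hθ).trans ?_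
  rw [← Finset.sum_filter_add_sum_filter_not _ (· < m), mul_assoc, two_mul]
  refine add_le_add ?_ ?_
  · calc _ ≤ ∑ i ∈ Finset.range m' with i < m,
          ‖PowerSeries.coeff i f‖ * θ ^ i * truncNorm θ m' f := by
            gcongr
            exact truncNorm_mono hθ (Nat.sub_le m' _)
      _ ≤ ∑ i ∈ Finset.range m, ‖PowerSeries.coeff i f‖ * θ ^ i * truncNorm θ m' f := by
          refine Finset.sum_le_sum_of_subset_of_nonneg (fun i hi => ?_) fun i _ _ =>
            mul_nonneg (by positivity) (truncNorm_nonneg hθ)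
          exact Finset.mem_range.mpr (Finset.mem_filter.mp hi).2
      _ = _ := by rw [← Finset.sum_mul, ← truncNorm]
  · calc _ ≤ ∑ i ∈ Finset.range m' with ¬i < m,
          ‖PowerSeries.coeff i f‖ * θ ^ i * truncNorm θ m f := by
            refine Finset.sum_le_sum fun i hi => ?_
            have hi' := (Finset.mem_filter.mp hi).2
            gcongr
            exact truncNorm_mono hθ (by omega)
      _ ≤ ∑ i ∈ Finset.range m', ‖PowerSeries.coeff i f‖ * θ ^ i * truncNorm θ m f :=
          Finset.sum_le_sum_of_subset_of_nonneg (Finset.filter_subset _ _) fun i _ _ =>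
            mul_nonneg (by positivity) (truncNorm_nonneg hθ)
      _ = _ := by rw [← Finset.sum_mul, ← truncNorm, mul_comm]

theorem norm_coeff_le_truncNorm {i : ℕ} (hi : i < m) :
    ‖PowerSeries.coeff i f‖ ≤ truncNorm 1 m f := by
  simp only [truncNorm, one_pow, mul_one]
  exact Finset.single_le_sum (f := fun i => ‖PowerSeries.coeff i f‖)
    (fun _ _ => norm_nonneg _) (Finset.mem_range.mpr hi)

theorem truncNorm_le_of_coeff_le {c : ℝ} (h : ∀ i < m, ‖PowerSeries.coeff i f‖ ≤ c) :
    truncNorm 1 m f ≤ m * c := by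
  simp only [truncNorm, one_pow, mul_one]
  simpa using Finset.sum_le_card_nsmul _ _ c fun i hi => h i (Finset.mem_range.mp hi)

theorem norm_coeff_mul_le {c : ℝ} {i : ℕ} (h : ∀ j ≤ i, ‖PowerSeries.coeff j g‖ ≤ c) (hi : i < m) :
    ‖PowerSeries.coeff i (f * g)‖ ≤ truncNorm 1 m f * c := by
  have hc : 0 ≤ c := (norm_nonneg _).trans (h 0 (Nat.zero_le _))
  rw [PowerSeries.coeff_mul, Finset.Nat.sum_antidiagonal_eq_sum_range_succ_mk]
  calc _ ≤ ∑ j ∈ Finset.range (i + 1), ‖PowerSeries.coeff j f‖ * c := by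
        refine norm_sum_le_of_le _ fun j _ => (norm_mul_le _ _).trans ?_
        gcongr
        exact h _ (Nat.sub_le _ _)
    _ = truncNorm 1 (i + 1) f * c := by simp only [truncNorm, one_pow, mul_one, Finset.sum_mul]
    _ ≤ truncNorm 1 m f * c := by
        gcongr
        exact truncNorm_mono zero_le_one hi

theorem truncNorm_C_le (z : R) : truncNorm θ m (PowerSeries.C z) ≤ ‖z‖ := by
  rcases m with - | m
  · simp [truncNorm]
  · simp [truncNorm, Finset.sum_range_succ', PowerSeries.coeff_C]

theorem truncNorm_one_le [NormOneClass R] : truncNorm θ m (1 : R⟦X⟧) ≤ 1 := by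
  simpa using truncNorm_C_le (m := m) (θ := θ) (1 : R)

theorem truncNorm_X_le [NormOneClass R] (hθ : 0 ≤ θ) :
    truncNorm θ m (PowerSeries.X : R⟦X⟧) ≤ θ := by
  refine (truncNorm_mono hθ (Nat.le_add_right m 2)).trans ?_
  simp [truncNorm, Finset.sum_range_succ', PowerSeries.coeff_X]

theorem truncNorm_mk_pow_le [NormOneClass R] (hθ : 0 ≤ θ) {z : R} (hz : ‖z‖ * θ ≤ 1 / 2) :
    truncNorm θ m (PowerSeries.mk fun i => z ^ i) ≤ 2 := by
  refine (Finset.sum_le_sum fun i _ => ?_).trans (sum_geometric_two_le m)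
  rw [PowerSeries.coeff_mk]
  calc ‖z ^ i‖ * θ ^ i ≤ ‖z‖ ^ i * θ ^ i := by
        gcongr
        exact norm_pow_le z i
    _ ≤ (1 / 2) ^ i := by
        rw [← mul_pow]
        gcongr

end truncNorm

theorem one_sub_C_mul_X_mul_mk_pow {R : Type*} [CommRing R] (z : R) :
    (1 - PowerSeries.C z * PowerSeries.X) * PowerSeries.mk (fun i => z ^ i) = 1 := by
  ext i
  rw [sub_mul, one_mul, mul_assoc, map_sub, PowerSeries.coeff_C_mul]
  rcases i with - | i
  · simp
  · rw [PowerSeries.coeff_succ_X_mul]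
    simp [PowerSeries.coeff_one, pow_succ']

theorem reflect_prod_X_sub_C {R : Type*} [CommRing R] (Z : Multiset R) :
    reflect Z.card (Z.map fun z => X - C z).prod = (Z.map fun z => 1 - C z * X).prod := by
  nontriviality R
  induction Z using Multiset.induction_on with
  | empty => simp
  | cons z Z ih =>
    rw [Multiset.map_cons, Multiset.prod_cons, Multiset.card_cons, add_comm, reflect_mul, ih,
      Multiset.map_cons, Multiset.prod_cons, reflect_sub, reflect_one_X, reflect_C, pow_one]
    · exact natDegree_X_sub_C_le z
    · rw [natDegree_multiset_prod_X_sub_C_eq_card]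

section truncNormProd

variable {R : Type*} [SeminormedCommRing R] [NormOneClass R]

theorem truncNorm_multiset_prod_le {ι : Type*} {θ : ℝ} {m : ℕ} (hθ : 0 ≤ θ) {c : ℝ} (hc : 0 ≤ c)
    (Z : Multiset ι) (F : ι → R⟦X⟧) (hF : ∀ z ∈ Z, truncNorm θ m (F z) ≤ c) :
    truncNorm θ m (Z.map F).prod ≤ c ^ Z.card := by
  induction Z using Multiset.induction_on with
  | empty => simpa using truncNorm_one_le
  | cons z Z ih =>
    rw [Multiset.map_cons, Multiset.prod_cons, Multiset.card_cons, pow_succ']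
    exact (truncNorm_mul_le hθ).trans (mul_le_mul (hF z (Multiset.mem_cons_self z Z))
      (ih fun w hw => hF w (Multiset.mem_cons_of_mem hw)) (truncNorm_nonneg hθ) hc)

variable {r : ℝ} {Z : Multiset R}

theorem truncNorm_prod_X_sub_C_le (hr : 0 ≤ r) (hZ : ∀ z ∈ Z, ‖z‖ ≤ r) (m : ℕ) :
    truncNorm 1 m (((Z.map fun z => X - C z).prod : R[X]) : R⟦X⟧) ≤ (1 + r) ^ Z.card := by
  rw [← Polynomial.coeToPowerSeries.ringHom_apply, map_multiset_prod, Multiset.map_map]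
  refine truncNorm_multiset_prod_le zero_le_one (by positivity) Z _ fun z hz => ?_
  rw [Function.comp_apply, Polynomial.coeToPowerSeries.ringHom_apply, Polynomial.coe_sub,
    Polynomial.coe_X, Polynomial.coe_C]
  exact (truncNorm_sub_le zero_le_one).trans
    (add_le_add (truncNorm_X_le zero_le_one) ((truncNorm_C_le z).trans (hZ z hz)))

theorem truncNorm_prod_one_sub_C_mul_X_le (hr : 0 ≤ r) (hZ : ∀ z ∈ Z, ‖z‖ ≤ r) (m : ℕ) :
    truncNorm 1 m (((Z.map fun z => 1 - C z * X).prod : R[X]) : R⟦X⟧) ≤ (1 + r) ^ Z.card := by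
  rw [← Polynomial.coeToPowerSeries.ringHom_apply, map_multiset_prod, Multiset.map_map]
  refine truncNorm_multiset_prod_le zero_le_one (by positivity) Z _ fun z hz => ?_
  rw [Function.comp_apply, Polynomial.coeToPowerSeries.ringHom_apply, Polynomial.coe_sub,
    Polynomial.coe_one, Polynomial.coe_mul, Polynomial.coe_C, Polynomial.coe_X]
  refine (truncNorm_sub_le zero_le_one).trans (add_le_add truncNorm_one_le ?_)
  calc _ ≤ truncNorm 1 m (PowerSeries.C z) * truncNorm 1 m PowerSeries.X :=
        truncNorm_mul_le zero_le_one
    _ ≤ r * 1 := mul_le_mul ((truncNorm_C_le z).trans (hZ z hz)) (truncNorm_X_le zero_le_one)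
        (truncNorm_nonneg zero_le_one) hr
    _ = r := mul_one r

theorem truncNorm_prod_mk_pow_le (hr : 1 ≤ r) (hZ : ∀ z ∈ Z, ‖z‖ ≤ r) (m : ℕ) :
    truncNorm 1 (m + 1) (Z.map fun z => PowerSeries.mk (fun i => z ^ i)).prod ≤
      2 ^ Z.card * (2 * r) ^ m := by
  have hθ : (0 : ℝ) ≤ (2 * r)⁻¹ := by positivity
  have weighted : truncNorm (2 * r)⁻¹ (m + 1)
      (Z.map fun z => PowerSeries.mk (fun i => z ^ i)).prod ≤ 2 ^ Z.card := by
    refine truncNorm_multiset_prod_le hθ zero_le_two Z _ fun z hz => truncNorm_mk_pow_le hθ ?_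
    rw [← div_eq_mul_inv, div_le_div_iff₀ (by positivity) two_pos]
    linarith [hZ z hz]
  refine le_trans ?_ (mul_le_mul_of_nonneg_right weighted (by positivity))
  rw [truncNorm, truncNorm, Finset.sum_mul]
  refine Finset.sum_le_sum fun i hi => ?_
  rw [mul_assoc, one_pow, inv_pow, ← div_eq_inv_mul]
  gcongr
  rw [one_le_div₀ (by positivity)]
  exact pow_le_pow_right₀ (by linarith) (Finset.mem_range_succ_iff.mp hi)

end truncNormProd

/-! ### The exact quotient and remainder -/

theorem supNorm_le_iff {A : Type*} [SeminormedRing A] {f : A[X]} {c : ℝ} :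
    f.supNorm ≤ c ↔ ∀ i, ‖f.coeff i‖ ≤ c :=
  (isLUB_le_iff f.isGreatest_supNorm.isLUB).trans Set.forall_mem_range

theorem one_add_rpow_pow_le {ρ : ℝ} (hρ : 0 ≤ ρ) (n : ℕ) :
    (1 + (2 : ℝ) ^ ρ) ^ n ≤ 2 ^ (n * (ρ + 1)) := by
  rw [mul_comm, Real.rpow_mul_natCast two_pos.le, Real.rpow_add_one two_ne_zero]
  gcongr
  linarith [Real.one_le_rpow one_le_two hρ]

namespace IsDivision

variable {n : ℕ} {τ₁ τ₂ ρ : ℝ} {s t q r : ℂ[X]}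

theorem prod_roots (h : IsDivision n τ₁ τ₂ ρ s t q r) :
    (t.roots.map fun z => X - C z).prod = t :=
  ((IsAlgClosed.splits t).eq_prod_roots_of_monic h.monic_t).symm

theorem card_roots (h : IsDivision n τ₁ τ₂ ρ s t q r) : t.roots.card = n := by
  rw [← (IsAlgClosed.splits t).natDegree_eq_card_roots, h.natDegree_t]

theorem norm_le_of_mem_roots (h : IsDivision n τ₁ τ₂ ρ s t q r) : ∀ z ∈ t.roots, ‖z‖ ≤ 2 ^ ρ :=
  fun z hz => h.norm_root z (isRoot_of_mem_roots hz)

theorem reflect_eq_prod (h : IsDivision n τ₁ τ₂ ρ s t q r) :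
    reflect n t = (t.roots.map fun z => 1 - C z * X).prod := by
  rw [← reflect_prod_X_sub_C, h.prod_roots, h.card_roots]

theorem reflect_mul_inv (h : IsDivision n τ₁ τ₂ ρ s t q r) :
    (reflect n t : ℂ⟦X⟧) * (reflect n t : ℂ⟦X⟧)⁻¹ = 1 := by
  refine PowerSeries.mul_inv_cancel _ ?_
  rw [Polynomial.constantCoeff_coe, coeff_reflect, revAt_le (Nat.zero_le n), Nat.sub_zero,
    ← h.natDegree_t, h.monic_t.coeff_natDegree]
  exact one_ne_zero

theorem inv_reflect_eq_prod (h : IsDivision n τ₁ τ₂ ρ s t q r) :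
    (reflect n t : ℂ⟦X⟧)⁻¹ = (t.roots.map fun z => PowerSeries.mk fun i => z ^ i).prod := by
  refine (left_inv_eq_right_inv ?_ h.reflect_mul_inv).symm
  rw [h.reflect_eq_prod, ← Polynomial.coeToPowerSeries.ringHom_apply, map_multiset_prod,
    Multiset.map_map, ← Multiset.prod_map_mul]
  refine Multiset.prod_eq_one fun f hf => ?_
  obtain ⟨z, -, rfl⟩ := Multiset.mem_map.mp hf
  rw [mul_comm, ← one_sub_C_mul_X_mul_mk_pow z]
  simp

theorem truncNorm_inv_le (hρ : 0 ≤ ρ) (h : IsDivision n τ₁ τ₂ ρ s t q r) :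
    truncNorm 1 (n + 1) (reflect n t : ℂ⟦X⟧)⁻¹ ≤ 2 ^ (n * (ρ + 2)) := by
  rw [h.inv_reflect_eq_prod]
  refine (truncNorm_prod_mk_pow_le (Real.one_le_rpow one_le_two hρ) h.norm_le_of_mem_roots n).trans
    (le_of_eq ?_)
  rw [h.card_roots, ← mul_pow, mul_comm (n : ℝ), Real.rpow_mul_natCast two_pos.le,
    Real.rpow_add two_pos, Real.rpow_two]
  ring

theorem truncNorm_reflect_le (hρ : 0 ≤ ρ) (h : IsDivision n τ₁ τ₂ ρ s t q r) :
    truncNorm 1 (n + 1) (reflect n t : ℂ⟦X⟧) ≤ 2 ^ (n * (ρ + 1)) := by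
  rw [h.reflect_eq_prod]
  refine (truncNorm_prod_one_sub_C_mul_X_le (by positivity) h.norm_le_of_mem_roots _).trans ?_
  rw [h.card_roots]
  exact one_add_rpow_pow_le hρ n

theorem truncNorm_divisor_le (hρ : 0 ≤ ρ) (h : IsDivision n τ₁ τ₂ ρ s t q r) :
    truncNorm 1 (n + 1) (t : ℂ⟦X⟧) ≤ 2 ^ (n * (ρ + 1)) := by
  have bound := truncNorm_prod_X_sub_C_le (by positivity) h.norm_le_of_mem_roots (n + 1)
  rw [h.prod_roots, h.card_roots] at bound
  exact bound.trans (one_add_rpow_pow_le hρ n)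

theorem coeff_remainder_eq_zero (h : IsDivision n τ₁ τ₂ ρ s t q r) {i : ℕ} (hi : n ≤ i) :
    r.coeff i = 0 := by
  refine coeff_eq_zero_of_degree_lt (h.degree_r.trans_le (degree_le_natDegree.trans ?_))
  rw [h.natDegree_t]
  exact_mod_cast hi

theorem natDegree_quotient_le (h : IsDivision n τ₁ τ₂ ρ s t q r) : q.natDegree ≤ n := by
  rcases eq_or_ne q 0 with rfl | hq
  · simp
  have hr : r.natDegree ≤ n := (natDegree_le_natDegree h.degree_r.le).trans h.natDegree_t.le
  have htq : (t * q).natDegree ≤ 2 * n := by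
    rw [eq_sub_of_add_eq h.eq.symm]
    exact (natDegree_sub_le _ _).trans (max_le h.natDegree_s (by omega))
  rw [h.monic_t.natDegree_mul' hq, h.natDegree_t] at htq
  omega

theorem coeff_reflect_quotient (h : IsDivision n τ₁ τ₂ ρ s t q r) {i : ℕ} (hi : i ≤ n) :
    (reflect n q).coeff i =
      PowerSeries.coeff i ((reflect (2 * n) s : ℂ⟦X⟧) * (reflect n t : ℂ⟦X⟧)⁻¹) := by
  have reflect_s : reflect (2 * n) s = reflect n t * reflect n q + reflect (2 * n) r := by
    conv_lhs => rw [h.eq, reflect_add, two_mul,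
      reflect_mul t q h.natDegree_t.le h.natDegree_quotient_le]
    rw [two_mul]
  have remainder_term : PowerSeries.coeff i
      ((reflect (2 * n) r : ℂ⟦X⟧) * (reflect n t : ℂ⟦X⟧)⁻¹) = 0 := by
    rw [PowerSeries.coeff_mul]
    refine Finset.sum_eq_zero fun p hp => ?_
    rw [Finset.HasAntidiagonal.mem_antidiagonal] at hp
    rw [Polynomial.coeff_coe, coeff_reflect, revAt_le (by omega),
      h.coeff_remainder_eq_zero (by omega), zero_mul]
  rw [reflect_s, Polynomial.coe_add, Polynomial.coe_mul, add_mul, mul_right_comm,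
    h.reflect_mul_inv, one_mul, map_add, remainder_term, add_zero, Polynomial.coeff_coe]

theorem norm_quotient_coeff_le (hρ : 0 ≤ ρ) (h : IsDivision n τ₁ τ₂ ρ s t q r) (i : ℕ) :
    ‖q.coeff i‖ ≤ 2 ^ (n * (ρ + 2)) * 2 ^ τ₁ := by
  by_cases hi : i ≤ n
  · have hq := h.coeff_reflect_quotient (Nat.sub_le n i)
    rw [coeff_reflect, revAt_le (Nat.sub_le n i), Nat.sub_sub_self hi, mul_comm] at hq
    rw [hq]
    refine (norm_coeff_mul_le (c := 2 ^ τ₁) (m := n + 1) ?_ (by omega)).trans ?_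
    · intro j _
      rw [Polynomial.coeff_coe, coeff_reflect]
      exact supNorm_le_iff.mp h.norm_s _
    · gcongr
      exact h.truncNorm_inv_le hρ
  · rw [coeff_eq_zero_of_natDegree_lt (h.natDegree_quotient_le.trans_lt (by omega)), norm_zero]
    positivity

theorem norm_remainder_coeff_le (hρ : 0 ≤ ρ) (h : IsDivision n τ₁ τ₂ ρ s t q r) (i : ℕ) :
    ‖r.coeff i‖ ≤ 2 ^ τ₁ + 2 ^ (n * (ρ + 1)) * (2 ^ (n * (ρ + 2)) * 2 ^ τ₁) := by
  by_cases hi : i < n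
  · rw [eq_sub_of_add_eq' h.eq.symm, coeff_sub]
    refine (norm_sub_le _ _).trans (add_le_add (supNorm_le_iff.mp h.norm_s _) ?_)
    rw [← Polynomial.coeff_coe, Polynomial.coe_mul]
    refine (norm_coeff_mul_le (c := 2 ^ (n * (ρ + 2)) * 2 ^ τ₁) (m := n + 1) ?_ (by omega)).trans ?_
    · intro j _
      rw [Polynomial.coeff_coe]
      exact h.norm_quotient_coeff_le hρ j
    · gcongr
      exact h.truncNorm_divisor_le hρ
  · rw [h.coeff_remainder_eq_zero (by omega), norm_zero]
    positivity

theorem supNorm_quotient_le (hn : 1 ≤ n) (hρ : 0 ≤ ρ) (h : IsDivision n τ₁ τ₂ ρ s t q r) :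
    q.supNorm ≤ 2 ^ (2 * n + lg n + 1 + n * ρ + τ₁) := by
  have lg_nonneg : 0 ≤ lg n := Real.logb_nonneg one_lt_two (by exact_mod_cast hn)
  refine supNorm_le_iff.mpr fun i => (h.norm_quotient_coeff_le hρ i).trans ?_
  rw [← Real.rpow_add two_pos]
  exact Real.rpow_le_rpow_of_exponent_le one_le_two (by linarith)

theorem supNorm_remainder_le (hn : 1 ≤ n) (hρ : 0 ≤ ρ) (h : IsDivision n τ₁ τ₂ ρ s t q r) :
    r.supNorm ≤ 2 ^ (3 * n + lg n + 1 + 2 * n * ρ + τ₁) := by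
  have lg_nonneg : 0 ≤ lg n := Real.logb_nonneg one_lt_two (by exact_mod_cast hn)
  have nρ_nonneg : 0 ≤ n * ρ := by positivity
  refine supNorm_le_iff.mpr fun i => (h.norm_remainder_coeff_le hρ i).trans ?_
  rw [← Real.rpow_add two_pos, ← Real.rpow_add two_pos]
  calc _ ≤ (2 : ℝ) ^ (3 * n + 2 * n * ρ + τ₁) + 2 ^ (3 * n + 2 * n * ρ + τ₁) := by
        refine add_le_add ?_ ?_ <;>
        exact Real.rpow_le_rpow_of_exponent_le one_le_two (by nlinarith)
    _ = (2 : ℝ) ^ (3 * n + 2 * n * ρ + τ₁ + 1) := by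
        rw [Real.rpow_add_one two_ne_zero, mul_two]
    _ ≤ _ := Real.rpow_le_rpow_of_exponent_le one_le_two (by linarith)

end IsDivision

/-! ### Newton iteration with rounding -/

/-- The remainder of a polynomial modulo `X ^ m`. -/
noncomputable def truncate {R : Type*} [CommSemiring R] (m : ℕ) (f : R[X]) : R[X] :=
  PowerSeries.trunc m (f : R⟦X⟧)

section truncate

variable {R : Type*} [CommSemiring R]

theorem coeff_truncate (m : ℕ) (f : R[X]) (i : ℕ) :
    (truncate m f).coeff i = if i < m then f.coeff i else 0 := by
  rw [truncate, PowerSeries.coeff_trunc, Polynomial.coeff_coe]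

theorem coeff_mul_truncate {m : ℕ} (f g : R[X]) {i : ℕ} (hi : i < m) :
    (f * truncate m g).coeff i = (f * g).coeff i := by
  rw [coeff_mul, coeff_mul]
  refine Finset.sum_congr rfl fun p hp => ?_
  rw [Finset.HasAntidiagonal.mem_antidiagonal] at hp
  rw [coeff_truncate, if_pos (by omega)]

end truncate

/-- Division of a Gaussian integer by `2 ^ e`, rounded down in both parts. -/
def gaussianShr (e : ℕ) (z : GaussianInt) : GaussianInt := ⟨z.re / 2 ^ e, z.im / 2 ^ e⟩

theorem abs_intCast_ediv_sub_div_le (a : ℤ) {b : ℤ} (hb : 0 ≤ b) :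
    |((a / b : ℤ) : ℝ) - a / b| ≤ 1 := by
  have floor_eq : ⌊(a : ℝ) / b⌋ = a / b := by
    rw [Int.floor_div_cast_of_nonneg hb, Int.floor_intCast]
  rw [← floor_eq, abs_sub_comm, Int.self_sub_floor, Int.abs_fract]
  exact (Int.fract_lt_one _).le

theorem norm_gaussianShr_sub_le (e : ℕ) (z : GaussianInt) :
    ‖(gaussianShr e z).toComplex - z.toComplex / 2 ^ e‖ ≤ 2 := by
  have he : (0 : ℤ) ≤ 2 ^ e := by positivity
  have re_add_im : (gaussianShr e z).toComplex - z.toComplex / 2 ^ e =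
      ((((z.re / 2 ^ e : ℤ) : ℝ) - z.re / (2 ^ e : ℤ) : ℝ) : ℂ) +
      ((((z.im / 2 ^ e : ℤ) : ℝ) - z.im / (2 ^ e : ℤ) : ℝ) : ℂ) * Complex.I := by
    rw [GaussianInt.toComplex_def, GaussianInt.toComplex_def, gaussianShr]
    push_cast
    ring
  rw [re_add_im]
  refine (norm_add_le _ _).trans ((add_le_add ?_ ?_).trans one_add_one_eq_two.le)
  · rw [Complex.norm_real]
    exact abs_intCast_ediv_sub_div_le _ he
  · rw [norm_mul, Complex.norm_I, mul_one, Complex.norm_real]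
    exact abs_intCast_ediv_sub_div_le _ he

/-- The first `m` coefficients divided by `2 ^ e` and rounded. -/
noncomputable def roundedTruncate (e m : ℕ) (f : GaussianInt[X]) : GaussianInt[X] :=
  ofFn m fun i => gaussianShr e (f.coeff i)

theorem coeff_roundedTruncate (e m : ℕ) (f : GaussianInt[X]) (i : ℕ) :
    (roundedTruncate e m f).coeff i = if i < m then gaussianShr e (f.coeff i) else 0 := by
  split_ifs with hi
  · exact ofFn_coeff_eq_val_of_lt _ hi
  · exact ofFn_coeff_eq_zero_of_ge _ (not_lt.mp hi)

/-- The Newton step for the inverse of `τ` modulo `X ^ (n + 1)` before rounding. Both `τ` and `v`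
are in fixed-point representation with `P` bits after the point, so that the result has `3 * P`
bits after the point. -/
noncomputable def newtonPre (n P : ℕ) (τ v : GaussianInt[X]) : GaussianInt[X] :=
  v * (C (2 ^ (2 * P + 1)) - truncate (n + 1) (τ * v))

/-- The Newton iteration for the inverse of `τ` modulo `X ^ (n + 1)` in fixed-point arithmetic with
`P` bits after the point. -/
noncomputable def newtonIter (n P : ℕ) (τ : GaussianInt[X]) : ℕ → GaussianInt[X]
  | 0 => C (2 ^ P)
  | k + 1 =>
      roundedTruncate (2 * P) (min (2 ^ (k + 1)) (n + 1)) (newtonPre n P τ (newtonIter n P τ k))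

/-- The complex power series represented by a polynomial with fixed-point coefficients that have
`P` bits after the point. -/
noncomputable def scaled (P : ℕ) (f : GaussianInt[X]) : ℂ⟦X⟧ :=
  PowerSeries.C (((2 : ℂ) ^ P)⁻¹) * (f.map GaussianInt.toComplex : ℂ⟦X⟧)

theorem coeff_scaled (P : ℕ) (f : GaussianInt[X]) (i : ℕ) :
    PowerSeries.coeff i (scaled P f) = (f.coeff i).toComplex / 2 ^ P := by
  rw [scaled, PowerSeries.coeff_C_mul, Polynomial.coeff_coe, coeff_map, ← div_eq_inv_mul]

theorem coe_map_eq_scaled (P : ℕ) (f : GaussianInt[X]) :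
    (f.map GaussianInt.toComplex : ℂ⟦X⟧) = PowerSeries.C ((2 : ℂ) ^ P) * scaled P f := by
  rw [scaled, ← mul_assoc, ← map_mul, mul_inv_cancel₀ (pow_ne_zero _ two_ne_zero), map_one, one_mul]

theorem coeff_scaled_mul_scaled (P P' : ℕ) (f g : GaussianInt[X]) (i : ℕ) :
    PowerSeries.coeff i (scaled P f * scaled P' g) =
      ((f * g).coeff i).toComplex / 2 ^ (P + P') := by
  rw [scaled, scaled, mul_mul_mul_comm, ← map_mul, ← Polynomial.coe_mul, ← Polynomial.map_mul,
    PowerSeries.coeff_C_mul, Polynomial.coeff_coe, coeff_map, ← mul_inv, ← pow_add,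
    ← div_eq_inv_mul]

theorem coe_map_newton_step (P : ℕ) (τ v : GaussianInt[X]) :
    ((v * (C (2 ^ (2 * P + 1)) - τ * v)).map GaussianInt.toComplex : ℂ⟦X⟧) =
      PowerSeries.C ((2 : ℂ) ^ (3 * P)) * (scaled P v * (2 - scaled P τ * scaled P v)) := by
  have const_eq : ((C (2 ^ (2 * P + 1) : GaussianInt)).map GaussianInt.toComplex : ℂ⟦X⟧) =
      PowerSeries.C ((2 : ℂ) ^ P) ^ 2 * 2 := by
    rw [Polynomial.map_C, Polynomial.coe_C, map_pow, map_ofNat, pow_succ, mul_comm 2 P, pow_mul,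
      map_mul, map_pow _ ((2 : ℂ) ^ P) 2, map_ofNat]
  rw [Polynomial.map_mul, Polynomial.map_sub, Polynomial.map_mul, Polynomial.coe_mul,
    Polynomial.coe_sub, Polynomial.coe_mul, const_eq, coe_map_eq_scaled P v, coe_map_eq_scaled P τ,
    mul_comm 3 P, pow_mul, map_pow _ ((2 : ℂ) ^ P) 3]
  ring

theorem coeff_newtonPre (n P : ℕ) (τ v : GaussianInt[X]) {i : ℕ} (hi : i < n + 1) :
    ((newtonPre n P τ v).coeff i).toComplex = 2 ^ (3 * P) *
      PowerSeries.coeff i (scaled P v * (2 - scaled P τ * scaled P v)) := by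
  have untruncated : (newtonPre n P τ v).coeff i = (v * (C (2 ^ (2 * P + 1)) - τ * v)).coeff i := by
    rw [newtonPre, mul_sub, mul_sub, coeff_sub, coeff_sub, coeff_mul_truncate _ _ hi]
  rw [untruncated, ← coeff_map, ← Polynomial.coeff_coe, coe_map_newton_step,
    PowerSeries.coeff_C_mul]

section exactNewton

variable {R : Type*} {m m' : ℕ}

theorem truncNorm_eq_of_coeff_eq_zero [SeminormedRing R] {f : R⟦X⟧} {θ : ℝ} (hm : m ≤ m')
    (hf : ∀ i, m ≤ i → PowerSeries.coeff i f = 0) : truncNorm θ m' f = truncNorm θ m f := by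
  refine (Finset.sum_subset (Finset.range_mono hm) fun i _ hi => ?_).symm
  rw [hf i (not_lt.mp (mt Finset.mem_range.mpr hi)), norm_zero, zero_mul]

/-- The identity `H - V (2 - T' V) = T (H - V)² + (T' - T) V²` makes the error quadratic; since
`H - V` is small only in degrees less than `m`, its square is linear in the error in degrees less
than `2 m`. -/
theorem truncNorm_newton_step_le [SeminormedCommRing R] {T T' H V : R⟦X⟧} {B ε δ : ℝ}
    (hTH : T * H = 1) (hB : 1 ≤ B) (hmm' : m ≤ m') (hm' : m' ≤ 2 * m) (hT : truncNorm 1 m' T ≤ B)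
    (hH : truncNorm 1 m' H ≤ B) (hT' : truncNorm 1 m' (T' - T) ≤ δ)
    (hV : ∀ i, m ≤ i → PowerSeries.coeff i V = 0) (hE : truncNorm 1 m (H - V) ≤ ε) (hε : ε ≤ 1) :
    truncNorm 1 m' (H - V * (2 - T' * V)) ≤ 6 * B ^ 2 * ε + 4 * B ^ 2 * δ := by
  have h0 : (0 : ℝ) ≤ 1 := zero_le_one
  have hε0 : 0 ≤ ε := (truncNorm_nonneg h0).trans hE
  have hδ0 : 0 ≤ δ := (truncNorm_nonneg h0).trans hT'
  have V_le : truncNorm 1 m' V ≤ 2 * B := by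
    rw [truncNorm_eq_of_coeff_eq_zero hmm' hV, ← sub_sub_cancel H V]
    linarith [truncNorm_sub_le (m := m) (f := H) (g := H - V) h0,
      truncNorm_mono (f := H) h0 hmm']
  have error_le : truncNorm 1 m' (H - V) ≤ 3 * B := by
    linarith [truncNorm_sub_le (m := m') (f := H) (g := V) h0]
  have error_eq : H - V * (2 - T' * V) = T * ((H - V) * (H - V)) + (T' - T) * (V * V) := by
    linear_combination (-(H - 2 * V)) * hTH
  rw [error_eq]
  refine (truncNorm_add_le h0).trans (add_le_add ?_ ?_)
  · calc _ ≤ truncNorm 1 m' T * truncNorm 1 m' ((H - V) * (H - V)) := truncNorm_mul_le h0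
      _ ≤ B * (2 * ε * (3 * B)) := by
        refine mul_le_mul hT ((truncNorm_mul_self_le h0 hm').trans ?_) (truncNorm_nonneg h0)
          (by linarith)
        exact mul_le_mul (by linarith) error_le (truncNorm_nonneg h0) (by positivity)
      _ = _ := by ring
  · calc _ ≤ truncNorm 1 m' (T' - T) * truncNorm 1 m' (V * V) := truncNorm_mul_le h0
      _ ≤ δ * (2 * B * (2 * B)) := by
        refine mul_le_mul hT' ((truncNorm_mul_le h0).trans ?_) (truncNorm_nonneg h0) hδ0
        exact mul_le_mul V_le V_le (truncNorm_nonneg h0) (by positivity)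
      _ = _ := by ring

end exactNewton

theorem coeff_newtonIter_eq_zero {n P : ℕ} {τ : GaussianInt[X]} (k : ℕ) {i : ℕ}
    (hi : min (2 ^ k) (n + 1) ≤ i) : (newtonIter n P τ k).coeff i = 0 := by
  cases k with
  | zero =>
    rw [newtonIter, coeff_C, if_neg]
    rw [pow_zero, min_eq_left (by omega)] at hi
    omega
  | succ k => rw [newtonIter, coeff_roundedTruncate, if_neg (by omega)]

/-- The bound for the error after `k` Newton steps. Here `B` bounds the power series and its
inverse, and `η` bounds the errors of the input and of the rounding. -/
noncomputable def newtonError (n : ℕ) (B η : ℝ) (k : ℕ) : ℝ := (28 * B ^ 2 * (n + 1)) ^ k * η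

theorem newtonError_zero (n : ℕ) (B η : ℝ) : newtonError n B η 0 = η := by
  rw [newtonError, pow_zero, one_mul]

theorem newtonError_mono (n : ℕ) {B η : ℝ} (hB : 1 ≤ B) (hη : 0 ≤ η) :
    Monotone (newtonError n B η) := by
  intro k l hk
  have base : 1 ≤ 28 * B ^ 2 * (n + 1) := by
    rw [mul_assoc]
    exact one_le_mul_of_one_le_of_one_le (by norm_num)
      (one_le_mul_of_one_le_of_one_le (one_le_pow₀ hB) (by simp))
  exact mul_le_mul_of_nonneg_right (pow_le_pow_right₀ base hk) hη

theorem newton_step_le_newtonError_succ (n : ℕ) {B η : ℝ} (hB : 1 ≤ B) (hη : 0 ≤ η) (k : ℕ) :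
    6 * B ^ 2 * newtonError n B η k + 12 * B ^ 2 * (n + 1) * η + (n + 1) * (2 * η) ≤
      newtonError n B η (k + 1) := by
  have hx : η ≤ newtonError n B η k :=
    (newtonError_zero n B η).symm.le.trans (newtonError_mono n hB hη k.zero_le)
  have hx0 : 0 ≤ newtonError n B η k := hη.trans hx
  have hN : (1 : ℝ) ≤ n + 1 := by simp
  have succ_eq : newtonError n B η (k + 1) = 28 * B ^ 2 * (n + 1) * newtonError n B η k := by
    rw [newtonError, newtonError, pow_succ', mul_assoc]
  rw [succ_eq]
  generalize newtonError n B η k = x at hx hx0 ⊢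
  generalize (n : ℝ) + 1 = N at hN ⊢
  calc 6 * B ^ 2 * x + 12 * B ^ 2 * N * η + N * (2 * η)
      = 6 * B ^ 2 * 1 * x + 12 * B ^ 2 * N * η + 2 * 1 * N * η := by ring
    _ ≤ 6 * B ^ 2 * N * x + 12 * B ^ 2 * N * x + 2 * B ^ 2 * N * x := by
        gcongr
        exact one_le_pow₀ hB
    _ = 20 * B ^ 2 * N * x := by ring
    _ ≤ 28 * B ^ 2 * N * x := by gcongr; norm_num

section newton

variable {n P : ℕ} {τ : GaussianInt[X]} {T H : ℂ⟦X⟧} {B η : ℝ}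

theorem truncNorm_newtonPre_le (hTH : T * H = 1) (hB : 1 ≤ B) (hT : truncNorm 1 (n + 1) T ≤ B)
    (hH : truncNorm 1 (n + 1) H ≤ B)
    (hτ : ∀ i ≤ n, ‖PowerSeries.coeff i (scaled P τ - T)‖ ≤ 3 * η) {k : ℕ} {ε : ℝ}
    (hE : truncNorm 1 (min (2 ^ k) (n + 1)) (H - scaled P (newtonIter n P τ k)) ≤ ε) (hε : ε ≤ 1) :
    truncNorm 1 (min (2 ^ (k + 1)) (n + 1)) (H - scaled P (newtonIter n P τ k) *
      (2 - scaled P τ * scaled P (newtonIter n P τ k))) ≤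
      6 * B ^ 2 * ε + 12 * B ^ 2 * (n + 1) * η := by
  have h0 : (0 : ℝ) ≤ 1 := zero_le_one
  have hle : min (2 ^ (k + 1)) (n + 1) ≤ n + 1 := min_le_right _ _
  refine (truncNorm_newton_step_le (T := T) (δ := (n + 1) * (3 * η)) hTH hB
    (by rw [pow_succ']; omega) (by rw [pow_succ']; omega)
    ((truncNorm_mono h0 hle).trans hT) ((truncNorm_mono h0 hle).trans hH) ?_ (fun i hi => ?_)
    hE hε).trans (le_of_eq (by ring))
  · refine (truncNorm_mono h0 hle).trans ?_
    exact_mod_cast truncNorm_le_of_coeff_le (m := n + 1) fun i hi => hτ i (by omega)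
  · rw [coeff_scaled, coeff_newtonIter_eq_zero k hi, map_zero, zero_div]

theorem truncNorm_newton_rounding_le (k : ℕ) (hP : ((2 : ℝ) ^ P)⁻¹ ≤ η) :
    truncNorm 1 (min (2 ^ (k + 1)) (n + 1)) (scaled P (newtonIter n P τ k) *
        (2 - scaled P τ * scaled P (newtonIter n P τ k)) - scaled P (newtonIter n P τ (k + 1))) ≤
      (n + 1) * (2 * η) := by
  have hη : 0 ≤ η := le_trans (by positivity) hP
  have size_le : ((min (2 ^ (k + 1)) (n + 1) : ℕ) : ℝ) ≤ n + 1 := by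
    exact_mod_cast min_le_right _ _
  refine (truncNorm_le_of_coeff_le (c := 2 * η) fun i hi => ?_).trans
    (mul_le_mul_of_nonneg_right size_le (by positivity))
  have rounding := norm_gaussianShr_sub_le (2 * P)
    ((newtonPre n P τ (newtonIter n P τ k)).coeff i)
  rw [coeff_newtonPre n P τ _ (hi.trans_le (min_le_right _ _))] at rounding
  rw [map_sub, coeff_scaled, newtonIter, coeff_roundedTruncate, if_pos hi]
  generalize (gaussianShr (2 * P) _).toComplex = z at rounding ⊢
  generalize PowerSeries.coeff i (_ : ℂ⟦X⟧) = c at rounding ⊢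
  have scaled_rounding :
      c - z / 2 ^ P = -((z - 2 ^ (3 * P) * c / 2 ^ (2 * P)) * (2 ^ P : ℂ)⁻¹) := by
    rw [show 3 * P = P + 2 * P by ring, pow_add]
    field_simp
    ring
  rw [scaled_rounding, norm_neg, norm_mul, norm_inv, norm_pow, Complex.norm_ofNat]
  gcongr

theorem truncNorm_newtonIter_zero_le (hH0 : PowerSeries.coeff 0 H = 1) (hη : 0 ≤ η) :
    truncNorm 1 (min (2 ^ 0) (n + 1)) (H - scaled P (newtonIter n P τ 0)) ≤ η := by
  have coeff_zero : PowerSeries.coeff 0 (H - scaled P (newtonIter n P τ 0)) = 0 := by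
    rw [map_sub, hH0, coeff_scaled, newtonIter, coeff_C_zero, map_pow, map_ofNat,
      div_self (pow_ne_zero _ two_ne_zero), sub_self]
  rw [pow_zero, min_eq_left (Nat.le_add_left 1 n), truncNorm, Finset.sum_range_one, coeff_zero,
    norm_zero, zero_mul]
  exact hη

theorem truncNorm_newtonIter_le (hTH : T * H = 1) (hH0 : PowerSeries.coeff 0 H = 1) (hB : 1 ≤ B)
    (hT : truncNorm 1 (n + 1) T ≤ B) (hH : truncNorm 1 (n + 1) H ≤ B)
    (hτ : ∀ i ≤ n, ‖PowerSeries.coeff i (scaled P τ - T)‖ ≤ 3 * η)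
    (hP : ((2 : ℝ) ^ P)⁻¹ ≤ η) {K : ℕ} (hK : newtonError n B η K ≤ 1) {k : ℕ} (hk : k ≤ K) :
    truncNorm 1 (min (2 ^ k) (n + 1)) (H - scaled P (newtonIter n P τ k)) ≤
      newtonError n B η k := by
  have hη : 0 ≤ η := le_trans (by positivity) hP
  induction k with
  | zero => exact (truncNorm_newtonIter_zero_le hH0 hη).trans (newtonError_zero n B η).ge
  | succ k ih =>
    have small : newtonError n B η k ≤ 1 := (newtonError_mono n hB hη (by omega)).trans hK
    have step := truncNorm_newtonPre_le hTH hB hT hH hτ (ih (by omega)) small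
    rw [← sub_add_sub_cancel H (scaled P (newtonIter n P τ k) *
      (2 - scaled P τ * scaled P (newtonIter n P τ k)))]
    exact ((truncNorm_add_le zero_le_one).trans
      (add_le_add step (truncNorm_newton_rounding_le k hP))).trans
      (newton_step_le_newtonError_succ n hB hη k)

end newton

/-! ### Approximate division -/

/-- The reversal of the approximate quotient of `s` by `t`, from the inverse of the reversal of `t`
after `K` Newton steps. The input has `P` and the result `2 * P` bits after the point. -/
noncomputable def approxRevQuot (n P K : ℕ) (s t : GaussianInt[X]) : GaussianInt[X] :=
  truncate (n + 1) (truncate (n + 1) (reflect (2 * n) s) * newtonIter n P (reflect n t) K)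

/-- The approximate quotient of `s` by `t`. The input has `P` and the result `3 * P` bits after the
point. -/
noncomputable def approxQuot (n P K : ℕ) (s t : GaussianInt[X]) : GaussianInt[X] :=
  C (2 ^ P) * reflect n (approxRevQuot n P K s t)

/-- The approximate remainder of `s` by `t`. The input has `P` and the result `3 * P` bits after the
point. -/
noncomputable def approxRem (n P K : ℕ) (s t : GaussianInt[X]) : GaussianInt[X] :=
  truncate n (C (2 ^ (2 * P)) * s - t * reflect n (approxRevQuot n P K s t))

theorem coeff_approxRevQuot (n P K : ℕ) (s t : GaussianInt[X]) {i : ℕ} (hi : i ≤ n) :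
    ((approxRevQuot n P K s t).coeff i).toComplex / 2 ^ (2 * P) =
      PowerSeries.coeff i (scaled P (reflect (2 * n) s) *
        scaled P (newtonIter n P (reflect n t) K)) := by
  rw [coeff_scaled_mul_scaled, ← two_mul, approxRevQuot, coeff_truncate, if_pos (by omega),
    mul_comm, coeff_mul_truncate _ _ (by omega), mul_comm]

theorem coeff_approxQuot (n P K : ℕ) (s t : GaussianInt[X]) (i : ℕ) :
    ((approxQuot n P K s t).coeff i).toComplex / 2 ^ (3 * P) =
      ((reflect n (approxRevQuot n P K s t)).coeff i).toComplex / 2 ^ (2 * P) := by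
  rw [approxQuot, coeff_C_mul, map_mul, map_pow, map_ofNat, show 3 * P = P + 2 * P by ring,
    pow_add, mul_div_mul_left _ _ (pow_ne_zero _ two_ne_zero)]

theorem coeff_approxRem (n P K : ℕ) (s t : GaussianInt[X]) {i : ℕ} (hi : i < n) :
    ((approxRem n P K s t).coeff i).toComplex / 2 ^ (3 * P) =
      PowerSeries.coeff i (scaled P s -
        scaled P t * scaled (2 * P) (reflect n (approxRevQuot n P K s t))) := by
  rw [map_sub, coeff_scaled_mul_scaled, coeff_scaled, approxRem, coeff_truncate, if_pos hi,
    coeff_sub, coeff_C_mul, map_sub, map_mul, map_pow, map_ofNat, sub_div,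
    show 3 * P = 2 * P + P by ring, pow_add (2 : ℂ) (2 * P) P,
    mul_div_mul_left _ _ (pow_ne_zero _ two_ne_zero), ← pow_add, add_comm (2 * P) P]

/-- The Gaussian polynomials `s'` and `t'` represent, with `P` bits after the point, approximations
of `s` and `t` that are good enough for `K` Newton steps. The number `A` bounds the dividend, `B`
bounds the divisor and its inverse, and `η` bounds the errors of the input and of the rounding. -/
structure DivApprox (n P K : ℕ) (A B η τ₁ τ₂ ρ : ℝ) (s t q r : ℂ[X]) (s' t' : GaussianInt[X]) :
    Prop where
  division : IsDivision n τ₁ τ₂ ρ s t q r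
  one_le_A : 1 ≤ A
  one_le_B : 1 ≤ B
  norm_s : ∀ i, ‖s.coeff i‖ ≤ A
  norm_q : ∀ i, ‖q.coeff i‖ ≤ A * B
  norm_r : ∀ i, ‖r.coeff i‖ ≤ A + A * B * B
  norm_inv : truncNorm 1 (n + 1) (reflect n t : ℂ⟦X⟧)⁻¹ ≤ B
  norm_reflect_t : truncNorm 1 (n + 1) (reflect n t : ℂ⟦X⟧) ≤ B
  norm_t : truncNorm 1 (n + 1) (t : ℂ⟦X⟧) ≤ B
  error_s : ∀ i, ‖(s'.coeff i).toComplex / 2 ^ P - s.coeff i‖ ≤ 3 * η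
  error_t : ∀ i, ‖(t'.coeff i).toComplex / 2 ^ P - t.coeff i‖ ≤ 3 * η
  inv_two_pow_le : ((2 : ℝ) ^ P)⁻¹ ≤ η
  le_two_pow : n + 1 ≤ 2 ^ K
  small : 34 * (n + 1) * A * B ^ 2 * newtonError n B η K ≤ 1
  large : A + A * B * B + 1 ≤ 2 ^ P

namespace DivApprox

variable {n P K : ℕ} {A B η τ₁ τ₂ ρ : ℝ} {s t q r : ℂ[X]} {s' t' : GaussianInt[X]}

theorem eta_nonneg (h : DivApprox n P K A B η τ₁ τ₂ ρ s t q r s' t') : 0 ≤ η :=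
  le_trans (by positivity) h.inv_two_pow_le

theorem le_newtonError (h : DivApprox n P K A B η τ₁ τ₂ ρ s t q r s' t') :
    η ≤ newtonError n B η K :=
  (newtonError_zero n B η).symm.le.trans (newtonError_mono n h.one_le_B h.eta_nonneg K.zero_le)

theorem newtonError_nonneg (h : DivApprox n P K A B η τ₁ τ₂ ρ s t q r s' t') :
    0 ≤ newtonError n B η K :=
  h.eta_nonneg.trans h.le_newtonError

theorem newtonError_le_one (h : DivApprox n P K A B η τ₁ τ₂ ρ s t q r s' t') :
    newtonError n B η K ≤ 1 := by
  refine (le_mul_of_one_le_left h.newtonError_nonneg ?_).trans h.small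
  have one_le : (1 : ℝ) ≤ 34 * (n + 1) := one_le_mul_of_one_le_of_one_le (by norm_num) (by simp)
  exact one_le_mul_of_one_le_of_one_le (one_le_mul_of_one_le_of_one_le one_le h.one_le_A)
    (one_le_pow₀ h.one_le_B)

theorem coeff_zero_inv (h : DivApprox n P K A B η τ₁ τ₂ ρ s t q r s' t') :
    PowerSeries.coeff 0 (reflect n t : ℂ⟦X⟧)⁻¹ = 1 := by
  rw [PowerSeries.coeff_zero_eq_constantCoeff, PowerSeries.constantCoeff_inv,
    Polynomial.constantCoeff_coe, coeff_reflect, revAt_le (Nat.zero_le n), Nat.sub_zero,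
    ← h.division.natDegree_t, h.division.monic_t.coeff_natDegree, inv_one]

theorem norm_reflect_error_le (h : DivApprox n P K A B η τ₁ τ₂ ρ s t q r s' t') (i : ℕ) :
    ‖PowerSeries.coeff i (scaled P (reflect n t') - (reflect n t : ℂ⟦X⟧))‖ ≤ 3 * η := by
  rw [map_sub, coeff_scaled, Polynomial.coeff_coe, coeff_reflect, coeff_reflect]
  exact h.error_t _

theorem truncNorm_inv_sub_newtonIter_le (h : DivApprox n P K A B η τ₁ τ₂ ρ s t q r s' t') {k : ℕ}
    (hk : k ≤ K) :
    truncNorm 1 (min (2 ^ k) (n + 1))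
      ((reflect n t : ℂ⟦X⟧)⁻¹ - scaled P (newtonIter n P (reflect n t') k)) ≤
        newtonError n B η k :=
  truncNorm_newtonIter_le h.division.reflect_mul_inv h.coeff_zero_inv h.one_le_B h.norm_reflect_t
    h.norm_inv (fun i _ => h.norm_reflect_error_le i) h.inv_two_pow_le h.newtonError_le_one hk

theorem norm_newtonPre_le (h : DivApprox n P K A B η τ₁ τ₂ ρ s t q r s' t') {k : ℕ} (hk : k < K)
    {i : ℕ} (hi : i < min (2 ^ (k + 1)) (n + 1)) :
    ‖((newtonPre n P (reflect n t') (newtonIter n P (reflect n t') k)).coeff i).toComplex‖ ≤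
      2 ^ (4 * P) := by
  have hη := h.eta_nonneg
  have hin : i < n + 1 := hi.trans_le (min_le_right _ _)
  have mono := newtonError_mono n h.one_le_B hη
  have error_le := truncNorm_newtonPre_le h.division.reflect_mul_inv h.one_le_B h.norm_reflect_t
    h.norm_inv (fun i _ => h.norm_reflect_error_le i) (h.truncNorm_inv_sub_newtonIter_le hk.le)
    ((mono hk.le).trans h.newtonError_le_one)
  have error_le_one : 6 * B ^ 2 * newtonError n B η k + 12 * B ^ 2 * (n + 1) * η ≤ 1 :=
    ((le_add_of_nonneg_right (by positivity)).trans
      (newton_step_le_newtonError_succ n h.one_le_B hη k)).trans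
      ((mono hk).trans h.newtonError_le_one)
  have coeff_error := (norm_coeff_le_truncNorm hi).trans (error_le.trans error_le_one)
  have coeff_inv := (norm_coeff_le_truncNorm hin).trans h.norm_inv
  have B_le : B ≤ A * B * B :=
    le_mul_of_one_le_left (zero_le_one.trans h.one_le_B)
      (one_le_mul_of_one_le_of_one_le h.one_le_A h.one_le_B)
  rw [coeff_newtonPre n P _ _ hin, norm_mul, norm_pow, Complex.norm_ofNat,
    show 4 * P = 3 * P + P by ring, pow_add]
  rw [map_sub] at coeff_error
  gcongr
  linarith [h.one_le_A, h.large, norm_le_norm_add_norm_sub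
    (PowerSeries.coeff i (reflect n t : ℂ⟦X⟧)⁻¹)
    (PowerSeries.coeff i (scaled P (newtonIter n P (reflect n t') k) *
      (2 - scaled P (reflect n t') * scaled P (newtonIter n P (reflect n t') k))))]

theorem truncNorm_newtonIter_le_two_mul (h : DivApprox n P K A B η τ₁ τ₂ ρ s t q r s' t') :
    truncNorm 1 (n + 1) (scaled P (newtonIter n P (reflect n t') K)) ≤ 2 * B := by
  have error_le := h.truncNorm_inv_sub_newtonIter_le le_rfl
  rw [min_eq_right h.le_two_pow] at error_le
  rw [← sub_sub_cancel (reflect n t : ℂ⟦X⟧)⁻¹ (scaled P (newtonIter n P (reflect n t') K))]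
  refine (truncNorm_sub_le zero_le_one).trans ?_
  linarith [h.norm_inv, h.newtonError_le_one, h.one_le_B]

theorem norm_approxRevQuot_error_le (h : DivApprox n P K A B η τ₁ τ₂ ρ s t q r s' t') {i : ℕ}
    (hi : i ≤ n) :
    ‖(reflect n q).coeff i - ((approxRevQuot n P K s' t').coeff i).toComplex / 2 ^ (2 * P)‖ ≤
      7 * A * B * newtonError n B η K := by
  have hin : i < n + 1 := by omega
  have hε := h.newtonError_nonneg
  have hB0 : 0 ≤ B := zero_le_one.trans h.one_le_B
  have hA0 : 0 ≤ A := zero_le_one.trans h.one_le_A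
  have inv_error := h.truncNorm_inv_sub_newtonIter_le le_rfl
  rw [min_eq_right h.le_two_pow] at inv_error
  have newton_le := h.truncNorm_newtonIter_le_two_mul
  rw [h.division.coeff_reflect_quotient hi, coeff_approxRevQuot _ _ _ _ _ hi, ← map_sub]
  generalize scaled P (newtonIter n P (reflect n t') K) = V at *
  generalize (reflect n t : ℂ⟦X⟧)⁻¹ = H at *
  have error_eq : (reflect (2 * n) s : ℂ⟦X⟧) * H - scaled P (reflect (2 * n) s') * V =
      (H - V) * (reflect (2 * n) s : ℂ⟦X⟧) -
        V * (scaled P (reflect (2 * n) s') - (reflect (2 * n) s : ℂ⟦X⟧)) := by ring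
  have error_inv : ‖PowerSeries.coeff i ((H - V) * (reflect (2 * n) s : ℂ⟦X⟧))‖ ≤
      truncNorm 1 (n + 1) (H - V) * A := by
    refine norm_coeff_mul_le (fun j _ => ?_) hin
    rw [Polynomial.coeff_coe, coeff_reflect]
    exact h.norm_s _
  have error_s : ‖PowerSeries.coeff i
      (V * (scaled P (reflect (2 * n) s') - (reflect (2 * n) s : ℂ⟦X⟧)))‖ ≤
      truncNorm 1 (n + 1) V * (3 * η) := by
    refine norm_coeff_mul_le (fun j _ => ?_) hin
    rw [map_sub, Polynomial.coeff_coe, coeff_scaled, coeff_reflect, coeff_reflect]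
    exact h.error_s _
  rw [error_eq, map_sub]
  calc _ ≤ truncNorm 1 (n + 1) (H - V) * A + truncNorm 1 (n + 1) V * (3 * η) :=
        (norm_sub_le _ _).trans (add_le_add error_inv error_s)
    _ ≤ newtonError n B η K * A * 1 + 2 * B * (3 * (1 * newtonError n B η K)) := by
        rw [mul_one, one_mul]
        gcongr
        · exact mul_nonneg zero_le_three h.eta_nonneg
        · exact h.le_newtonError
    _ ≤ newtonError n B η K * A * B + 2 * B * (3 * (A * newtonError n B η K)) := by
        gcongr
        · exact h.one_le_B
        · exact h.one_le_A
    _ = _ := by ring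

theorem norm_reflect_approxRevQuot_error_le (h : DivApprox n P K A B η τ₁ τ₂ ρ s t q r s' t')
    (i : ℕ) :
    ‖q.coeff i - ((reflect n (approxRevQuot n P K s' t')).coeff i).toComplex / 2 ^ (2 * P)‖ ≤
      7 * A * B * newtonError n B η K := by
  by_cases hi : i ≤ n
  · have error_le := h.norm_approxRevQuot_error_le (Nat.sub_le n i)
    rwa [coeff_reflect, revAt_le (Nat.sub_le n i), Nat.sub_sub_self hi, ← revAt_le hi,
      ← coeff_reflect] at error_le
  · have hA := h.one_le_A
    have hB := h.one_le_B
    have hε := h.newtonError_nonneg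
    rw [coeff_eq_zero_of_natDegree_lt (by have := h.division.natDegree_quotient_le; omega),
      coeff_reflect, revAt_eq_self_of_lt (by omega), approxRevQuot, coeff_truncate,
      if_neg (by omega), map_zero, zero_div, sub_zero, norm_zero]
    positivity

theorem truncNorm_reflect_approxRevQuot_le (h : DivApprox n P K A B η τ₁ τ₂ ρ s t q r s' t') :
    truncNorm 1 (n + 1) (scaled (2 * P) (reflect n (approxRevQuot n P K s' t'))) ≤
      (n + 1) * (8 * A * B) := by
  have hA := h.one_le_A
  have hB := h.one_le_B
  have coeff_le (i : ℕ) : ‖PowerSeries.coeff i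
      (scaled (2 * P) (reflect n (approxRevQuot n P K s' t')))‖ ≤ 8 * A * B := by
    rw [coeff_scaled]
    calc _ ≤ ‖q.coeff i‖ + ‖q.coeff i - _‖ := norm_le_norm_add_norm_sub _ _
      _ ≤ A * B + 7 * A * B * 1 := by
        refine add_le_add (h.norm_q i) ((h.norm_reflect_approxRevQuot_error_le i).trans ?_)
        gcongr
        exact h.newtonError_le_one
      _ = 8 * A * B := by ring
  exact_mod_cast truncNorm_le_of_coeff_le (m := n + 1) fun i _ => coeff_le i

theorem remainder_error_bound_le (h : DivApprox n P K A B η τ₁ τ₂ ρ s t q r s' t') :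
    3 * η + B * (7 * A * B * newtonError n B η K) + (n + 1) * (8 * A * B) * (3 * η) ≤
      34 * (n + 1) * A * B ^ 2 * newtonError n B η K := by
  have hA := h.one_le_A
  have hB := h.one_le_B
  have hη := h.eta_nonneg
  have hε := h.newtonError_nonneg
  have hN : (1 : ℝ) ≤ n + 1 := by simp
  have hle := h.le_newtonError
  generalize newtonError n B η K = ε at *
  generalize (n : ℝ) + 1 = N at *
  calc 3 * η + B * (7 * A * B * ε) + N * (8 * A * B) * (3 * η)
      = 3 * 1 * 1 * 1 ^ 2 * η + 7 * 1 * A * B ^ 2 * ε + 24 * N * A * (B * 1) * η := by ring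
    _ ≤ 3 * N * A * B ^ 2 * ε + 7 * N * A * B ^ 2 * ε + 24 * N * A * (B * B) * ε := by gcongr
    _ = 34 * N * A * B ^ 2 * ε := by ring

theorem norm_approxRem_error_le (h : DivApprox n P K A B η τ₁ τ₂ ρ s t q r s' t') (i : ℕ) :
    ‖r.coeff i - ((approxRem n P K s' t').coeff i).toComplex / 2 ^ (3 * P)‖ ≤
      34 * (n + 1) * A * B ^ 2 * newtonError n B η K := by
  have hA := h.one_le_A
  have hB := h.one_le_B
  have hη := h.eta_nonneg
  have hε := h.newtonError_nonneg
  rcases le_or_gt n i with hi | hi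
  · rw [h.division.coeff_remainder_eq_zero hi, approxRem, coeff_truncate, if_neg (by omega),
      map_zero, zero_div, sub_zero, norm_zero]
    positivity
  have quot_error := h.norm_reflect_approxRevQuot_error_le
  have quot_le := h.truncNorm_reflect_approxRevQuot_le
  rw [coeff_approxRem _ _ _ _ _ hi, ← Polynomial.coeff_coe r, ← map_sub]
  generalize reflect n (approxRevQuot n P K s' t') = Q at *
  have remainder_eq : (r : ℂ⟦X⟧) = s - t * q := by
    rw [eq_sub_iff_add_eq', ← Polynomial.coe_mul, ← Polynomial.coe_add, ← h.division.eq]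
  have error_eq : (r : ℂ⟦X⟧) - (scaled P s' - scaled P t' * scaled (2 * P) Q) =
      -(scaled P s' - s) - t * (q - scaled (2 * P) Q) + scaled (2 * P) Q * (scaled P t' - t) := by
    rw [remainder_eq]
    ring
  rw [error_eq, map_add, map_sub, map_neg]
  refine ((norm_add_le _ _).trans (add_le_add ((norm_sub_le _ _).trans
    (add_le_add ?_ ?_)) ?_)).trans h.remainder_error_bound_le
  · rw [norm_neg, map_sub, coeff_scaled, Polynomial.coeff_coe]
    exact h.error_s i
  · refine (norm_coeff_mul_le (c := 7 * A * B * newtonError n B η K) (fun j _ => ?_)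
      (hi.trans n.lt_succ_self)).trans (mul_le_mul_of_nonneg_right h.norm_t (by positivity))
    rw [map_sub, Polynomial.coeff_coe, coeff_scaled]
    exact quot_error j
  · refine (norm_coeff_mul_le (c := 3 * η) (fun j _ => ?_)
      (hi.trans n.lt_succ_self)).trans (mul_le_mul_of_nonneg_right quot_le (by positivity))
    rw [map_sub, coeff_scaled, Polynomial.coeff_coe]
    exact h.error_t j

theorem quotient_error_bound_le (h : DivApprox n P K A B η τ₁ τ₂ ρ s t q r s' t') :
    7 * A * B * newtonError n B η K ≤ 34 * (n + 1) * A * B ^ 2 * newtonError n B η K := by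
  have hA := h.one_le_A
  have hB := h.one_le_B
  have hε := h.newtonError_nonneg
  gcongr
  · linarith [Nat.cast_nonneg (α := ℝ) n]
  · exact le_self_pow₀ hB two_ne_zero

theorem norm_approxQuot_error_le (h : DivApprox n P K A B η τ₁ τ₂ ρ s t q r s' t') (i : ℕ) :
    ‖q.coeff i - ((approxQuot n P K s' t').coeff i).toComplex / 2 ^ (3 * P)‖ ≤
      34 * (n + 1) * A * B ^ 2 * newtonError n B η K := by
  rw [coeff_approxQuot]
  exact (h.norm_reflect_approxRevQuot_error_le i).trans h.quotient_error_bound_le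

theorem norm_approxQuot_le (h : DivApprox n P K A B η τ₁ τ₂ ρ s t q r s' t') (i : ℕ) :
    ‖((approxQuot n P K s' t').coeff i).toComplex‖ ≤ 2 ^ (4 * P) := by
  have error_le := (h.norm_approxQuot_error_le i).trans h.small
  have hA := h.one_le_A
  have hB := h.one_le_B
  have scaled_le : ‖((approxQuot n P K s' t').coeff i).toComplex / 2 ^ (3 * P)‖ ≤ 2 ^ P := by
    linarith [norm_le_norm_add_norm_sub (q.coeff i)
      (((approxQuot n P K s' t').coeff i).toComplex / 2 ^ (3 * P)), h.norm_q i, h.large,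
      le_mul_of_one_le_right (show 0 ≤ A * B by positivity) hB]
  rw [norm_div, norm_pow, Complex.norm_ofNat, div_le_iff₀ (by positivity)] at scaled_le
  exact scaled_le.trans (le_of_eq (by ring))

theorem norm_approxRem_le (h : DivApprox n P K A B η τ₁ τ₂ ρ s t q r s' t') (i : ℕ) :
    ‖((approxRem n P K s' t').coeff i).toComplex‖ ≤ 2 ^ (4 * P) := by
  have error_le := (h.norm_approxRem_error_le i).trans h.small
  have scaled_le : ‖((approxRem n P K s' t').coeff i).toComplex / 2 ^ (3 * P)‖ ≤ 2 ^ P := by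
    linarith [norm_le_norm_add_norm_sub (r.coeff i)
      (((approxRem n P K s' t').coeff i).toComplex / 2 ^ (3 * P)), h.norm_r i, h.large]
  rw [norm_div, norm_pow, Complex.norm_ofNat, div_le_iff₀ (by positivity)] at scaled_le
  exact scaled_le.trans (le_of_eq (by ring))

theorem three_mul_eta_le_one (h : DivApprox n P K A B η τ₁ τ₂ ρ s t q r s' t') : 3 * η ≤ 1 := by
  have hε := h.newtonError_nonneg
  have one_le : (1 : ℝ) ≤ (n + 1) * A * B ^ 2 :=
    one_le_mul_of_one_le_of_one_le (one_le_mul_of_one_le_of_one_le (by simp) h.one_le_A)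
      (one_le_pow₀ h.one_le_B)
  calc 3 * η ≤ 34 * newtonError n B η K := by linarith [h.le_newtonError]
    _ ≤ 34 * ((n + 1) * A * B ^ 2 * newtonError n B η K) := by
      gcongr
      exact le_mul_of_one_le_left hε one_le
    _ ≤ 1 := by linarith [h.small]

theorem norm_dividend_le (h : DivApprox n P K A B η τ₁ τ₂ ρ s t q r s' t') (i : ℕ) :
    ‖(s'.coeff i).toComplex‖ ≤ 2 ^ (2 * P) := by
  have scaled_le : ‖(s'.coeff i).toComplex / 2 ^ P‖ ≤ 2 ^ P := by
    have hA := h.one_le_A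
    have hB := h.one_le_B
    linarith [norm_le_norm_sub_add ((s'.coeff i).toComplex / 2 ^ P) (s.coeff i), h.error_s i,
      h.norm_s i, h.three_mul_eta_le_one, h.large, show 0 ≤ A * B * B by positivity]
  rw [norm_div, norm_pow, Complex.norm_ofNat, div_le_iff₀ (by positivity)] at scaled_le
  exact scaled_le.trans (le_of_eq (by ring))

theorem norm_divisor_le (h : DivApprox n P K A B η τ₁ τ₂ ρ s t q r s' t') (i : ℕ) :
    ‖(t'.coeff i).toComplex‖ ≤ 2 ^ (2 * P) := by
  have hA := h.one_le_A
  have hB := h.one_le_B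
  have coeff_le : ‖t.coeff i‖ ≤ B := by
    by_cases hi : i < n + 1
    · simpa only [Polynomial.coeff_coe] using (norm_coeff_le_truncNorm hi).trans h.norm_t
    · rw [coeff_eq_zero_of_natDegree_lt (by rw [h.division.natDegree_t]; omega), norm_zero]
      positivity
  have B_le : B ≤ A * B * B :=
    le_mul_of_one_le_left (by positivity) (one_le_mul_of_one_le_of_one_le hA hB)
  have scaled_le : ‖(t'.coeff i).toComplex / 2 ^ P‖ ≤ 2 ^ P := by
    linarith [norm_le_norm_sub_add ((t'.coeff i).toComplex / 2 ^ P) (t.coeff i), h.error_t i,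
      h.three_mul_eta_le_one, h.large]
  rw [norm_div, norm_pow, Complex.norm_ofNat, div_le_iff₀ (by positivity)] at scaled_le
  exact scaled_le.trans (le_of_eq (by ring))

end DivApprox

/-! ### The choice of the precision -/

theorem one_le_lg {x : ℝ} (hx : 2 ≤ x) : 1 ≤ lg x := by
  rwa [lg, Real.le_logb_iff_rpow_le one_lt_two (by linarith), Real.rpow_one]

theorem two_rpow_lg {x : ℝ} (hx : 0 < x) : (2 : ℝ) ^ lg x = x :=
  Real.rpow_logb two_pos one_lt_two.ne' hx

theorem lg_natCast_le {n : ℕ} (hn : 1 ≤ n) : lg n ≤ n := by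
  rw [lg, Real.logb_le_iff_le_rpow one_lt_two (by positivity), Real.rpow_natCast]
  exact_mod_cast Nat.lt_two_pow_self.le

theorem lg_two_mul {x : ℝ} (hx : x ≠ 0) : lg (2 * x) = 1 + lg x := by
  rw [lg, Real.logb_mul two_ne_zero hx, Real.logb_self_eq_one one_lt_two, lg]

theorem two_pow_clog_le {m : ℕ} (hm : 2 ≤ m) : 2 ^ Nat.clog 2 m ≤ 2 * (m - 1) := by
  have pow_pred_lt := Nat.pow_pred_clog_lt_self one_lt_two (x := m) hm
  rw [← Nat.succ_pred_eq_of_pos (Nat.clog_pos one_lt_two hm), pow_succ']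
  omega

theorem clog_succ_le_two_mul_lg {n : ℕ} (hn : 2 ≤ n) : (Nat.clog 2 (n + 1) : ℝ) ≤ 2 * lg n := by
  have clog_le : (Nat.clog 2 (n + 1) : ℝ) ≤ lg (2 * n) := by
    rw [lg, Real.le_logb_iff_rpow_le one_lt_two (by positivity), Real.rpow_natCast]
    exact_mod_cast two_pow_clog_le (m := n + 1) (by omega)
  rw [lg_two_mul (by positivity)] at clog_le
  linarith [one_le_lg (x := n) (by exact_mod_cast hn)]

theorem exponent_le_divPrecision {n : ℕ} (hn : 2 ≤ n) (ℓ τ₁ : ℝ) {τ₂ ρ : ℝ} (hτ₂ : 0 ≤ τ₂)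
    (hρ : 1 ≤ ρ) :
    6 + (lg n + 1) + τ₁ + 2 * n * (ρ + 2) +
      (5 + 2 * n * (ρ + 2) + (lg n + 1)) * Nat.clog 2 (n + 1) ≤
        divPrecision n ℓ τ₁ τ₂ ρ - ℓ := by
  have hn2 : (2 : ℝ) ≤ n := by exact_mod_cast hn
  have hlg := one_le_lg hn2
  have newton_exponent : (5 + 2 * n * (ρ + 2) + (lg n + 1)) * Nat.clog 2 (n + 1) ≤
      (5 + 2 * n * (ρ + 2) + (lg n + 1)) * (2 * lg n) := by
    gcongr
    exact clog_succ_le_two_mul_lg hn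
  have lg_le_sq : lg n ≤ lg n ^ 2 := le_self_pow₀ hlg two_ne_zero
  have nρ_le : n * ρ ≤ n * ρ * lg n := le_mul_of_one_le_right (by positivity) hlg
  have n_le : (n : ℝ) ≤ n * lg n := le_mul_of_one_le_right (by positivity) hlg
  have n_lg_le : n * lg n ≤ n * ρ * lg n := by
    gcongr
    exact le_mul_of_one_le_right (by positivity) hρ
  have hτ₂lg : 0 ≤ τ₂ * lg n := by positivity
  rw [divPrecision]
  nlinarith

theorem natCast_add_one_le_two_rpow {n : ℕ} (hn : 1 ≤ n) : (n : ℝ) + 1 ≤ 2 ^ (lg n + 1) := by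
  rw [Real.rpow_add_one two_ne_zero, two_rpow_lg (by positivity), mul_two]
  gcongr
  exact_mod_cast hn

theorem newtonError_two_rpow_le {n : ℕ} (hn : 1 ≤ n) (β : ℝ) {η : ℝ} (hη : 0 ≤ η) (K : ℕ) :
    newtonError n (2 ^ β) η K ≤ 2 ^ ((5 + 2 * β + (lg n + 1)) * K) * η := by
  have succ_le := natCast_add_one_le_two_rpow hn
  have sq_eq : ((2 : ℝ) ^ β) ^ 2 = 2 ^ (2 * β) := by
    rw [← Real.rpow_mul_natCast zero_le_two, mul_comm, Nat.cast_ofNat]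
  have le_pow_five : (28 : ℝ) ≤ 2 ^ (5 : ℝ) := by norm_num
  rw [newtonError, sq_eq, Real.rpow_mul_natCast zero_le_two, Real.rpow_add two_pos,
    Real.rpow_add two_pos]
  gcongr

theorem error_bound_le_two_rpow_neg {n : ℕ} (hn : 2 ≤ n) (ℓ τ₁ : ℝ) {τ₂ ρ : ℝ} (hτ₂ : 0 ≤ τ₂)
    (hρ : 1 ≤ ρ) :
    34 * (n + 1) * 2 ^ τ₁ * ((2 : ℝ) ^ (n * (ρ + 2))) ^ 2 *
      newtonError n (2 ^ (n * (ρ + 2))) (2 ^ (-divPrecision n ℓ τ₁ τ₂ ρ))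
        (Nat.clog 2 (n + 1)) ≤ 2 ^ (-ℓ) := by
  have newton_le := newtonError_two_rpow_le (n := n) (by omega) (n * (ρ + 2))
    (η := 2 ^ (-divPrecision n ℓ τ₁ τ₂ ρ)) (by positivity) (Nat.clog 2 (n + 1))
  have succ_le := natCast_add_one_le_two_rpow (n := n) (by omega)
  have sq_eq : ((2 : ℝ) ^ (n * (ρ + 2))) ^ 2 = 2 ^ (2 * n * (ρ + 2)) := by
    rw [← Real.rpow_mul_natCast zero_le_two, mul_comm, Nat.cast_ofNat, mul_assoc]
  have le_pow_six : (34 : ℝ) ≤ 2 ^ (6 : ℝ) := by norm_num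
  have exponent_le := exponent_le_divPrecision hn ℓ τ₁ hτ₂ hρ
  rw [← mul_assoc 2 (n : ℝ)] at newton_le
  rw [sq_eq]
  calc _ ≤ (2 : ℝ) ^ (6 : ℝ) * 2 ^ (lg n + 1) * 2 ^ τ₁ * 2 ^ (2 * n * (ρ + 2)) *
        (2 ^ ((5 + 2 * n * (ρ + 2) + (lg n + 1)) * Nat.clog 2 (n + 1)) *
          2 ^ (-divPrecision n ℓ τ₁ τ₂ ρ)) := by
        gcongr
        rw [newtonError]
        positivity
    _ = (2 : ℝ) ^ (6 + (lg n + 1) + τ₁ + 2 * n * (ρ + 2) +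
        ((5 + 2 * n * (ρ + 2) + (lg n + 1)) * Nat.clog 2 (n + 1) +
          -divPrecision n ℓ τ₁ τ₂ ρ)) := by
        simp only [← Real.rpow_add two_pos]
    _ ≤ _ := Real.rpow_le_rpow_of_exponent_le one_le_two (by linarith)

theorem size_le_two_rpow_divPrecision {n : ℕ} (hn : 2 ≤ n) {ℓ τ₁ τ₂ ρ : ℝ} (hℓ : 0 ≤ ℓ)
    (hτ₁ : 0 ≤ τ₁) (hτ₂ : 0 ≤ τ₂) (hρ : 1 ≤ ρ) :
    (2 : ℝ) ^ τ₁ + 2 ^ τ₁ * 2 ^ (n * (ρ + 2)) * 2 ^ (n * (ρ + 2)) + 1 ≤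
      2 ^ divPrecision n ℓ τ₁ τ₂ ρ := by
  have hn2 : (2 : ℝ) ≤ n := by exact_mod_cast hn
  have hlg := one_le_lg hn2
  have hnρ : 0 ≤ n * (ρ + 2) := by positivity
  have exponent_le : τ₁ + n * (ρ + 2) + n * (ρ + 2) + 2 ≤ divPrecision n ℓ τ₁ τ₂ ρ := by
    have hτ₂lg : 0 ≤ τ₂ * lg n := by positivity
    have nρ_le : n * (ρ + 1) ≤ n * (ρ + 1) * lg n := le_mul_of_one_le_right (by positivity) hlg
    rw [divPrecision]
    nlinarith
  have first_le : (2 : ℝ) ^ τ₁ ≤ 2 ^ (τ₁ + n * (ρ + 2) + n * (ρ + 2)) :=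
    Real.rpow_le_rpow_of_exponent_le one_le_two (by linarith)
  have one_le : (1 : ℝ) ≤ 2 ^ (τ₁ + n * (ρ + 2) + n * (ρ + 2)) :=
    Real.one_le_rpow one_le_two (by linarith)
  rw [← Real.rpow_add two_pos, ← Real.rpow_add two_pos]
  calc _ ≤ (2 : ℝ) ^ (τ₁ + n * (ρ + 2) + n * (ρ + 2)) * 2 ^ (2 : ℝ) := by
        rw [Real.rpow_two]
        linarith
    _ = (2 : ℝ) ^ (τ₁ + n * (ρ + 2) + n * (ρ + 2) + 2) := (Real.rpow_add two_pos _ _).symm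
    _ ≤ _ := Real.rpow_le_rpow_of_exponent_le one_le_two exponent_le

theorem IsDivision.divApprox {n : ℕ} (hn : 2 ≤ n) {ℓ τ₁ τ₂ ρ : ℝ} (hℓ : 0 ≤ ℓ) (hτ₁ : 0 ≤ τ₁)
    (hτ₂ : 0 ≤ τ₂) (hρ : 1 ≤ ρ) {s t q r : ℂ[X]} (h : IsDivision n τ₁ τ₂ ρ s t q r)
    {s' t' : GaussianInt[X]} {P : ℕ} (hP : divPrecision n ℓ τ₁ τ₂ ρ ≤ P)
    (hs : ∀ i, ‖(s'.coeff i).toComplex / 2 ^ P - s.coeff i‖ ≤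
      3 * 2 ^ (-divPrecision n ℓ τ₁ τ₂ ρ))
    (ht : ∀ i, ‖(t'.coeff i).toComplex / 2 ^ P - t.coeff i‖ ≤
      3 * 2 ^ (-divPrecision n ℓ τ₁ τ₂ ρ)) :
    DivApprox n P (Nat.clog 2 (n + 1)) (2 ^ τ₁) (2 ^ (n * (ρ + 2)))
      (2 ^ (-divPrecision n ℓ τ₁ τ₂ ρ)) τ₁ τ₂ ρ s t q r s' t' := by
  have hρ0 : 0 ≤ ρ := zero_le_one.trans hρ
  have bound_le : (2 : ℝ) ^ (n * (ρ + 1)) ≤ 2 ^ (n * (ρ + 2)) :=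
    Real.rpow_le_rpow_of_exponent_le one_le_two (by gcongr; exact one_le_two)
  exact
    { division := h
      one_le_A := Real.one_le_rpow one_le_two hτ₁
      one_le_B := Real.one_le_rpow one_le_two (by positivity)
      norm_s := supNorm_le_iff.mp h.norm_s
      norm_q := fun i => (h.norm_quotient_coeff_le hρ0 i).trans_eq (mul_comm _ _)
      norm_r := fun i => (h.norm_remainder_coeff_le hρ0 i).trans <| by
        rw [mul_rotate', ← mul_assoc, mul_comm (2 ^ τ₁ : ℝ)]
        gcongr
      norm_inv := h.truncNorm_inv_le hρ0
      norm_reflect_t := (h.truncNorm_reflect_le hρ0).trans bound_le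
      norm_t := (h.truncNorm_divisor_le hρ0).trans bound_le
      error_s := hs
      error_t := ht
      inv_two_pow_le := by
        rw [← Real.rpow_natCast, ← Real.rpow_neg zero_le_two]
        exact Real.rpow_le_rpow_of_exponent_le one_le_two (neg_le_neg hP)
      le_two_pow := Nat.le_pow_clog one_lt_two _
      small := (error_bound_le_two_rpow_neg hn ℓ τ₁ hτ₂ hρ).trans
        (Real.rpow_le_one_of_one_le_of_nonpos one_le_two (by linarith))
      large := by
        refine (size_le_two_rpow_divPrecision hn hℓ hτ₁ hτ₂ hρ).trans ?_
        rw [← Real.rpow_natCast]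
        exact Real.rpow_le_rpow_of_exponent_le one_le_two hP }

/-! ### Circuits for signed integers -/

theorem ofBits_castSucc {w : ℕ} (x : Fin (w + 1) → Bool) :
    Nat.ofBits x = Nat.ofBits (fun i : Fin w => x i.castSucc) + (x (Fin.last w)).toNat * 2 ^ w := by
  rw [ofBits_eq_sum, ofBits_eq_sum, Fin.sum_univ_castSucc]
  rfl

theorem ofBits_signExtend {w : ℕ} (x : Fin (w + 1) → Bool) (d : ℕ) :
    (Nat.ofBits (Fin.append (fun i : Fin w => x i.castSucc) fun _ : Fin d => x (Fin.last w)) : ℤ) =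
      intOfBits x + (x (Fin.last w)).toNat * 2 ^ (w + d) := by
  rw [ofBits_append, intOfBits]
  cases x (Fin.last w)
  · simp [ofBits_eq_sum]
  · have ones : Nat.ofBits (fun _ : Fin d => true) = 2 ^ d - 1 := by
      simpa [ofBits_eq_sum] using ofBits_not fun _ : Fin d => false
    rw [ones, if_pos rfl]
    push_cast [Nat.one_le_two_pow, Bool.toNat_true, pow_add]
    ring

theorem neg_two_pow_le_intOfBits {w : ℕ} (x : Fin (w + 1) → Bool) : -2 ^ w ≤ intOfBits x := by
  rw [intOfBits]
  split_ifs <;> linarith [(Nat.ofBits fun i : Fin w => x i.castSucc).cast_nonneg (α := ℤ),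
    pow_pos (two_pos (α := ℤ)) w]

/-- Integers in two's complement with `w` value bits and a sign bit. -/
abbrev BitEncoding.int (w : ℕ) : BitEncoding := ⟨Fin (w + 1), ℤ, intOfBits⟩

theorem ComputableWithin.wiring_not {ι κ : Type} (a : ι) (f : κ → ι ⊕ Unit) :
    ComputableWithin (fun (x : ι → Bool) k => Sum.elim x (fun _ => !x a) (f k)) 1 :=
  (((wiring id).sumElim (gate (fun b _ => !b) a a)).rewire f).mono (zero_add 1).le

theorem mul_two_pow_ediv_emod_eq {x : ℤ} {w p P K : ℕ} (hx : -2 ^ w ≤ x)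
    (hlow : -2 ^ K ≤ x * 2 ^ P / 2 ^ p) (hhigh : x * 2 ^ P / 2 ^ p < 2 ^ K) :
    (((2 ^ P * (x + 2 ^ (w + (p + (K + 1)))).toNat / 2 ^ p % 2 ^ (K + 1) + 2 ^ K) %
      2 ^ (K + 1) : ℕ) : ℤ) = x * 2 ^ P / 2 ^ p + 2 ^ K := by
  have hpow : (2 : ℤ) ^ w ≤ 2 ^ (w + (p + (K + 1))) :=
    pow_le_pow_right₀ one_le_two (Nat.le_add_right w _)
  have offset : 2 ^ P * (x + 2 ^ (w + (p + (K + 1)))) =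
      x * 2 ^ P + 2 ^ (P + w) * 2 ^ (K + 1) * 2 ^ p := by ring
  push_cast
  rw [Int.toNat_of_nonneg (by linarith), offset, Int.add_mul_ediv_right _ _ (by positivity),
    Int.add_mul_emod_self_right, Int.emod_add_emod]
  refine Int.emod_eq_of_lt (by linarith) ?_
  rw [pow_succ]
  linarith

theorem toNat_add_two_pow_lt {x : ℤ} {N : ℕ} (hN : 1 ≤ N) (hx : |x| < 2 ^ (N - 1)) :
    (x + 2 ^ (N - 1)).toNat < 2 ^ N := by
  obtain ⟨N, rfl⟩ := Nat.exists_eq_add_of_le' hN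
  have hpow : (2 : ℤ) ^ (N + 1) = 2 ^ N * 2 := pow_succ 2 N
  obtain ⟨hlow, hhigh⟩ := abs_lt.mp hx
  zify
  rw [Nat.add_sub_cancel] at *
  rw [Int.toNat_of_nonneg (by linarith)]
  linarith

theorem toNat_add_two_pow_div_mod {x : ℤ} {N e : ℕ} (he : e < N) (hx : |x| < 2 ^ (N - 1)) :
    (((x + 2 ^ (N - 1)).toNat / 2 ^ e % 2 ^ N : ℕ) : ℤ) = x / 2 ^ e + 2 ^ (N - 1 - e) := by
  have hpow : (2 : ℤ) ^ (N - 1) = 2 ^ (N - 1 - e) * 2 ^ e := by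
    rw [← pow_add, Nat.sub_add_cancel (by omega)]
  rw [Nat.mod_eq_of_lt ((Nat.div_le_self _ _).trans_lt (toNat_add_two_pow_lt (by omega) hx))]
  push_cast
  rw [Int.toNat_of_nonneg (by linarith [(abs_lt.mp hx).1]), hpow,
    Int.add_mul_ediv_right _ _ (by positivity)]

namespace Computes

variable {Ω : Type*} {A : BitEncoding} {y : Ω → A.Value} {N : ℕ}

theorem int_of_nat {w : ℕ} :
    Computes (nat (w + 1)) (int w) id (fun x : ℕ => ((x : ℤ) - 2 ^ w : ℤ)) 1 := by
  refine ⟨_, .wiring_not (Fin.last w)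
    (Fin.snoc (α := fun _ => Fin (w + 1) ⊕ Unit) (fun i => .inl i.castSucc) (.inr ())), ?_⟩
  rintro _ x rfl
  dsimp only [id]
  rw [ofBits_castSucc, intOfBits]
  simp only [Fin.snoc_castSucc, Fin.snoc_last, Sum.elim_inl, Sum.elim_inr]
  cases x (Fin.last w) <;> simp

theorem nat_of_int {w : ℕ} (d : ℕ) :
    Computes (int w) (nat (w + d + 1)) id (fun x : ℤ => (x + 2 ^ (w + d)).toNat) 1 := by
  refine ⟨_, .wiring_not (Fin.last w) (Fin.snoc (α := fun _ => Fin (w + 1) ⊕ Unit)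
    (Fin.append (fun i => .inl i.castSucc) fun _ : Fin d => .inl (Fin.last w)) (.inr ())), ?_⟩
  rintro _ x rfl
  refine (Int.toNat_natCast _).symm.trans (congrArg Int.toNat ?_)
  have sign_extend : ∀ i : Fin (w + d), Sum.elim x (fun _ : Unit => !x (Fin.last w))
      (Fin.append (fun i : Fin w => .inl i.castSucc) (fun _ : Fin d => .inl (Fin.last w)) i) =
      Fin.append (fun i : Fin w => x i.castSucc) (fun _ : Fin d => x (Fin.last w)) i := fun i => by
    cases i using Fin.addCases <;> simp
  change (Nat.ofBits _ : ℤ) = intOfBits x + _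
  rw [ofBits_castSucc]
  simp only [Fin.snoc_castSucc, Fin.snoc_last, sign_extend, Sum.elim_inr]
  push_cast [ofBits_signExtend]
  cases x (Fin.last w) <;> simp

theorem nat_const [Nonempty A.Index] {m : ℕ} (c : ℕ) (hc : c < 2 ^ m) :
    Computes A (nat m) y (fun _ => c) 2 :=
  (const (B := nat m) fun i : Fin m => c.testBit i).congr fun _ => by
    exact (Nat.ofBits_testBit c m).trans (Nat.mod_eq_of_lt hc)

theorem fermat_of_int [NeZero N] {w p P K : ℕ} (hK : K < N) {x : Ω → ℤ}
    (hlow : ∀ ω, -2 ^ K ≤ x ω * 2 ^ P / 2 ^ p) (hhigh : ∀ ω, x ω * 2 ^ P / 2 ^ p < 2 ^ K) :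
    Computes (int w) (fermat N) x (fun ω => ((x ω * 2 ^ P / 2 ^ p : ℤ) : Fermat N))
      (300 * N) := by
  have hN : 1 ≤ N := NeZero.one_le
  let W := w + (p + (K + 1)) + 1
  have : NeZero (P + W) := ⟨by omega⟩
  have shifted : Computes (nat W) (nat (P + W)) id (fun x : ℕ => (0 + 2 ^ P * x : ℕ)) 2 :=
    ((nat_zero P).pair refl).andThen (nat_append rfl)
  have window := ((nat_of_int (w := w) (p + (K + 1))).andThen shifted).andThen
    (nat_window p (K + 1))
  have offset := ((refl (A := nat (K + 1)) (y := id)).pair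
    ((nat_const (m := K + 1) (2 ^ K) (Nat.pow_lt_pow_right one_lt_two K.lt_succ_self)).pair
      (nat_zero 1))).andThen (nat_add (K + 1))
  have residue := ((offset.andThen (nat_window 0 (K + 1))).andThen
    (fermat_of_nat (N := N) (by omega))).fermat_sub (fermat_const (2 ^ K : Fermat N))
  refine ((window.andThen residue).apply.mono (b := 300 * N) (by omega)).congr_of_mem_range
    fun ω ⟨bits, hbits⟩ => ?_
  have hx : -2 ^ w ≤ x ω := (neg_two_pow_le_intOfBits bits).trans_eq hbits
  have key := congrArg (Int.cast : ℤ → Fermat N)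
    (mul_two_pow_ediv_emod_eq hx (hlow ω) (hhigh ω))
  rw [Int.cast_natCast] at key
  simp only [pow_zero, Nat.div_one, zero_add, add_zero, id]
  rw [key]
  push_cast
  ring

theorem nat_of_fermat [NeZero N] {x : Ω → ℤ} (hx : ∀ ω, |x ω| < 2 ^ (N - 1)) :
    Computes (fermat N) (nat N) (fun ω => (x ω : Fermat N))
      (fun ω => (x ω + 2 ^ (N - 1)).toNat) (300 * N) := by
  have hN : 1 ≤ N := NeZero.one_le
  have : NeZero (2 * N) := ⟨by omega⟩
  have offset := ((refl (A := fermat N) (y := fun ω => (x ω : Fermat N))).fermat_add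
    (fermat_const (2 ^ (N - 1) : Fermat N))).andThen nat_val_fermat
  refine (offset.mono (by omega)).congr fun ω => ?_
  have cast_toNat : (x ω : Fermat N) + 2 ^ (N - 1) =
      (((x ω + 2 ^ (N - 1)).toNat : ℕ) : Fermat N) := by
    rw [← Int.cast_natCast, Int.toNat_of_nonneg (by linarith [(abs_lt.mp (hx ω)).1])]
    push_cast
    rfl
  rw [cast_toNat, Fermat.val_natCast_mod (toNat_add_two_pow_lt hN (hx ω))]

theorem fermat_shr [NeZero N] {e : ℕ} (he : e < N) {x : Ω → ℤ}
    (hx : ∀ ω, |x ω| < 2 ^ (N - 1)) :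
    Computes (fermat N) (fermat N) (fun ω => (x ω : Fermat N))
      (fun ω => ((x ω / 2 ^ e : ℤ) : Fermat N)) (500 * N) := by
  have hN : 1 ≤ N := NeZero.one_le
  have : NeZero (2 * N) := ⟨by omega⟩
  have shifted := (((nat_of_fermat hx).andThen (nat_window e N)).andThen
    (fermat_of_nat (by omega))).fermat_sub (fermat_const (2 ^ (N - 1 - e) : Fermat N))
  refine (shifted.mono (by omega)).congr fun ω => ?_
  rw [← Int.cast_natCast, toNat_add_two_pow_div_mod he (hx ω)]
  push_cast
  ring

end Computes

/-! ### Circuits for polynomials over the Gaussian integers -/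

theorem Fermat.two_pow_half_mul_self {N : ℕ} (hN : 2 ∣ N) (c : ℕ) :
    (2 : Fermat N) ^ (N / 2 + c * N) * 2 ^ (N / 2 + c * N) = ((-1 : ℤ) : Fermat N) := by
  have exponent : N / 2 + c * N + (N / 2 + c * N) = N + 2 * N * c := by
    linear_combination Nat.div_mul_cancel hN
  rw [← pow_add, exponent, pow_add, pow_mul, Fermat.two_pow_two_mul, Fermat.two_pow_self]
  simp

/-- The two homomorphisms from the Gaussian integers to the integers modulo `2 ^ N + 1`, which map
`I` to `2 ^ (N / 2)` and to `-2 ^ (N / 2)`, respectively. Their values at `z` determine the residues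
of the real and the imaginary part of `z`, and products are computed in both of them. -/
noncomputable def fermatHom {N : ℕ} (hN : 2 ∣ N) (c : Fin 2) : GaussianInt →+* Fermat N :=
  Zsqrtd.lift ⟨2 ^ (N / 2 + c * N), Fermat.two_pow_half_mul_self hN c⟩

theorem fermatHom_apply {N : ℕ} (hN : 2 ∣ N) (c : Fin 2) (z : GaussianInt) :
    fermatHom hN c z = (z.re : Fermat N) + 2 ^ (N / 2 + c * N) * (z.im : Fermat N) := by
  rw [fermatHom, Zsqrtd.lift_apply_apply, mul_comm]

/-- Polynomials with `L` Gaussian coefficients, given by the images of the coefficients under the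
two homomorphisms `fermatHom`. -/
abbrev BitEncoding.residues (N L : ℕ) : BitEncoding := ((fermat N).pow (Fin L)).pow (Fin 2)

/-- The images of the first `L` coefficients of a polynomial under the two homomorphisms
`fermatHom`. -/
noncomputable def residueVec {N : ℕ} (hN : 2 ∣ N) (L : ℕ) (f : GaussianInt[X]) :
    Fin 2 → Fin L → Fermat N :=
  fun c => toFn L (f.map (fermatHom hN c))

theorem residueVec_apply {N : ℕ} (hN : 2 ∣ N) {L : ℕ} (f : GaussianInt[X]) (c : Fin 2)
    (i : Fin L) : residueVec hN L f c i = fermatHom hN c (f.coeff i) :=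
  coeff_map _ _

theorem abs_re_im_lt_of_norm_lt {z : GaussianInt} {m : ℕ} (hz : ‖z.toComplex‖ < 2 ^ m) :
    |z.re| < 2 ^ m ∧ |z.im| < 2 ^ m := by
  have hre := (Complex.abs_re_le_norm z.toComplex).trans_lt hz
  have him := (Complex.abs_im_le_norm z.toComplex).trans_lt hz
  rw [← GaussianInt.intCast_re] at hre
  rw [← GaussianInt.intCast_im] at him
  exact ⟨by exact_mod_cast hre, by exact_mod_cast him⟩

namespace Computes

variable {Ω : Type*} {A : BitEncoding} {y : Ω → A.Value} {a b N L : ℕ}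

theorem residues_of_coeff (hN : 2 ∣ N) {f : Ω → GaussianInt[X]} {g : ℕ}
    (h : ∀ (c : Fin 2) (i : Fin L),
      Computes A (fermat N) y (fun ω => fermatHom hN c ((f ω).coeff i)) g) :
    Computes A (residues N L) y (fun ω => residueVec hN L (f ω)) (2 * (L * g)) := by
  refine (pi_const (τ := Fin 2) (g := L * g) fun c => (pi_const (τ := Fin L) (g := g)
    fun i => (h c i).congr fun ω => (residueVec_apply hN _ c i).symm).mono ?_).mono ?_ <;> simp

theorem residues_of_degree_lt [NeZero N] [Nonempty A.Index] (hN : 2 ∣ N)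
    {f : Ω → GaussianInt[X]} {d g : ℕ} (hf : ∀ ω, (f ω).degree < d) (hg : 2 ≤ g)
    (h : ∀ (c : Fin 2) (i : ℕ), i < d → i < L →
      Computes A (fermat N) y (fun ω => fermatHom hN c ((f ω).coeff i)) g) :
    Computes A (residues N L) y (fun ω => residueVec hN L (f ω)) (2 * (L * g)) := by
  refine residues_of_coeff hN fun c i => ?_
  by_cases hi : (i : ℕ) < d
  · exact h c i hi i.2
  · exact ((fermat_const 0).mono hg).congr fun ω => by
      rw [(degree_lt_iff_coeff_zero _ _).mp (hf ω) i (not_lt.mp hi), map_zero]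

theorem residue_coeff {hN : 2 ∣ N} {f : Ω → GaussianInt[X]}
    (h : Computes A (residues N L) y (fun ω => residueVec hN L (f ω)) a) (c : Fin 2) {i : ℕ}
    (hi : i < L) : Computes A (fermat N) y (fun ω => fermatHom hN c ((f ω).coeff i)) a := by
  refine (h.trans ((proj c).trans (proj (A := fermat N)
    (y := fun ω => residueVec hN L (f ω) c) (⟨i, hi⟩ : Fin L)))).congr fun ω => ?_
  rw [residueVec_apply]

theorem residue_coeff_pair {hN : 2 ∣ N} {f : Ω → GaussianInt[X]}
    (h : Computes A (residues N L) y (fun ω => residueVec hN L (f ω)) a) {i : ℕ} (hi : i < L) :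
    Computes A ((fermat N).prod (fermat N)) y
      (fun ω => (fermatHom hN 0 ((f ω).coeff i), fermatHom hN 1 ((f ω).coeff i))) a :=
  h.trans ((residue_coeff refl 0 hi).pair (residue_coeff refl 1 hi))

theorem residues_mul [NeZero N] {k g : ℕ}
    (hmul : Computes ((fermat N).prod (fermat N)) (fermat N) id
      (fun p : Fermat N × Fermat N => p.1 * p.2) g) (hN : 2 ∣ N) (hk : 2 ^ k ∣ N) {d : ℕ}
    (hd : 2 * d ≤ 2 ^ k) {f f' : Ω → GaussianInt[X]} (hf : ∀ ω, (f ω).degree < d)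
    (hf' : ∀ ω, (f' ω).degree < d)
    (h : Computes A (residues N (2 ^ k)) y (fun ω => residueVec hN (2 ^ k) (f ω)) a)
    (h' : Computes A (residues N (2 ^ k)) y (fun ω => residueVec hN (2 ^ k) (f' ω)) b) :
    Computes A (residues N (2 ^ k)) y (fun ω => residueVec hN (2 ^ k) (f ω * f' ω))
      (a + b + 2 * (2 ^ k * (g + 300 * k * N))) := by
  have hd' : (d : WithBot ℕ) ≤ (2 ^ k : ℕ) := by exact_mod_cast (by omega : d ≤ 2 ^ k)
  have degree_map : ∀ (c : Fin 2) (f : GaussianInt[X]), f.degree < d →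
    (f.map (fermatHom hN c)).degree < d := fun c f hf => degree_map_le.trans_lt hf
  refine (h.pair h').trans ((pi_const (τ := Fin 2) fun c => ?_).mono (by rw [Fintype.card_fin]))
  have component : Computes ((residues N (2 ^ k)).prod (residues N (2 ^ k)))
      (((fermat N).pow (Fin (2 ^ k))).prod ((fermat N).pow (Fin (2 ^ k))))
      (fun ω => (residueVec hN (2 ^ k) (f ω), residueVec hN (2 ^ k) (f' ω)))
      (fun ω => (residueVec hN (2 ^ k) (f ω) c, residueVec hN (2 ^ k) (f' ω) c)) 0 :=
    (fst.trans (proj c)).pair (snd.trans (proj c))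
  refine ((component.trans (fermat_polynomial_mul hmul hk
    (fun ω => (degree_map c _ (hf ω)).trans_le hd') (fun ω => (degree_map c _ (hf' ω)).trans_le hd')
    fun ω => (degree_mul_lt_of_lt (degree_map c _ (hf ω)) (degree_map c _ (hf' ω))).trans_le
      (by exact_mod_cast hd))).mono (zero_add _).le).congr fun ω => ?_
  rw [residueVec, Polynomial.map_mul]

theorem fermat_re [NeZero N] (hN : 2 ∣ N) {z : Ω → GaussianInt} :
    Computes ((fermat N).prod (fermat N)) (fermat N)
      (fun ω => (fermatHom hN 0 (z ω), fermatHom hN 1 (z ω))) (fun ω => ((z ω).re : Fermat N))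
      (100 * N) := by
  have half_mul_two : (2 : Fermat N) ^ (2 * N - 1) * 2 = 1 := by
    have hN1 : 1 ≤ N := NeZero.one_le
    rw [← pow_succ, Nat.sub_add_cancel (by omega), Fermat.two_pow_two_mul]
  refine (fermat_add_id.andThen (fermat_two_pow_mul (2 * N - 1))).apply.congr fun ω => ?_
  simp only [fermatHom_apply, Fin.val_zero, Fin.val_one, zero_mul, one_mul, add_zero,
    pow_add (2 : Fermat N), Fermat.two_pow_self]
  linear_combination ((z ω).re : Fermat N) * half_mul_two

theorem fermat_im [NeZero N] (hN : 2 ∣ N) {z : Ω → GaussianInt} :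
    Computes ((fermat N).prod (fermat N)) (fermat N)
      (fun ω => (fermatHom hN 0 (z ω), fermatHom hN 1 (z ω))) (fun ω => ((z ω).im : Fermat N))
      (100 * N) := by
  have inv_mul : (2 : Fermat N) ^ (2 * N - 1 - N / 2) * 2 * 2 ^ (N / 2) = 1 := by
    have hN1 : 1 ≤ N := NeZero.one_le
    rw [← pow_succ, ← pow_add, ← Fermat.two_pow_two_mul N]
    congr 1
    omega
  refine (((fst.fermat_sub snd).andThen (fermat_two_pow_mul (2 * N - 1 - N / 2))).mono
    (by omega)).congr fun ω => ?_
  simp only [fermatHom_apply, Fin.val_zero, Fin.val_one, zero_mul, one_mul, add_zero,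
    pow_add (2 : Fermat N), Fermat.two_pow_self]
  linear_combination ((z ω).im : Fermat N) * inv_mul

theorem fermatHom_shr [NeZero N] (hN : 2 ∣ N) {e : ℕ} (he : e < N) (c : Fin 2)
    {z : Ω → GaussianInt} (hz : ∀ ω, ‖(z ω).toComplex‖ < 2 ^ (N - 1)) :
    Computes ((fermat N).prod (fermat N)) (fermat N)
      (fun ω => (fermatHom hN 0 (z ω), fermatHom hN 1 (z ω)))
      (fun ω => fermatHom hN c (gaussianShr e (z ω))) (1500 * N) := by
  have re := (fermat_re hN).trans (fermat_shr he fun ω => (abs_re_im_lt_of_norm_lt (hz ω)).1)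
  have im := (fermat_im hN).trans (fermat_shr he fun ω => (abs_re_im_lt_of_norm_lt (hz ω)).2)
  refine ((re.fermat_add (im.andThen (fermat_two_pow_mul (N / 2 + c * N)))).mono
    (by omega)).congr fun ω => ?_
  rw [fermatHom_apply, gaussianShr]

theorem int_of_fermat {w : ℕ} {x : Ω → ℤ} (hx : ∀ ω, |x ω| < 2 ^ w) :
    Computes (fermat (w + 1)) (int w) (fun ω => (x ω : Fermat (w + 1))) x
      (300 * (w + 1) + 1) := by
  refine ((nat_of_fermat (N := w + 1) hx).andThen int_of_nat).congr fun ω => ?_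
  rw [Nat.add_sub_cancel, Int.toNat_of_nonneg (by linarith [(abs_lt.mp (hx ω)).1]),
    add_sub_cancel_right]

theorem int_of_fermatHom {w : ℕ} (hN : 2 ∣ w + 1) {z : Ω → GaussianInt}
    (hz : ∀ ω, ‖(z ω).toComplex‖ < 2 ^ w) :
    Computes ((fermat (w + 1)).prod (fermat (w + 1))) ((int w).pow (Fin 2))
      (fun ω => (fermatHom hN 0 (z ω), fermatHom hN 1 (z ω)))
      (fun ω => ![(z ω).re, (z ω).im]) (1000 * (w + 1)) := by
  refine (pi_const (τ := Fin 2) (g := 500 * (w + 1)) fun c => ?_).mono ?_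
  · fin_cases c
    · exact ((fermat_re hN).trans
        (int_of_fermat fun ω => (abs_re_im_lt_of_norm_lt (hz ω)).1)).mono (by omega)
    · exact ((fermat_im hN).trans
        (int_of_fermat fun ω => (abs_re_im_lt_of_norm_lt (hz ω)).2)).mono (by omega)
  · rw [Fintype.card_fin]
    omega

end Computes

/-! ### Circuits for the division -/

theorem degree_truncate_lt {R : Type*} [CommSemiring R] (m : ℕ) (f : R[X]) :
    (truncate m f).degree < m :=
  PowerSeries.degree_trunc_lt _ _

theorem coeff_reflect_of_le {R : Type*} [Semiring R] (f : R[X]) {n i : ℕ} (hi : i ≤ n) :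
    (reflect n f).coeff i = f.coeff (n - i) := by
  rw [coeff_reflect, revAt_le hi]

theorem degree_reflect_lt {R : Type*} [Semiring R] {f : R[X]} {n : ℕ}
    (hf : f.degree < (n + 1 : ℕ)) : (reflect n f).degree < (n + 1 : ℕ) := by
  refine (degree_lt_iff_coeff_zero _ _).mpr fun i hi => ?_
  rw [coeff_reflect, revAt_eq_self_of_lt (by omega), (degree_lt_iff_coeff_zero _ _).mp hf i hi]

theorem degree_roundedTruncate_lt (e m : ℕ) (f : GaussianInt[X]) :
    (roundedTruncate e m f).degree < m :=
  ofFn_degree_lt _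

theorem degree_newtonIter_lt (n P : ℕ) (τ : GaussianInt[X]) (k : ℕ) :
    (newtonIter n P τ k).degree < (n + 1 : ℕ) :=
  (degree_lt_iff_coeff_zero _ _).mpr fun _ hi =>
    coeff_newtonIter_eq_zero _ (min_le_of_right_le hi)

theorem degree_C_sub_truncate_lt {R : Type*} [CommRing R] (c : R) (n : ℕ) (f : R[X]) :
    (C c - truncate (n + 1) f).degree < (n + 1 : ℕ) :=
  (degree_sub_le _ _).trans_lt (max_lt (degree_C_le.trans_lt (by exact_mod_cast n.succ_pos))
    (degree_truncate_lt _ _))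

theorem degree_approxQuot_lt (n P K : ℕ) (s t : GaussianInt[X]) :
    (approxQuot n P K s t).degree < (n + 1 : ℕ) := by
  refine (degree_lt_iff_coeff_zero _ _).mpr fun i hi => ?_
  rw [approxQuot, approxRevQuot, coeff_C_mul, (degree_lt_iff_coeff_zero _ _).mp
    (degree_reflect_lt (degree_truncate_lt (n + 1) _)) i hi, mul_zero]

/-- The encoding of the coefficients of a polynomial over the Gaussian integers by the signed
integers that are their real and imaginary parts, as in `polyOfBits`. -/
abbrev BitEncoding.intParts (w d : ℕ) : BitEncoding := ((int w).pow (Fin 2)).pow (Fin d)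

/-- The real and the imaginary parts of the first `d` coefficients of a polynomial. -/
def coeffParts (d : ℕ) (f : GaussianInt[X]) : Fin d → Fin 2 → ℤ :=
  fun j => ![(f.coeff j).re, (f.coeff j).im]

namespace Computes

section residues

variable {Ω : Type*} {A : BitEncoding} {y : Ω → A.Value} {a N L L' : ℕ} [NeZero N] {hN : 2 ∣ N}
  {f f' : Ω → GaussianInt[X]}

theorem residues_reindex [NeZero L]
    (h : Computes A (residues N L) y (fun ω => residueVec hN L (f ω)) a) {d : ℕ}
    (hf' : ∀ ω, (f' ω).degree < d) (σ : ℕ → ℕ) (hσ : ∀ i < d, σ i < L)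
    (hcoeff : ∀ ω, ∀ i < d, (f' ω).coeff i = (f ω).coeff (σ i)) :
    Computes A (residues N L') y (fun ω => residueVec hN L' (f' ω)) (a + 4 * L') :=
  (h.trans (residues_of_degree_lt hN hf' le_rfl fun c i hi _ =>
    ((residue_coeff refl c (hσ i hi)).mono zero_le_two).congr fun ω => by
      rw [hcoeff ω i hi])).mono (by omega)

theorem residues_C_sub_truncate [NeZero L]
    (h : Computes A (residues N L) y (fun ω => residueVec hN L (f ω)) a) (z : GaussianInt)
    (n : ℕ) :
    Computes A (residues N L) y (fun ω => residueVec hN L (C z - truncate (n + 1) (f ω)))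
      (a + 204 * (L * N)) := by
  have hN1 : 1 ≤ N := NeZero.one_le
  refine (h.trans (residues_of_degree_lt (g := 102 * N) hN
    (fun ω => degree_C_sub_truncate_lt _ _ _) (by omega) fun c i hi hiL => ?_)).mono
      (le_of_eq (by ring))
  refine (((fermat_const (fermatHom hN c ((C z).coeff i))).fermat_sub
    (residue_coeff refl c hiL)).mono (by omega)).congr fun ω => ?_
  rw [coeff_sub, map_sub, coeff_truncate, if_pos hi]

theorem residues_roundedTruncate [NeZero L]
    (h : Computes A (residues N L) y (fun ω => residueVec hN L (f ω)) a) {e m : ℕ} (he : e < N)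
    (hf : ∀ ω, ∀ i < m, ‖((f ω).coeff i).toComplex‖ < 2 ^ (N - 1)) :
    Computes A (residues N L) y (fun ω => residueVec hN L (roundedTruncate e m (f ω)))
      (a + 3000 * (L * N)) := by
  have hN1 : 1 ≤ N := NeZero.one_le
  refine (h.trans (residues_of_degree_lt (g := 1500 * N) hN
    (fun ω => degree_roundedTruncate_lt _ _ _) (by omega) fun c i hi hiL => ?_)).mono
      (le_of_eq (by ring))
  refine ((((residue_coeff_pair refl hiL).trans (fermatHom_shr hN he c fun ω => hf ω i hi))).mono
    (zero_add _).le).congr fun ω => ?_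
  rw [coeff_roundedTruncate, if_pos hi]

theorem int_of_residues {w d : ℕ} {hN : 2 ∣ w + 1} (hd : d ≤ L)
    (h : Computes A (residues (w + 1) L) y (fun ω => residueVec hN L (f ω)) a)
    (hf : ∀ ω i, ‖((f ω).coeff i).toComplex‖ < 2 ^ w) :
    Computes A (intParts w d) y (fun ω => coeffParts d (f ω))
      (a + d * (1000 * (w + 1))) := by
  refine (h.trans (pi_const fun j : Fin d => (residue_coeff_pair refl (j.2.trans_le hd)).trans
    (int_of_fermatHom hN fun ω => hf ω j))).mono ?_
  rw [Fintype.card_fin, zero_add]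

end residues

section division

variable {Ω : Type*} {A : BitEncoding} {y : Ω → A.Value} {a N : ℕ} [NeZero N] {hN : 2 ∣ N}
  {n P K k g : ℕ} {τ s t : Ω → GaussianInt[X]}

theorem residues_newtonStep
    (hmul : Computes ((fermat N).prod (fermat N)) (fermat N) id
      (fun p : Fermat N × Fermat N => p.1 * p.2) g) (hk : 2 ^ k ∣ N) (hd : 2 * (n + 1) ≤ 2 ^ k)
    (hP : 4 * P < N - 1) (hτ : ∀ ω, (τ ω).degree < (n + 1 : ℕ)) {j : ℕ}
    (hsmall : ∀ ω, ∀ i < min (2 ^ (j + 1)) (n + 1),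
      ‖((newtonPre n P (τ ω) (newtonIter n P (τ ω) j)).coeff i).toComplex‖ ≤ 2 ^ (4 * P))
    (h : Computes A (residues N (2 ^ k)) y (fun ω => residueVec hN (2 ^ k) (τ ω)) a)
    (h' : Computes A (residues N (2 ^ k)) y
      (fun ω => residueVec hN (2 ^ k) (newtonIter n P (τ ω) j)) 0) :
    Computes A (residues N (2 ^ k)) y
      (fun ω => residueVec hN (2 ^ k) (newtonIter n P (τ ω) (j + 1)))
      (a + 4 * (2 ^ k * (g + 300 * k * N)) + 4000 * (2 ^ k * N)) := by
  have hv (ω : Ω) := degree_newtonIter_lt n P (τ ω) j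
  have defect := (residues_mul hmul hN hk hd hτ hv h h').residues_C_sub_truncate
    (2 ^ (2 * P + 1)) n
  have pre := residues_mul hmul hN hk hd hv (fun ω => degree_C_sub_truncate_lt _ _ _) h' defect
  refine (pre.residues_roundedTruncate (e := 2 * P) (by omega) fun ω i hi =>
    (hsmall ω i hi).trans_lt (pow_lt_pow_right₀ one_lt_two hP)).mono ?_
  omega

theorem residues_newtonIter
    (hmul : Computes ((fermat N).prod (fermat N)) (fermat N) id
      (fun p : Fermat N × Fermat N => p.1 * p.2) g) (hk : 2 ^ k ∣ N) (hd : 2 * (n + 1) ≤ 2 ^ k)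
    (hP : 4 * P < N - 1) (hτ : ∀ ω, (τ ω).degree < (n + 1 : ℕ))
    (hsmall : ∀ ω, ∀ j < K, ∀ i < min (2 ^ (j + 1)) (n + 1),
      ‖((newtonPre n P (τ ω) (newtonIter n P (τ ω) j)).coeff i).toComplex‖ ≤ 2 ^ (4 * P))
    [Nonempty A.Index]
    (h : Computes A (residues N (2 ^ k)) y (fun ω => residueVec hN (2 ^ k) (τ ω)) a) :
    Computes A (residues N (2 ^ k)) y (fun ω => residueVec hN (2 ^ k) (newtonIter n P (τ ω) K))
      (4 * 2 ^ k + K * (a + 4 * (2 ^ k * (g + 300 * k * N)) + 4000 * (2 ^ k * N))) := by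
  induction K with
  | zero =>
    exact (residues_of_degree_lt hN (fun ω => degree_newtonIter_lt n P (τ ω) 0) le_rfl
      fun c i _ _ => fermat_const (fermatHom hN c ((C (2 ^ P)).coeff i))).mono (by omega)
  | succ j ih =>
    let y' (ω : Ω) : (A.prod (residues N (2 ^ k))).Value :=
      (y ω, residueVec hN (2 ^ k) (newtonIter n P (τ ω) j))
    have step := residues_newtonStep hmul hk hd hP hτ (fun ω => hsmall ω j j.lt_succ_self)
      ((fst (y := y')).trans h) (snd (y := y'))
    refine ((refl.pair (ih fun ω i hi => hsmall ω i (hi.trans j.lt_succ_self))).trans step).mono ?_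
    rw [add_mul]
    omega

theorem residues_reflect_approxRevQuot [Nonempty A.Index]
    (hmul : Computes ((fermat N).prod (fermat N)) (fermat N) id
      (fun p : Fermat N × Fermat N => p.1 * p.2) g) (hk : 2 ^ k ∣ N) (hd : 2 * (n + 1) ≤ 2 ^ k)
    (hP : 4 * P < N - 1) (ht : ∀ ω, (t ω).degree < (n + 1 : ℕ))
    (hsmall : ∀ ω, ∀ j < K, ∀ i < min (2 ^ (j + 1)) (n + 1), ‖((newtonPre n P (reflect n (t ω))
      (newtonIter n P (reflect n (t ω)) j)).coeff i).toComplex‖ ≤ 2 ^ (4 * P))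
    (h : Computes A (residues N (2 * n + 1)) y (fun ω => residueVec hN (2 * n + 1) (s ω)) 0)
    (h' : Computes A (residues N (n + 1)) y (fun ω => residueVec hN (n + 1) (t ω)) 0) :
    Computes A (residues N (2 ^ k)) y
      (fun ω => residueVec hN (2 ^ k) (reflect n (approxRevQuot n P K (s ω) (t ω))))
      ((12 + 4 * K) * 2 ^ k + (4 * K + 2) * (2 ^ k * (g + 300 * k * N)) +
        K * (4000 * (2 ^ k * N))) := by
  have revDivisor := h'.residues_reindex (L' := 2 ^ k) (fun ω => degree_reflect_lt (ht ω)) (n - ·)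
    (fun i _ => by omega) fun ω i hi => coeff_reflect_of_le (t ω) (Nat.lt_succ_iff.mp hi)
  have inverse := residues_newtonIter hmul hk hd hP (fun ω => degree_reflect_lt (ht ω)) hsmall
    revDivisor
  have revDividend := h.residues_reindex (L' := 2 ^ k)
    (fun ω => degree_truncate_lt (n + 1) (reflect (2 * n) (s ω))) (2 * n - ·)
    (fun i _ => by omega) fun ω i hi => by
      rw [coeff_truncate, if_pos hi, coeff_reflect_of_le _ (by omega)]
  have product := residues_mul hmul hN hk hd (fun ω => degree_truncate_lt _ _)
    (fun ω => degree_newtonIter_lt _ _ _ _) revDividend inverse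
  refine (product.residues_reindex (f' := fun ω => reflect n (approxRevQuot n P K (s ω) (t ω)))
    (fun ω => degree_reflect_lt (degree_truncate_lt _ _)) (n - ·) (fun i _ => by omega)
    fun ω i hi => ?_).mono (le_of_eq (by ring))
  rw [coeff_reflect_of_le _ (Nat.lt_succ_iff.mp hi), approxRevQuot, coeff_truncate,
    if_pos (by omega)]

theorem residues_two_pow_mul {L : ℕ} {f : Ω → GaussianInt[X]}
    (h : Computes A (residues N L) y (fun ω => residueVec hN L (f ω)) a) (e : ℕ) :
    Computes A (residues N L) y (fun ω => residueVec hN L (C (2 ^ e) * f ω)) a := by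
  refine (h.trans ((residues_of_coeff (g := 0) hN fun c i => ?_).mono (by simp))).mono
    (add_zero a).le
  refine ((residue_coeff refl c i.2).andThen (fermat_two_pow_mul e)).congr fun ω => ?_
  rw [coeff_C_mul, map_mul, map_pow, map_ofNat]

theorem residues_sub_truncate {f f' : Ω → GaussianInt[X]} {b L L' M : ℕ} (hL : L' ≤ L) (hM : L' ≤ M)
    (h : Computes A (residues N L) y (fun ω => residueVec hN L (f ω)) a)
    (h' : Computes A (residues N M) y (fun ω => residueVec hN M (f' ω)) b) :
    Computes A (residues N L') y
      (fun ω => residueVec hN L' (truncate L' (f ω - f' ω))) (a + b + 200 * (L' * N)) := by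
  refine ((h.pair h').trans (residues_of_coeff (g := 100 * N) hN fun c i => ?_)).mono
    (le_of_eq (by ring))
  refine (((residue_coeff fst c (i.2.trans_le hL)).fermat_sub
    (residue_coeff snd c (i.2.trans_le hM))).mono (by omega)).congr fun ω => ?_
  rw [coeff_truncate, if_pos i.2, coeff_sub, map_sub]

theorem residues_approxRem
    (hmul : Computes ((fermat N).prod (fermat N)) (fermat N) id
      (fun p : Fermat N × Fermat N => p.1 * p.2) g) (hk : 2 ^ k ∣ N) (hd : 2 * (n + 1) ≤ 2 ^ k)
    (ht : ∀ ω, (t ω).degree < (n + 1 : ℕ))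
    (h : Computes A (residues N (2 * n + 1)) y (fun ω => residueVec hN (2 * n + 1) (s ω)) 0)
    (h' : Computes A (residues N (n + 1)) y (fun ω => residueVec hN (n + 1) (t ω)) 0)
    (hQ : Computes A (residues N (2 ^ k)) y
      (fun ω => residueVec hN (2 ^ k) (reflect n (approxRevQuot n P K (s ω) (t ω)))) 0) :
    Computes A (residues N n) y (fun ω => residueVec hN n (approxRem n P K (s ω) (t ω)))
      (4 * 2 ^ k + 2 * (2 ^ k * (g + 300 * k * N)) + 200 * (n * N)) := by
  have divisor := h'.residues_reindex (L' := 2 ^ k) ht id (fun _ hi => hi) fun _ _ _ => rfl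
  have prod := residues_mul hmul hN hk hd ht
    (fun ω => degree_reflect_lt (degree_truncate_lt _ _)) divisor hQ
  exact (residues_sub_truncate (by omega) (by omega) (h.residues_two_pow_mul (2 * P)) prod).mono
    (le_of_eq (by ring))

end division

theorem int_approxDivision {Ω : Type*} {w n P K k g : ℕ} {s t : Ω → GaussianInt[X]}
    (hN : 2 ∣ w + 1)
    (hmul : Computes ((fermat (w + 1)).prod (fermat (w + 1))) (fermat (w + 1)) id
      (fun p : Fermat (w + 1) × Fermat (w + 1) => p.1 * p.2) g)
    (hk : 2 ^ k ∣ w + 1) (hd : 2 * (n + 1) ≤ 2 ^ k) (hP : 4 * P < w)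
    (ht : ∀ ω, (t ω).degree < (n + 1 : ℕ))
    (hsmall : ∀ ω, ∀ j < K, ∀ i < min (2 ^ (j + 1)) (n + 1), ‖((newtonPre n P (reflect n (t ω))
      (newtonIter n P (reflect n (t ω)) j)).coeff i).toComplex‖ ≤ 2 ^ (4 * P))
    (hq : ∀ ω i, ‖((approxQuot n P K (s ω) (t ω)).coeff i).toComplex‖ ≤ 2 ^ (4 * P))
    (hr : ∀ ω i, ‖((approxRem n P K (s ω) (t ω)).coeff i).toComplex‖ ≤ 2 ^ (4 * P)) :
    Computes ((residues (w + 1) (2 * n + 1)).prod (residues (w + 1) (n + 1)))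
      ((intParts w (n + 1)).prod (intParts w n))
      (fun ω => (residueVec hN (2 * n + 1) (s ω), residueVec hN (n + 1) (t ω)))
      (fun ω => (coeffParts (n + 1) (approxQuot n P K (s ω) (t ω)),
        coeffParts n (approxRem n P K (s ω) (t ω))))
      ((K + 1) * (4 * (2 ^ k * (g + 300 * k * (w + 1))) + 5000 * (2 ^ k * (w + 1)))) := by
  let A := (residues (w + 1) (2 * n + 1)).prod (residues (w + 1) (n + 1))
  let y (ω : Ω) : A.Value := (residueVec hN (2 * n + 1) (s ω), residueVec hN (n + 1) (t ω))
  let Q (ω : Ω) := reflect n (approxRevQuot n P K (s ω) (t ω))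
  let y' (ω : Ω) : (A.prod (residues (w + 1) (2 ^ k))).Value := (y ω, residueVec hN (2 ^ k) (Q ω))
  have quot : Computes A (residues (w + 1) (2 ^ k)) y (fun ω => residueVec hN (2 ^ k) (Q ω)) _ :=
    residues_reflect_approxRevQuot hmul hk hd hP ht hsmall fst snd
  have quot' := snd (y := y')
  have rem := residues_approxRem hmul hk hd ht
    ((fst (y := y')).trans (fst (y := y))) ((fst (y := y')).trans (snd (y := y))) quot'
  have lt_two_pow {x : ℝ} (hx : x ≤ 2 ^ (4 * P)) : x < 2 ^ w :=
    hx.trans_lt (pow_lt_pow_right₀ one_lt_two hP)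
  have out := (int_of_residues (d := n + 1) (by omega) (quot'.residues_two_pow_mul P)
    fun ω i => lt_two_pow (hq ω i)).pair
    (int_of_residues le_rfl rem fun ω i => lt_two_pow (hr ω i))
  refine ((refl.pair quot).trans out).mono ?_
  have hL : 2 ^ k ≤ 2 ^ k * (w + 1) := Nat.le_mul_of_pos_right _ w.succ_pos
  have hU : 2 * (n + 1) * (w + 1) ≤ 2 ^ k * (w + 1) := Nat.mul_le_mul_right _ hd
  have hK : K * 2 ^ k ≤ K * (2 ^ k * (w + 1)) := Nat.mul_le_mul_left _ hL
  generalize 2 ^ k * (g + 300 * k * (w + 1)) = G at *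
  generalize 2 ^ k * (w + 1) = U at *
  nlinarith

end Computes

/-! ### The circuit for the approximate division -/

theorem polyOfBits_eq_ofFn (p : ℕ) {d w : ℕ} (b : PolyBit d w → Bool) :
    polyOfBits p b = ofFn d fun j =>
      GaussianInt.toComplex ⟨(intParts w d).decode b j 0, (intParts w d).decode b j 1⟩ / 2 ^ p := by
  simp only [ofFn_eq_sum_monomial, GaussianInt.toComplex_def]
  rfl

theorem coeff_polyOfBits_of_decode_eq (p : ℕ) {d w : ℕ} {b : PolyBit d w → Bool}
    {f : GaussianInt[X]} (hf : f.degree < d) (hb : (intParts w d).decode b = coeffParts d f)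
    (i : ℕ) : (polyOfBits p b).coeff i = (f.coeff i).toComplex / 2 ^ p := by
  rw [polyOfBits_eq_ofFn, hb]
  by_cases hi : i < d
  · rw [ofFn_coeff_eq_val_of_lt _ hi]
    rfl
  · rw [ofFn_coeff_eq_zero_of_ge _ (not_lt.mp hi),
      (degree_lt_iff_coeff_zero _ _).mp hf i (not_lt.mp hi), map_zero, zero_div]

theorem norm_gaussianShr_mul_two_pow_sub_le (p P : ℕ) (x y : ℤ) :
    ‖(gaussianShr p ⟨x * 2 ^ P, y * 2 ^ P⟩).toComplex / 2 ^ P -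
      GaussianInt.toComplex ⟨x, y⟩ / 2 ^ p‖ ≤ 2 * ((2 : ℝ) ^ P)⁻¹ := by
  have toComplex_mul : GaussianInt.toComplex ⟨x * 2 ^ P, y * 2 ^ P⟩ =
      GaussianInt.toComplex ⟨x, y⟩ * 2 ^ P := by
    simp only [GaussianInt.toComplex_def]
    push_cast
    ring
  rw [← div_eq_mul_inv, le_div_iff₀ (by positivity), ← Complex.norm_ofNat 2, ← norm_pow,
    ← norm_mul, sub_mul, div_mul_cancel₀ _ (pow_ne_zero _ two_ne_zero), div_mul_eq_mul_div,
    ← toComplex_mul, Complex.norm_ofNat]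
  exact norm_gaussianShr_sub_le p _

/-- The polynomial whose coefficients have the given real and imaginary parts, with `p` bits after
the point, rounded to `P` bits after the point. -/
noncomputable def roundInput (p P : ℕ) {d : ℕ} (a : Fin d → Fin 2 → ℤ) : GaussianInt[X] :=
  ofFn d fun j => gaussianShr p ⟨a j 0 * 2 ^ P, a j 1 * 2 ^ P⟩

theorem norm_coeff_roundInput_sub_le (p P : ℕ) {d w : ℕ} (b : PolyBit d w → Bool) (i : ℕ) :
    ‖((roundInput p P ((intParts w d).decode b)).coeff i).toComplex / 2 ^ P -
      (polyOfBits p b).coeff i‖ ≤ 2 * ((2 : ℝ) ^ P)⁻¹ := by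
  rw [roundInput, polyOfBits_eq_ofFn]
  by_cases hi : i < d
  · rw [ofFn_coeff_eq_val_of_lt _ hi, ofFn_coeff_eq_val_of_lt _ hi]
    exact norm_gaussianShr_mul_two_pow_sub_le p P _ _
  · rw [ofFn_coeff_eq_zero_of_ge _ (not_lt.mp hi), ofFn_coeff_eq_zero_of_ge _ (not_lt.mp hi),
      map_zero, zero_div, sub_zero, norm_zero]
    positivity

theorem norm_coeff_roundInput_error_le (p : ℕ) {P : ℕ} {η : ℝ} (hP : ((2 : ℝ) ^ P)⁻¹ ≤ η)
    {d w : ℕ} {b : PolyBit d w → Bool} {f : ℂ[X]} (hf : (f - polyOfBits p b).supNorm ≤ η) (i : ℕ) :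
    ‖((roundInput p P ((intParts w d).decode b)).coeff i).toComplex / 2 ^ P - f.coeff i‖ ≤
      3 * η := by
  have rounding := norm_coeff_roundInput_sub_le p P b i
  have input := supNorm_le_iff.mp hf i
  rw [coeff_sub, norm_sub_rev] at input
  linarith [norm_sub_le_norm_sub_add_norm_sub
    (((roundInput p P ((intParts w d).decode b)).coeff i).toComplex / 2 ^ P)
    ((polyOfBits p b).coeff i) (f.coeff i)]

theorem IsDivision.divApprox_roundInput {n : ℕ} (hn : 2 ≤ n) {ℓ τ₁ τ₂ ρ : ℝ} (hℓ : 0 ≤ ℓ)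
    (hτ₁ : 0 ≤ τ₁) (hτ₂ : 0 ≤ τ₂) (hρ : 1 ≤ ρ) {P : ℕ} (hP : divPrecision n ℓ τ₁ τ₂ ρ ≤ P)
    {s t q r : ℂ[X]} (h : IsDivision n τ₁ τ₂ ρ s t q r) {p w : ℕ}
    {x : PolyBit (2 * n + 1) w ⊕ PolyBit (n + 1) w → Bool}
    (hs : (s - polyOfBits p (fun i => x (Sum.inl i))).supNorm ≤ 2 ^ (-divPrecision n ℓ τ₁ τ₂ ρ))
    (ht : (t - polyOfBits p (fun i => x (Sum.inr i))).supNorm ≤ 2 ^ (-divPrecision n ℓ τ₁ τ₂ ρ)) :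
    DivApprox n P (Nat.clog 2 (n + 1)) (2 ^ τ₁) (2 ^ (n * (ρ + 2)))
      (2 ^ (-divPrecision n ℓ τ₁ τ₂ ρ)) τ₁ τ₂ ρ s t q r
      (roundInput p P (((intParts w (2 * n + 1)).prod (intParts w (n + 1))).decode x).1)
      (roundInput p P (((intParts w (2 * n + 1)).prod (intParts w (n + 1))).decode x).2) := by
  have inv_two_pow_le : ((2 : ℝ) ^ P)⁻¹ ≤ 2 ^ (-divPrecision n ℓ τ₁ τ₂ ρ) := by
    rw [← Real.rpow_natCast, ← Real.rpow_neg zero_le_two]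
    exact Real.rpow_le_rpow_of_exponent_le one_le_two (neg_le_neg hP)
  exact h.divApprox hn hℓ hτ₁ hτ₂ hρ hP (norm_coeff_roundInput_error_le p inv_two_pow_le hs)
    (norm_coeff_roundInput_error_le p inv_two_pow_le ht)

namespace Computes

theorem residues_roundInput {Ω : Type*} {N d w p P K : ℕ} [NeZero N] (hN : 2 ∣ N) (hK : K < N)
    {y : Ω → Fin d → Fin 2 → ℤ}
    (hy : ∀ ω i, ‖((roundInput p P (y ω)).coeff i).toComplex‖ < 2 ^ K) :
    Computes (intParts w d) (residues N d) y (fun ω => residueVec hN d (roundInput p P (y ω)))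
      (2 * (d * (700 * N))) := by
  refine residues_of_coeff hN fun c i => ?_
  have coeff_eq (ω : Ω) : (roundInput p P (y ω)).coeff i =
      gaussianShr p ⟨y ω i 0 * 2 ^ P, y ω i 1 * 2 ^ P⟩ :=
    ofFn_coeff_eq_val_of_lt _ i.2
  have part (e : Fin 2) (he : ∀ ω, |y ω i e * 2 ^ P / 2 ^ p| < 2 ^ K) :
      Computes (intParts w d) (fermat N) y
        (fun ω => ((y ω i e * 2 ^ P / 2 ^ p : ℤ) : Fermat N)) (300 * N) :=
    ((proj (A := (int w).pow (Fin 2)) i).trans ((proj (A := int w) e).trans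
      (fermat_of_int hK (fun ω => (abs_lt.mp (he ω)).1.le) fun ω => (abs_lt.mp (he ω)).2))).mono
        (by omega)
  have bounds (ω : Ω) := abs_re_im_lt_of_norm_lt (coeff_eq ω ▸ hy ω i)
  refine (((part 0 fun ω => (bounds ω).1).fermat_add
    ((part 1 fun ω => (bounds ω).2).andThen (fermat_two_pow_mul (N / 2 + c * N)))).mono
    (by omega)).congr fun ω => ?_
  rw [coeff_eq, fermatHom_apply, gaussianShr]

theorem int_roundedDivision {Ω : Type*} {n P p w w' K k g : ℕ} (hN : 2 ∣ w' + 1)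
    (hmul : Computes ((fermat (w' + 1)).prod (fermat (w' + 1))) (fermat (w' + 1)) id
      (fun p : Fermat (w' + 1) × Fermat (w' + 1) => p.1 * p.2) g)
    (hk : 2 ^ k ∣ w' + 1) (hd : 2 * (n + 1) ≤ 2 ^ k) (hP : 4 * P < w')
    {y : Ω → ((intParts w (2 * n + 1)).prod (intParts w (n + 1))).Value}
    (hy : ∀ ω, ∃ A B η τ₁ τ₂ ρ s t q r, DivApprox n P K A B η τ₁ τ₂ ρ s t q r
      (roundInput p P (y ω).1) (roundInput p P (y ω).2)) :
    Computes ((intParts w (2 * n + 1)).prod (intParts w (n + 1)))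
      ((intParts w' (n + 1)).prod (intParts w' n)) y
      (fun ω =>
        (coeffParts (n + 1) (approxQuot n P K (roundInput p P (y ω).1) (roundInput p P (y ω).2)),
          coeffParts n (approxRem n P K (roundInput p P (y ω).1) (roundInput p P (y ω).2))))
      ((K + 2) * (4 * (2 ^ k * (g + 300 * k * (w' + 1))) + 5000 * (2 ^ k * (w' + 1)))) := by
  have lt_two_pow {x : ℝ} (hx : x ≤ 2 ^ (2 * P)) : x < 2 ^ (2 * P + 1) :=
    hx.trans_lt (pow_lt_pow_right₀ one_lt_two (Nat.lt_succ_self _))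
  have dividend := (fst (y := y)).trans (residues_roundInput hN (K := 2 * P + 1) (by omega)
    fun ω i => by
      obtain ⟨A, B, η, τ₁, τ₂, ρ, s, t, q, r, h⟩ := hy ω
      exact lt_two_pow (h.norm_dividend_le i))
  have divisor := (snd (y := y)).trans (residues_roundInput hN (K := 2 * P + 1) (by omega)
    fun ω i => by
      obtain ⟨A, B, η, τ₁, τ₂, ρ, s, t, q, r, h⟩ := hy ω
      exact lt_two_pow (h.norm_divisor_le i))
  have division := int_approxDivision (K := K) (s := fun ω => roundInput p P (y ω).1) hN hmul hk hd
    hP (fun ω => ofFn_degree_lt _)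
    (fun ω j hj i hi => by
      obtain ⟨A, B, η, τ₁, τ₂, ρ, s, t, q, r, h⟩ := hy ω
      exact h.norm_newtonPre_le hj hi)
    (fun ω i => by
      obtain ⟨A, B, η, τ₁, τ₂, ρ, s, t, q, r, h⟩ := hy ω
      exact h.norm_approxQuot_le i)
    (fun ω i => by
      obtain ⟨A, B, η, τ₁, τ₂, ρ, s, t, q, r, h⟩ := hy ω
      exact h.norm_approxRem_le i)
  refine ((dividend.pair divisor).trans division).mono ?_
  have hU : 2 * (n + 1) * (w' + 1) ≤ 2 ^ k * (w' + 1) := Nat.mul_le_mul_right _ hd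
  generalize 2 ^ k * (g + 300 * k * (w' + 1)) = G at *
  generalize 2 ^ k * (w' + 1) = U at *
  nlinarith

end Computes

theorem DivApprox.supNorm_sub_polyOfBits_le {n P K : ℕ} {A B η τ₁ τ₂ ρ ε : ℝ} {s t q r : ℂ[X]}
    {s' t' : GaussianInt[X]} (h : DivApprox n P K A B η τ₁ τ₂ ρ s t q r s' t')
    (hε : 34 * (n + 1) * A * B ^ 2 * newtonError n B η K ≤ ε) {w : ℕ}
    {b : PolyBit (n + 1) w ⊕ PolyBit n w → Bool}
    (hb : ((intParts w (n + 1)).prod (intParts w n)).decode b =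
      (coeffParts (n + 1) (approxQuot n P K s' t'), coeffParts n (approxRem n P K s' t'))) :
    (q - polyOfBits (3 * P) (fun i => b (Sum.inl i))).supNorm ≤ ε ∧
      (r - polyOfBits (3 * P) (fun i => b (Sum.inr i))).supNorm ≤ ε := by
  obtain ⟨quot_eq, rem_eq⟩ := Prod.ext_iff.mp hb
  constructor <;> refine supNorm_le_iff.mpr fun i => ?_
  · rw [coeff_sub, coeff_polyOfBits_of_decode_eq (b := fun i => b (Sum.inl i)) _
      (degree_approxQuot_lt n P K s' t') quot_eq]
    exact (h.norm_approxQuot_error_le i).trans hε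
  · rw [coeff_sub, coeff_polyOfBits_of_decode_eq (b := fun i => b (Sum.inr i)) _
      (degree_truncate_lt _ _) rem_eq]
    exact (h.norm_approxRem_error_le i).trans hε

theorem exists_solvesDivision {n : ℕ} (hn : 2 ≤ n) {ℓ τ₁ τ₂ ρ : ℝ} (hℓ : 0 ≤ ℓ) (hτ₁ : 0 ≤ τ₁)
    (hτ₂ : 0 ≤ τ₂) (hρ : 1 ≤ ρ) {P k g w' : ℕ} (hP : divPrecision n ℓ τ₁ τ₂ ρ ≤ P)
    (hN : 2 ∣ w' + 1)
    (hmul : Computes ((fermat (w' + 1)).prod (fermat (w' + 1))) (fermat (w' + 1)) id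
      (fun p : Fermat (w' + 1) × Fermat (w' + 1) => p.1 * p.2) g) (hk : 2 ^ k ∣ w' + 1)
    (hd : 2 * (n + 1) ≤ 2 ^ k) (hPw : 4 * P < w') (p w : ℕ) :
    ∃ F, SolvesDivision n ℓ τ₁ τ₂ ρ p w (3 * P) w' F ∧
      ComputableWithin F ((Nat.clog 2 (n + 1) + 2) *
        (4 * (2 ^ k * (g + 300 * k * (w' + 1))) + 5000 * (2 ^ k * (w' + 1)))) := by
  let A := (intParts w (2 * n + 1)).prod (intParts w (n + 1))
  let lam := divPrecision n ℓ τ₁ τ₂ ρ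
  let ValidInput := {x : A.Index → Bool // ∃ s t q r : ℂ[X], IsDivision n τ₁ τ₂ ρ s t q r ∧
    (s - polyOfBits p (fun i => x (Sum.inl i))).supNorm ≤ 2 ^ (-lam) ∧
    (t - polyOfBits p (fun i => x (Sum.inr i))).supNorm ≤ 2 ^ (-lam)}
  have circuit := Computes.int_roundedDivision (p := p) (K := Nat.clog 2 (n + 1)) hN hmul hk hd hPw
    (y := fun x : ValidInput => A.decode x.1) (by
      rintro ⟨x, s, t, q, r, h, hs, ht⟩
      exact ⟨_, _, _, _, _, _, s, t, q, r, h.divApprox_roundInput hn hℓ hτ₁ hτ₂ hρ hP hs ht⟩)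
  obtain ⟨F, hF, decode_eq⟩ := circuit
  exact ⟨F, fun s t q r h x hs ht =>
    (h.divApprox_roundInput hn hℓ hτ₁ hτ₂ hρ hP hs ht).supNorm_sub_polyOfBits_le
      (error_bound_le_two_rpow_neg hn ℓ τ₁ hτ₂ hρ)
      (decode_eq ⟨x, s, t, q, r, h, hs, ht⟩ x rfl), hF⟩

/-! ### The number of gates -/

theorem lg_mono {x y : ℝ} (hx : 0 < x) (hxy : x ≤ y) : lg x ≤ lg y :=
  Real.logb_le_logb_of_le one_lt_two hx hxy

theorem exists_mulCost_le : ∃ D : ℝ, 1 ≤ D ∧ ∀ m : ℕ, 2 ≤ m →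
    (mulCost m : ℝ) ≤ D * (m * lg m ^ 10) := by
  obtain ⟨C, hC⟩ := exists_computesMul_two_pow
  refine ⟨2 * 3 ^ 10 * C + 6, by linarith [C.cast_nonneg (α := ℝ)], fun m hm => ?_⟩
  have hm2 : (2 : ℝ) ≤ m := by exact_mod_cast hm
  have one_le := one_le_lg hm2
  have : NeZero m := ⟨by omega⟩
  have cost_le : (mulCost m : ℝ) ≤ C * 2 ^ Nat.clog 2 m * (Nat.clog 2 m + 1) ^ 10 + 6 := by
    exact_mod_cast ((hC _).of_le (Nat.le_pow_clog one_lt_two m)).mulCost_le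
  have pow_le : (2 : ℝ) ^ Nat.clog 2 m ≤ 2 * m := by
    exact_mod_cast (two_pow_clog_le hm).trans (Nat.mul_le_mul_left 2 (Nat.sub_le m 1))
  have clog_le : (Nat.clog 2 m : ℝ) ≤ 2 * lg m :=
    (Nat.cast_le.mpr (Nat.clog_mono_right 2 m.le_succ)).trans (clog_succ_le_two_mul_lg hm)
  calc (mulCost m : ℝ) ≤ C * (2 * m) * (3 * lg m) ^ 10 + 6 := by
        refine cost_le.trans ?_
        gcongr
        linarith
    _ = 2 * 3 ^ 10 * C * (m * lg m ^ 10) + 6 := by ring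
    _ ≤ (2 * 3 ^ 10 * C + 6) * (m * lg m ^ 10) := by
        linarith [one_le_mul_of_one_le_of_one_le (by linarith : (1 : ℝ) ≤ m)
          (one_le_pow₀ one_le (n := 10))]

theorem divPrecision_le {n : ℕ} (hn : 2 ≤ n) {ℓ τ₁ τ₂ ρ : ℝ} (hℓ : 0 ≤ ℓ) (hτ₁ : 0 ≤ τ₁)
    (hτ₂ : 0 ≤ τ₂) (hρ : 1 ≤ ρ) :
    divPrecision n ℓ τ₁ τ₂ ρ ≤ 115 * (ℓ + τ₁ + τ₂ * lg n + n * ρ * lg n) := by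
  have hn2 : (2 : ℝ) ≤ n := by exact_mod_cast hn
  have one_le := one_le_lg hn2
  have lg_le := lg_natCast_le (n := n) (by omega)
  have sq_le : lg n ^ 2 ≤ n * lg n := by nlinarith
  have le_mul_rho : n * lg n ≤ n * ρ * lg n := by
    gcongr
    exact le_mul_of_one_le_right (by positivity) hρ
  rw [divPrecision]
  nlinarith [show 0 ≤ τ₂ * lg n by positivity]

/-- The number of bits of the integers that the division multiplies, up to a constant factor. -/
noncomputable def operandSize (n : ℕ) (ℓ τ₁ τ₂ ρ : ℝ) : ℝ := ℓ + τ₁ + (τ₂ + n * ρ) * lg n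

section operandSize

variable {n : ℕ} {ℓ τ₁ τ₂ ρ : ℝ}

theorem natCast_le_operandSize (hn : 2 ≤ n) (hℓ : 0 ≤ ℓ) (hτ₁ : 0 ≤ τ₁) (hτ₂ : 0 ≤ τ₂)
    (hρ : 1 ≤ ρ) : n ≤ operandSize n ℓ τ₁ τ₂ ρ := by
  have one_le := one_le_lg (x := n) (by exact_mod_cast hn)
  have le_mul_rho : (n : ℝ) ≤ n * ρ := le_mul_of_one_le_right (by positivity) hρ
  have le_mul_lg : τ₂ + n * ρ ≤ (τ₂ + n * ρ) * lg n := le_mul_of_one_le_right (by positivity) one_le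
  rw [operandSize]
  linarith

theorem operandSize_le_divPrecision (hn : 2 ≤ n) (hτ₂ : 0 ≤ τ₂) (hρ : 0 ≤ ρ) :
    operandSize n ℓ τ₁ τ₂ ρ ≤ divPrecision n ℓ τ₁ τ₂ ρ := by
  have one_le := one_le_lg (x := n) (by exact_mod_cast hn)
  have hτ₂' : 0 ≤ τ₂ * lg n := by positivity
  have hρ' : 0 ≤ n * ρ * lg n := by positivity
  have hn' : 0 ≤ n * lg n := by positivity
  rw [operandSize, divPrecision]
  nlinarith [sq_nonneg (lg n)]

theorem natCast_mul_operandSize_le (hn : 2 ≤ n) (hℓ : 0 ≤ ℓ) (hτ₁ : 0 ≤ τ₁) :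
    n * operandSize n ℓ τ₁ τ₂ ρ ≤ (n * ℓ + n * τ₁ + n * τ₂ + n ^ 2 * ρ) * lg n := by
  have one_le := one_le_lg (x := n) (by exact_mod_cast hn)
  have le_mul_lg : ℓ + τ₁ ≤ (ℓ + τ₁) * lg n := le_mul_of_one_le_right (by positivity) one_le
  calc n * operandSize n ℓ τ₁ τ₂ ρ ≤ n * ((ℓ + τ₁) * lg n + (τ₂ + n * ρ) * lg n) := by
        rw [operandSize]
        gcongr
    _ = (n * ℓ + n * τ₁ + n * τ₂ + n ^ 2 * ρ) * lg n := by ring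

theorem ceil_divPrecision_le (hn : 2 ≤ n) (hℓ : 0 ≤ ℓ) (hτ₁ : 0 ≤ τ₁) (hτ₂ : 0 ≤ τ₂)
    (hρ : 1 ≤ ρ) : ⌈divPrecision n ℓ τ₁ τ₂ ρ⌉₊ ≤ 116 * ⌈operandSize n ℓ τ₁ τ₂ ρ⌉₊ := by
  have hn2 : (2 : ℝ) ≤ n := by exact_mod_cast hn
  have le_size := natCast_le_operandSize hn hℓ hτ₁ hτ₂ hρ
  refine Nat.ceil_le.mpr ?_
  push_cast
  calc divPrecision n ℓ τ₁ τ₂ ρ ≤ 115 * (ℓ + τ₁ + τ₂ * lg n + n * ρ * lg n) :=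
        divPrecision_le hn hℓ hτ₁ hτ₂ hρ
    _ = 115 * operandSize n ℓ τ₁ τ₂ ρ := by rw [operandSize]; ring
    _ ≤ 116 * ⌈operandSize n ℓ τ₁ τ₂ ρ⌉₊ := by
        linarith [Nat.le_ceil (operandSize n ℓ τ₁ τ₂ ρ)]

end operandSize

theorem exists_multiple_between (a : ℕ) {L : ℕ} (hL : 0 < L) : ∃ N, L ∣ N ∧ a < N ∧ N ≤ a + L :=
  ⟨L * (a / L + 1), dvd_mul_right _ _, Nat.lt_mul_div_succ _ hL, by
    rw [mul_add, mul_one]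
    exact Nat.add_le_add_right (Nat.mul_div_le _ _) _⟩

theorem division_gates_le {n N μ : ℕ} (hn : 2 ≤ n) (hμ : 1 ≤ μ) (hN : N ≤ 470 * μ) :
    ((Nat.clog 2 (n + 1) + 2) * (4 * (2 ^ (Nat.clog 2 (n + 1) + 1) *
      (940 * 940 * (μ + 6 + 100 * N) + 2 + 300 * (Nat.clog 2 (n + 1) + 1) * N)) +
        5000 * (2 ^ (Nat.clog 2 (n + 1) + 1) * N)) : ℝ) ≤
      4 * (16 * (940 * 940 * 47007 + 2 + 300 * 3 * 470) + 20000 * 470) * (n * lg n ^ 2 * μ) := by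
  have one_le := one_le_lg (x := n) (by exact_mod_cast hn)
  have clog_le := clog_succ_le_two_mul_lg hn
  have two_pow_le : (2 : ℝ) ^ (Nat.clog 2 (n + 1) + 1) ≤ 4 * n := by
    have := two_pow_clog_le (m := n + 1) (by omega)
    rw [Nat.add_sub_cancel] at this
    exact_mod_cast (by omega : 2 ^ (Nat.clog 2 (n + 1) + 1) ≤ 4 * n)
  have two_pow_nonneg : (0 : ℝ) ≤ 2 ^ (Nat.clog 2 (n + 1) + 1) := by positivity
  have clog_nonneg : (0 : ℝ) ≤ Nat.clog 2 (n + 1) := Nat.cast_nonneg _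
  generalize (2 : ℝ) ^ (Nat.clog 2 (n + 1) + 1) = L at *
  generalize (Nat.clog 2 (n + 1) : ℝ) = K at *
  have hN' : (N : ℝ) ≤ 470 * μ := by exact_mod_cast hN
  have hμ' : (1 : ℝ) ≤ μ := by exact_mod_cast hμ
  have le_lg_mul : (μ : ℝ) ≤ lg n * μ := le_mul_of_one_le_left (by positivity) one_le
  have mul_gates_le :
      (940 * 940 * (μ + 6 + 100 * N) + 2 : ℝ) ≤ (940 * 940 * 47007 + 2) * (lg n * μ) := by
    linarith
  have twist_gates_le : 300 * (K + 1) * N ≤ 300 * (3 * lg n) * (470 * μ) := by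
    gcongr
    linarith
  calc _ ≤ 4 * lg n * (4 * (4 * n * ((940 * 940 * 47007 + 2) * (lg n * μ) +
        300 * (3 * lg n) * (470 * μ))) + 5000 * (4 * n * (470 * (lg n * μ)))) := by
        gcongr <;> linarith
    _ = _ := by ring

theorem exists_divisionGates : ∃ C : ℝ, 0 ≤ C ∧ ∀ n : ℕ, 2 ≤ n → ∀ ℓ τ₁ τ₂ ρ : ℝ,
    0 ≤ ℓ → 0 ≤ τ₁ → 0 ≤ τ₂ → 1 ≤ ρ → ∀ p w : ℕ,
      ∃ (p' w' g : ℕ) (F : (PolyBit (2 * n + 1) w ⊕ PolyBit (n + 1) w → Bool) →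
          PolyBit (n + 1) w' ⊕ PolyBit n w' → Bool),
        SolvesDivision n ℓ τ₁ τ₂ ρ p w p' w' F ∧ ComputableWithGates F g ∧
        (g : ℝ) ≤ C * (n * lg n ^ 2 * mulCost ⌈operandSize n ℓ τ₁ τ₂ ρ⌉₊) := by
  refine ⟨4 * (16 * (940 * 940 * 47007 + 2 + 300 * 3 * 470) + 20000 * 470), by norm_num, ?_⟩
  intro n hn ℓ τ₁ τ₂ ρ hℓ hτ₁ hτ₂ hρ p w
  have le_size : n ≤ ⌈operandSize n ℓ τ₁ τ₂ ρ⌉₊ := by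
    exact_mod_cast (natCast_le_operandSize hn hℓ hτ₁ hτ₂ hρ).trans (Nat.le_ceil _)
  have size_le := Nat.ceil_le_ceil
    (operandSize_le_divPrecision (ℓ := ℓ) (τ₁ := τ₁) hn hτ₂ (zero_le_one.trans hρ))
  have precision_le := ceil_divPrecision_le hn hℓ hτ₁ hτ₂ hρ
  have le_precision := Nat.le_ceil (divPrecision n ℓ τ₁ τ₂ ρ)
  generalize ⌈operandSize n ℓ τ₁ τ₂ ρ⌉₊ = M at *
  generalize ⌈divPrecision n ℓ τ₁ τ₂ ρ⌉₊ = P at *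
  have le_two_pow := Nat.le_pow_clog one_lt_two (n + 1)
  have two_pow_le := two_pow_clog_le (m := n + 1) (by omega)
  rw [Nat.add_sub_cancel] at two_pow_le
  obtain ⟨N, dvd_N, lt_N, N_le⟩ :=
    exists_multiple_between (4 * P + 2) (Nat.two_pow_pos (Nat.clog 2 (n + 1) + 1))
  obtain ⟨w', rfl⟩ : ∃ w', N = w' + 1 := Nat.exists_eq_succ_of_ne_zero (by omega)
  have block_le : w' + 1 ≤ 470 * M := by
    rw [pow_succ'] at N_le
    omega
  have : NeZero M := ⟨by omega⟩
  have hmul := Computes.fermat_mul_of_blocks (N := w' + 1) (M := M) (c := 940) (by omega) (by omega)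
    (computesMul_mulCost M)
  obtain ⟨F, hF, g, hg, hgF⟩ := exists_solvesDivision hn hℓ hτ₁ hτ₂ hρ le_precision
    ((dvd_pow_self 2 (Nat.succ_ne_zero _)).trans dvd_N) hmul dvd_N (by omega) (by omega) p w
  have size_le_cost := le_mulCost M
  refine ⟨_, _, g, F, hF, hgF, le_trans ?_
    (division_gates_le (N := w' + 1) (μ := mulCost M) hn (by omega) (by omega))⟩
  exact_mod_cast hg

theorem exists_gates_le_quasilinear : ∃ D : ℝ, 1 ≤ D ∧ ∀ n : ℕ, 2 ≤ n → ∀ ℓ τ₁ τ₂ ρ : ℝ,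
    0 ≤ ℓ → 0 ≤ τ₁ → 0 ≤ τ₂ → 1 ≤ ρ →
      (n * lg n ^ 2 * mulCost ⌈operandSize n ℓ τ₁ τ₂ ρ⌉₊ : ℝ) ≤
        D * ((n * ℓ + n * τ₁ + n * τ₂ + n ^ 2 * ρ) *
          lg (n * ℓ + n * τ₁ + n * τ₂ + n ^ 2 * ρ) ^ 13) := by
  obtain ⟨D, hD, mulCost_le⟩ := exists_mulCost_le
  refine ⟨2 ^ 11 * D, by linarith, ?_⟩
  intro n hn ℓ τ₁ τ₂ ρ hℓ hτ₁ hτ₂ hρ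
  have one_le := one_le_lg (x := n) (by exact_mod_cast hn)
  have hn2 : (2 : ℝ) ≤ n := by exact_mod_cast hn
  have le_size := natCast_le_operandSize hn hℓ hτ₁ hτ₂ hρ
  have mul_size_le := natCast_mul_operandSize_le (τ₂ := τ₂) (ρ := ρ) hn hℓ hτ₁
  have sq_le : (n : ℝ) ^ 2 ≤ n * ℓ + n * τ₁ + n * τ₂ + n ^ 2 * ρ := by
    have : (n : ℝ) ^ 2 ≤ n ^ 2 * ρ := le_mul_of_one_le_right (by positivity) hρ
    linarith [show 0 ≤ n * ℓ + n * τ₁ + n * τ₂ by positivity]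
  have lg_le_self := lg_natCast_le (n := n) (by omega)
  generalize operandSize n ℓ τ₁ τ₂ ρ = Z at *
  generalize n * ℓ + n * τ₁ + n * τ₂ + n ^ 2 * ρ = X at *
  have size_le : Z ≤ X := by nlinarith
  have size_nonneg : 0 ≤ Z := by linarith
  have two_le_ceil : 2 ≤ ⌈Z⌉₊ := hn.trans (by exact_mod_cast le_size.trans (Nat.le_ceil Z))
  have ceil_le : (⌈Z⌉₊ : ℝ) ≤ 2 * Z := by linarith [Nat.ceil_lt_add_one (a := Z) (by linarith)]
  have lg_le : lg n ≤ lg X := lg_mono (by linarith) (by nlinarith)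
  have lg_ceil_le : lg ⌈Z⌉₊ ≤ 2 * lg X := by
    have := lg_mono (by positivity) (by linarith : (⌈Z⌉₊ : ℝ) ≤ 2 * X)
    rw [lg_two_mul (by nlinarith)] at this
    linarith
  have one_le_lg_ceil := one_le_lg (x := ⌈Z⌉₊) (by exact_mod_cast two_le_ceil)
  have mul_size_le' : n * Z ≤ X * lg X := mul_size_le.trans (by gcongr; nlinarith)
  have mul_lg_nonneg : 0 ≤ X * lg X := le_trans (by positivity) mul_size_le'
  calc (n * lg n ^ 2 * mulCost ⌈Z⌉₊ : ℝ) ≤ n * lg n ^ 2 * (D * (⌈Z⌉₊ * lg ⌈Z⌉₊ ^ 10)) := by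
        gcongr
        exact mulCost_le _ two_le_ceil
    _ ≤ n * lg n ^ 2 * (D * (2 * Z * (2 * lg X) ^ 10)) := by gcongr
    _ = 2 ^ 11 * D * (n * Z * lg n ^ 2 * lg X ^ 10) := by ring
    _ ≤ 2 ^ 11 * D * (X * lg X * lg X ^ 2 * lg X ^ 10) := by gcongr
    _ = 2 ^ 11 * D * (X * lg X ^ 13) := by ring

theorem mainTheorem2 :
    -- the size of the input precision
    (∃ C : ℝ, ∀ n : ℕ, 2 ≤ n → ∀ ℓ τ₁ τ₂ ρ : ℝ, 0 ≤ ℓ → 0 ≤ τ₁ → 0 ≤ τ₂ → 1 ≤ ρ →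
      divPrecision n ℓ τ₁ τ₂ ρ ≤ C * (ℓ + τ₁ + τ₂ * lg n + n * ρ * lg n)) ∧
    -- the norms of the quotient and the remainder
    (∀ n : ℕ, 1 ≤ n → ∀ τ₁ τ₂ ρ : ℝ, 0 ≤ ρ → ∀ s t q r : Polynomial ℂ,
      IsDivision n τ₁ τ₂ ρ s t q r →
        q.supNorm ≤ 2 ^ (2 * n + lg n + 1 + n * ρ + τ₁) ∧
        r.supNorm ≤ 2 ^ (3 * n + lg n + 1 + 2 * n * ρ + τ₁)) ∧
    -- the approximate division and its Boolean cost
    (∃ (C : ℝ) (k : ℕ), ∀ n : ℕ, 2 ≤ n → ∀ ℓ τ₁ τ₂ ρ : ℝ,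
      0 ≤ ℓ → 0 ≤ τ₁ → 0 ≤ τ₂ → 1 ≤ ρ → ∀ p w : ℕ,
        ∃ (p' w' g : ℕ) (F : (PolyBit (2 * n + 1) w ⊕ PolyBit (n + 1) w → Bool) →
            PolyBit (n + 1) w' ⊕ PolyBit n w' → Bool),
          SolvesDivision n ℓ τ₁ τ₂ ρ p w p' w' F ∧
          ComputableWithGates F g ∧
          (g : ℝ) ≤ C * (n * lg n ^ 2 * mulCost ⌈ℓ + τ₁ + (τ₂ + n * ρ) * lg n⌉₊) ∧
          (g : ℝ) ≤ C * ((n * ℓ + n * τ₁ + n * τ₂ + n ^ 2 * ρ) *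
            lg (n * ℓ + n * τ₁ + n * τ₂ + n ^ 2 * ρ) ^ k)) := by
  obtain ⟨C, C_nonneg, exists_circuit⟩ := exists_divisionGates
  obtain ⟨D, one_le_D, gates_le⟩ := exists_gates_le_quasilinear
  refine ⟨⟨115, fun n hn ℓ τ₁ τ₂ ρ hℓ hτ₁ hτ₂ hρ => divPrecision_le hn hℓ hτ₁ hτ₂ hρ⟩,
    fun n hn τ₁ τ₂ ρ hρ s t q r h => ⟨h.supNorm_quotient_le hn hρ, h.supNorm_remainder_le hn hρ⟩,
    C * D, 13, ?_⟩
  intro n hn ℓ τ₁ τ₂ ρ hℓ hτ₁ hτ₂ hρ p w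
  obtain ⟨p', w', g, F, solves, computable, hg⟩ := exists_circuit n hn ℓ τ₁ τ₂ ρ hℓ hτ₁ hτ₂ hρ p w
  refine ⟨p', w', g, F, solves, computable, hg.trans ?_, hg.trans ?_⟩
  · exact mul_le_mul_of_nonneg_right (le_mul_of_one_le_right C_nonneg one_le_D)
      (by positivity)
  · rw [mul_assoc C D]
    exact mul_le_mul_of_nonneg_left (gates_le n hn ℓ τ₁ τ₂ ρ hℓ hτ₁ hτ₂ hρ) C_nonneg
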